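/- Let $k$ be an algebraically closed field, $d\geqslant 1$ an integer, and $\mathscr T$ a $k$-linear $\operatorname{Hom}$-finite $(d+2)$-angulated category (in the sense of Geiss–Keller–Oppermann) with split idempotents, $d$-suspension $\Sigma^d$, and a Serre functor $S$, i.e. an autoequivalence with natural isomorphisms $D\mathscr T(X,Y)\cong\mathscr T(Y,SX)$, where $D=\operatorname{Hom}_k(-,k)$. Let $T\in\mathscr T$, let $\Gamma=\operatorname{End}_{\mathscr T}T$, let $\operatorname{mod}\Gamma$ be the category of finite dimensional right $\Gamma$-modules, and let $\mathscr D\subseteq\operatorname{mod}\Gamma$ be the essential image of the functor $\mathscr T(T,-):\mathscr T\to\operatorname{mod}\Gamma$. Let $\operatorname{add}T$ be the class of direct summands of finite direct sums of copies of $T$. Consider the following conditions on $T$. * **(a)** Suppose that $M\in\operatorname{mod}\Gamma$ satisfies $\operatorname{Ext}^j_\Gamma(\mathscr D,M)=0$ for $1\leqslant j\leqslant d-1$, and that $f:T_1\to T_0$ is a morphism in $\operatorname{add}T$ for which $\mathscr T(T,T_1)\xrightarrow{\mathscr T(T,f)}\mathscr T(T,T_0)\to M\to 0$ is a minimal projective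 presentation in $\operatorname{mod}\Gamma$. Then there is a completion of $f$ to a $(d+2)$-angle $T_1\xrightarrow{f}T_0\xrightarrow{h_{d+1}}X_d\xrightarrow{h_d}\cdots\xrightarrow{h_2}X_1\xrightarrow{h_1}\Sigma^dT_1$ which satisfies $\mathscr T(T,h_i)=0$ for some $1\leqslant i\leqslant d+1$. * **(a')** Suppose that $N\in\operatorname{mod}\Gamma$ satisfies $\operatorname{Ext}^j_\Gamma(N,\mathscr D)=0$ for $1\leqslant j\leqslant d-1$, and that $g:ST_1\to ST_0$ is a morphism in $\operatorname{add}ST$ for which $0\to N\to\mathscr T(T,ST_1)\xrightarrow{\mathscr T(T,g)}\mathscr T(T,ST_0)$ is a minimal injective copresentation in $\operatorname{mod}\Gamma$. Then there is a completion of $g$ to a $(d+2)$-angle $\Sigma^{-d}ST_0\xrightarrow{h_{d+1}}X_d\xrightarrow{h_d}\cdots\xrightarrow{h_2}X_1\xrightarrow{h_1}ST_1\xrightarrow{g}ST_0$ which satisfies $\mathscr T(T,h_i)=0$ for some $1\leqslant i\leqslant d+1$. * **(b)** Suppose that $X\in\mathscr T$ is indecomposable with $\mathscr T(T,X)\neq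 0$. Then there is a $(d+2)$-angle $T_d\to\cdots\to T_0\to X\xrightarrow{h}\Sigma^dT_d$ with $T_i\in\operatorname{add}T$ for $0\leqslant i\leqslant d$ which satisfies $\mathscr T(T,h)=0$. * **(strong a)** The same as (a), except that the angle is required to satisfy $\mathscr T(T,h_d)=0$. * **(strong a')** The same as (a'), except that the angle is required to satisfy $\mathscr T(T,h_2)=0$. A full subcategory $\mathscr X\subseteq\operatorname{mod}\Gamma$ is called $d$-cluster tilting if it is functorially finite in $\operatorname{mod}\Gamma$ and $$\mathscr X=\{X\in\operatorname{mod}\Gamma\mid\operatorname{Ext}^i_\Gamma(X,\mathscr X)=0\text{ for }1\leqslant i\leqslant d-1\}=\{X\in\operatorname{mod}\Gamma\mid\operatorname{Ext}^i_\Gamma(\mathscr X,X)=0\text{ for }1\leqslant i\leqslant d-1\}.$$ **Theorem.** The following are equivalent: 1. $\mathscr D$ is a $d$-cluster tilting subcategory of $\operatorname{mod}\Gamma$ and the functor $\mathscr T(T,-):\mathscr T\to\operatorname{mod}\Gamma$ is full. 2. $T$ satisfies (a), (a') and (b). 3. $T$ satisfies (strong a), (strong a') and (b). Moreover, if these conditions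 hold and $I$ denotes the ideal of morphisms $f$ in $\mathscr T$ with $\mathscr T(T,f)=0$, then $\mathscr T(T,-)$ induces an equivalence of categories $\mathscr T/I\to\mathscr D$, and the categories $\mathscr D$ and $\mathscr T/I$ are $d$-abelian (in the sense of Jasso). -/

import Mathlib

open CategoryTheory CategoryTheory.Limits

universe w v u

noncomputable section

namespace DAngulated

attribute [local instance] hasBinaryBiproducts_of_finite_biproducts

/-! ### Sequences of morphisms -/

/-- A sequence of `d + 1` composable morphisms `X_{d+1} ⟶ X_d ⟶ ⋯ ⟶ X_1 ⟶ X_0`.  Objects are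
numbered in decreasing order, and `map i` is the morphism `X_{i+1} ⟶ X_i`. -/
structure Chain (d : ℕ) (C : Type u) [Category.{v} C] where
  /-- the objects -/
  obj : Fin (d + 2) → C
  /-- the morphisms -/
  map (i : Fin (d + 1)) : obj i.succ ⟶ obj i.castSucc

namespace Chain

variable {d : ℕ} {C : Type u} [Category.{v} C]

/-- The first morphism `X_{d+1} ⟶ X_d` of the sequence. -/
abbrev first (P : Chain d C) : P.obj (Fin.last d).succ ⟶ P.obj (Fin.last d).castSucc :=
  P.map (Fin.last d)

/-- The final morphism `X_1 ⟶ X_0` of the sequence. -/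
abbrev final (P : Chain d C) : P.obj (0 : Fin (d + 1)).succ ⟶ P.obj (0 : Fin (d + 1)).castSucc :=
  P.map 0

variable [Preadditive C]

/-- Consecutive morphisms compose to zero. -/
def IsComplex (P : Chain d C) : Prop :=
  ∀ i : Fin d,
    (P.map i.succ : P.obj i.succ.succ ⟶ P.obj i.succ.castSucc) ≫
      (P.map i.castSucc : P.obj i.succ.castSucc ⟶ P.obj i.castSucc.castSucc) = 0

/-- `X_d ⟶ ⋯ ⟶ X_0` is a `d`-cokernel of `X_{d+1} ⟶ X_d`: for every `Y`, the sequence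
`0 ⟶ Hom(X_0, Y) ⟶ Hom(X_1, Y) ⟶ ⋯ ⟶ Hom(X_{d+1}, Y)` is exact. -/
structure IsDCokernel (P : Chain d C) : Prop where
  isComplex : P.IsComplex
  exact : ∀ (i : Fin d) (Y : C) (g : P.obj i.succ.castSucc ⟶ Y),
    (P.map i.succ : P.obj i.succ.succ ⟶ P.obj i.succ.castSucc) ≫ g = 0 →
      ∃ h : P.obj i.castSucc.castSucc ⟶ Y,
        (P.map i.castSucc : P.obj i.succ.castSucc ⟶ P.obj i.castSucc.castSucc) ≫ h = g
  epi : Epi P.final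

/-- `X_{d+1} ⟶ ⋯ ⟶ X_1` is a `d`-kernel of `X_1 ⟶ X_0`: for every `Y`, the sequence
`0 ⟶ Hom(Y, X_{d+1}) ⟶ Hom(Y, X_d) ⟶ ⋯ ⟶ Hom(Y, X_0)` is exact. -/
structure IsDKernel (P : Chain d C) : Prop where
  isComplex : P.IsComplex
  exact : ∀ (i : Fin d) (Y : C) (g : Y ⟶ P.obj i.succ.castSucc),
    g ≫ (P.map i.castSucc : P.obj i.succ.castSucc ⟶ P.obj i.castSucc.castSucc) = 0 →
      ∃ h : Y ⟶ P.obj i.succ.succ,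
        h ≫ (P.map i.succ : P.obj i.succ.succ ⟶ P.obj i.succ.castSucc) = g
  mono : Mono P.first

/-- A `d`-exact sequence: simultaneously a `d`-kernel of its final and a `d`-cokernel of its first
morphism. -/
def IsDExact (P : Chain d C) : Prop := P.IsDKernel ∧ P.IsDCokernel

end Chain

/-- `d`-abelian categories in the sense of Jasso (for `d ≥ 1`). -/
structure IsDAbelian (d : ℕ) (A : Type u) [Category.{v} A] [Preadditive A] : Prop where
  hasFiniteBiproducts : HasFiniteBiproducts A
  isIdempotentComplete : IsIdempotentComplete A
  exists_dKernel : ∀ ⦃X Y : A⦄ (f : X ⟶ Y), ∃ P : Chain d A,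
    P.IsDKernel ∧ Nonempty (Arrow.mk P.final ≅ Arrow.mk f)
  exists_dCokernel : ∀ ⦃X Y : A⦄ (f : X ⟶ Y), ∃ P : Chain d A,
    P.IsDCokernel ∧ Nonempty (Arrow.mk P.first ≅ Arrow.mk f)
  isDExact_of_mono : ∀ P : Chain d A, Mono P.first → P.IsDCokernel → P.IsDExact
  isDExact_of_epi : ∀ P : Chain d A, Epi P.final → P.IsDKernel → P.IsDExact

/-! ### `(d+2)`-angulated categories in the sense of Geiss, Keller and Oppermann -/

/-- With `n = d + 2`: an `n`-`S`-sequence `X_{d+1} ⟶ X_d ⟶ ⋯ ⟶ X_0 ⟶ S X_{d+1}`. -/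
structure SuspSeq (d : ℕ) {C : Type u} [Category.{v} C] (S : C ⥤ C) extends Chain d C where
  /-- the connecting morphism `X_0 ⟶ S X_{d+1}` -/
  conn : obj (0 : Fin (d + 1)).castSucc ⟶ S.obj (obj (Fin.last d).succ)

namespace SuspSeq

variable {d : ℕ} {C : Type u} [Category.{v} C] {S : C ⥤ C}

/-- Morphisms of `n`-`S`-sequences. -/
@[ext]
structure Hom (X Y : SuspSeq d S) where
  /-- the components -/
  app (i : Fin (d + 2)) : X.obj i ⟶ Y.obj i
  comm (i : Fin (d + 1)) : X.map i ≫ app i.castSucc = app i.succ ≫ Y.map i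
  comm_conn : X.conn ≫ S.map (app (Fin.last d).succ) = app (0 : Fin (d + 1)).castSucc ≫ Y.conn

variable [Preadditive C]

/-- The objects `X_d, …, X_0, S X_{d+1}` of the left rotation. -/
def rotateObj (X : SuspSeq d S) : Fin (d + 2) → C :=
  Fin.cases (S.obj (X.obj (Fin.last d).succ)) (fun i => X.obj i.castSucc)

/-- The first `d + 1` morphisms `X_d ⟶ ⋯ ⟶ X_0 ⟶ S X_{d+1}` of the left rotation. -/
def rotateMap (X : SuspSeq d S) :
    ∀ i : Fin (d + 1), X.rotateObj i.succ ⟶ X.rotateObj i.castSucc :=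
  Fin.cases X.conn (fun j => X.map j.castSucc)

/-- The left rotation `X_d ⟶ ⋯ ⟶ X_0 ⟶ S X_{d+1} ⟶ S X_d` of a sequence, whose last morphism is
`(-1)^{d+2}` times the suspension of the first morphism of the sequence. -/
def rotate (X : SuspSeq d S) : SuspSeq d S where
  obj := X.rotateObj
  map := X.rotateMap
  conn := (((-1 : ℤ) ^ (d + 2)) • S.map X.first :
    S.obj (X.obj (Fin.last d).succ) ⟶ S.obj (X.obj (Fin.last d).castSucc))

variable [HasFiniteBiproducts C]

/-- The direct sum of two sequences. -/
def sum (X Y : SuspSeq d S) : SuspSeq d S where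
  obj i := X.obj i ⊞ Y.obj i
  map i := biprod.map (X.map i) (Y.map i)
  conn := biprod.desc (X.conn ≫ S.map biprod.inl) (Y.conn ≫ S.map biprod.inr)

/-- The component `RX_i ⟶ Y_{i-1}` of the mapping cone, `RX` being the left rotation of `X`, of a
morphism `φ` of sequences: it is `φ_{i-1}`. -/
def coneComponent {X Y : SuspSeq d S} (φ : Hom X Y) (i : Fin (d + 1)) :
    X.rotateObj i.succ ⟶ Y.obj i.castSucc :=
  φ.app i.castSucc

/-- The mapping cone of a morphism `φ : X ⟶ Y` of sequences:
`X_d ⊞ Y_{d+1} ⟶ X_{d-1} ⊞ Y_d ⟶ ⋯ ⟶ X_0 ⊞ Y_1 ⟶ S X_{d+1} ⊞ Y_0 ⟶ S (X_d ⊞ Y_{d+1})`.  The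
matrix of each morphism has `-x` and `y` on the diagonal, `x` and `y` being the morphisms of `X`
and `Y`, and a component of `φ` below the diagonal; the last one has `-S x_{d+1}`, `S φ_{d+1}`
and the connecting morphism of `Y`. -/
def cone {X Y : SuspSeq d S} (φ : Hom X Y) : SuspSeq d S where
  obj i := X.rotateObj i ⊞ Y.obj i
  map i := biprod.desc
    (biprod.lift (-X.rotateMap i) (coneComponent φ i))
    (biprod.lift 0 (Y.map i))
  conn := biprod.desc (X := S.obj (X.obj (Fin.last d).succ))
    (-(S.map X.first ≫ S.map (biprod.inl (X := X.obj (Fin.last d).castSucc)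
        (Y := Y.obj (Fin.last d).succ))) +
      S.map (φ.app (Fin.last d).succ) ≫ S.map (biprod.inr (X := X.obj (Fin.last d).castSucc)
        (Y := Y.obj (Fin.last d).succ)))
    (Y.conn ≫ S.map (biprod.inr (X := X.obj (Fin.last d).castSucc)
        (Y := Y.obj (Fin.last d).succ)))

end SuspSeq

/-- The structure of a `(d+2)`-angulated category (for `d ≥ 1`) on an additive category: a
`d`-suspension, which is an autoequivalence, and a class of `(d+2)`-angles.  A sequence that is
isomorphic to a `(d+2)`-angle is a `(d+2)`-angle (take a retract), so that it does no harm to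
prescribe morphisms up to isomorphism. -/
structure Angulation (d : ℕ) (C : Type u) [Category.{v} C] [Preadditive C]
    [HasFiniteBiproducts C] where
  /-- the `d`-suspension -/
  susp : C ≌ C
  /-- the class of `(d+2)`-angles -/
  IsAngle : SuspSeq d susp.functor → Prop
  sum_mem : ∀ X Y, IsAngle X → IsAngle Y → IsAngle (X.sum Y)
  /-- closure under direct summands -/
  summand_mem : ∀ (X Y : SuspSeq d susp.functor) (i : X.Hom Y) (r : Y.Hom X),
    (∀ j, i.app j ≫ r.app j = 𝟙 _) → IsAngle Y → IsAngle X
  /-- the trivial sequences `X ⟶ X ⟶ 0 ⟶ ⋯ ⟶ 0 ⟶ S X`, the first morphism being an isomorphism -/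
  trivial_mem : ∀ X : SuspSeq d susp.functor, IsIso X.first →
    (∀ j : Fin d, IsZero (X.obj j.castSucc.castSucc)) → IsAngle X
  exists_completion : ∀ ⦃A B : C⦄ (f : A ⟶ B), ∃ X : SuspSeq d susp.functor,
    IsAngle X ∧ Nonempty (Arrow.mk X.first ≅ Arrow.mk f)
  rotate_mem_iff : ∀ X, IsAngle X ↔ IsAngle X.rotate
  exists_hom : ∀ (X Y : SuspSeq d susp.functor), IsAngle X → IsAngle Y →
    ∀ (a : X.obj (Fin.last d).succ ⟶ Y.obj (Fin.last d).succ)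
      (b : X.obj (Fin.last d).castSucc ⟶ Y.obj (Fin.last d).castSucc),
      X.first ≫ b = a ≫ Y.first →
      ∃ φ : X.Hom Y, φ.app (Fin.last d).succ = a ∧ φ.app (Fin.last d).castSucc = b
  /-- the morphism of sequences can be chosen such that its mapping cone is a `(d+2)`-angle -/
  exists_hom_cone : ∀ (X Y : SuspSeq d susp.functor), IsAngle X → IsAngle Y →
    ∀ (a : X.obj (Fin.last d).succ ⟶ Y.obj (Fin.last d).succ)
      (b : X.obj (Fin.last d).castSucc ⟶ Y.obj (Fin.last d).castSucc),
      X.first ≫ b = a ≫ Y.first →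
      ∃ φ : X.Hom Y, φ.app (Fin.last d).succ = a ∧ φ.app (Fin.last d).castSucc = b ∧
        IsAngle (SuspSeq.cone φ)

/-! ### Serre functors and `add T` -/

/-- A Serre functor: an autoequivalence `S` with natural `k`-linear isomorphisms
`D Hom(X, Y) ≅ Hom(Y, S X)`, where `D` is the `k`-linear dual. -/
structure SerreFunctor (k : Type w) [Field k] (C : Type u) [Category.{v} C] [Preadditive C]
    [Linear k C] where
  /-- the autoequivalence -/
  equiv : C ≌ C
  /-- the isomorphisms -/
  duality (X Y : C) : Module.Dual k (X ⟶ Y) ≃ₗ[k] (Y ⟶ equiv.functor.obj X)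
  naturality_left : ∀ ⦃X X' : C⦄ (Y : C) (f : X ⟶ X') (φ : Module.Dual k (X ⟶ Y)),
    duality X' Y (φ ∘ₗ Linear.leftComp k Y f) = duality X Y φ ≫ equiv.functor.map f
  naturality_right : ∀ (X : C) ⦃Y Y' : C⦄ (g : Y' ⟶ Y) (φ : Module.Dual k (X ⟶ Y)),
    duality X Y' (φ ∘ₗ Linear.rightComp k X g) = g ≫ duality X Y φ

/-- `X ∈ add T`: `X` is a direct summand of a finite direct sum of copies of `T`. -/
def IsAdd {C : Type u} [Category.{v} C] [Preadditive C] [HasFiniteBiproducts C] (T X : C) : Prop :=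
  ∃ n : ℕ, Nonempty (Retract X (⨁ fun _ : Fin n => T))

/-! ### Modules -/

section Modules

variable {A : Type v} [Ring A]

/-- The objects of `mod A`: the `A`-modules that are finite dimensional over `k`. -/
def IsFinDim (k : Type w) [Field k] [Algebra k A] (M : ModuleCat.{v} A) : Prop :=
  letI : Module k M := Module.restrictScalars k A M
  Module.Finite k M

/-- `Ext^j(𝒳, M) = 0` for `1 ≤ j ≤ d - 1`. -/
def ExtVanishesFrom (d : ℕ) (𝒳 : ObjectProperty (ModuleCat.{v} A)) (M : ModuleCat.{v} A) : Prop :=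
  ∀ X, 𝒳 X → ∀ j : ℕ, 1 ≤ j → j < d → Subsingleton (Abelian.Ext X M j)

/-- `Ext^j(M, 𝒳) = 0` for `1 ≤ j ≤ d - 1`. -/
def ExtVanishesTo (d : ℕ) (𝒳 : ObjectProperty (ModuleCat.{v} A)) (M : ModuleCat.{v} A) : Prop :=
  ∀ X, 𝒳 X → ∀ j : ℕ, 1 ≤ j → j < d → Subsingleton (Abelian.Ext M X j)

/-- The full subcategory `𝒳` of `mod A` is `d`-cluster tilting in `mod A`: it is weakly `d`-cluster
tilting (the first two conditions), and every object of `mod A` has a right and a left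
`𝒳`-approximation. -/
structure IsDClusterTilting (k : Type w) [Field k] [Algebra k A] (d : ℕ)
    (𝒳 : ObjectProperty (ModuleCat.{v} A)) : Prop where
  mem_iff_to : ∀ M, 𝒳 M ↔ IsFinDim k M ∧ ExtVanishesTo d 𝒳 M
  mem_iff_from : ∀ M, 𝒳 M ↔ IsFinDim k M ∧ ExtVanishesFrom d 𝒳 M
  exists_rightApproximation : ∀ M : ModuleCat.{v} A, IsFinDim k M →
    ∃ (X : ModuleCat.{v} A) (f : X ⟶ M), 𝒳 X ∧
      ∀ (X' : ModuleCat.{v} A) (g : X' ⟶ M), 𝒳 X' → ∃ h : X' ⟶ X, h ≫ f = g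
  exists_leftApproximation : ∀ M : ModuleCat.{v} A, IsFinDim k M →
    ∃ (X : ModuleCat.{v} A) (f : M ⟶ X), 𝒳 X ∧
      ∀ (X' : ModuleCat.{v} A) (g : M ⟶ X'), 𝒳 X' → ∃ h : X ⟶ X', f ≫ h = g

/-- A submodule `N` of `M` is superfluous if `N + L = M` only for `L = M`. -/
def IsSuperfluous {M : Type v} [AddCommGroup M] [Module A M] (N : Submodule A M) : Prop :=
  ∀ L : Submodule A M, N ⊔ L = ⊤ → L = ⊤

/-- A submodule `N` of `M` is essential if `N ∩ L = 0` only for `L = 0`. -/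
def IsEssential {M : Type v} [AddCommGroup M] [Module A M] (N : Submodule A M) : Prop :=
  ∀ L : Submodule A M, N ⊓ L = ⊥ → L = ⊥

/-- `P₁ ⟶ P₀ ⟶ M ⟶ 0` is a minimal projective presentation: it is exact, and `P₀ ⟶ M` and
`P₁ ⟶ ker (P₀ ⟶ M)` are projective covers. -/
structure IsMinProjPresentation {P₁ P₀ M : ModuleCat.{v} A} (f : P₁ ⟶ P₀) (p : P₀ ⟶ M) :
    Prop where
  projective₁ : Projective P₁
  projective₀ : Projective P₀
  exact : LinearMap.range f.hom = LinearMap.ker p.hom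
  surjective : LinearMap.range p.hom = ⊤
  superfluous₁ : IsSuperfluous (LinearMap.ker f.hom)
  superfluous₀ : IsSuperfluous (LinearMap.ker p.hom)

/-- `0 ⟶ N ⟶ I₁ ⟶ I₀` is a minimal injective copresentation: it is exact, and `N ⟶ I₁` and
`coker (N ⟶ I₁) ⟶ I₀` are injective envelopes. -/
structure IsMinInjCopresentation {N I₁ I₀ : ModuleCat.{v} A} (u : N ⟶ I₁) (g : I₁ ⟶ I₀) :
    Prop where
  injective₁ : Injective I₁
  injective₀ : Injective I₀
  injective : LinearMap.ker u.hom = ⊥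
  exact : LinearMap.range u.hom = LinearMap.ker g.hom
  essential₁ : IsEssential (LinearMap.range u.hom)
  essential₀ : IsEssential (LinearMap.range g.hom)

end Modules

/-! ### The functor `𝒯(T, -)` and the conditions on `T` -/

section Conditions

variable {C : Type u} [Category.{v} C] [Preadditive C]

/-- The functor `𝒯(T, -)`, with values in right modules over `Γ = End T`, that is, in left modules
over the opposite ring (multiplication in `End T` is composition of maps, and `T ⟶ X` is acted
upon by precomposition). -/
abbrev homFunctor (T : C) : C ⥤ ModuleCat.{v} (End T)ᵐᵒᵖ := preadditiveCoyonedaObj T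

/-- The essential image `𝒟` of `𝒯(T, -)`. -/
abbrev imageD (T : C) : ObjectProperty (ModuleCat.{v} (End T)ᵐᵒᵖ) := (homFunctor T).essImage

/-- Congruence modulo the ideal `I` of morphisms `f` with `𝒯(T, f) = 0`. -/
def idealRel (T : C) : HomRel C := fun _ _ f g => (homFunctor T).map (f - g) = 0

lemma idealRel_iff (T : C) {X Y : C} (f g : X ⟶ Y) :
    idealRel T f g ↔ (homFunctor T).map f = (homFunctor T).map g := by
  rw [idealRel, Functor.map_sub, sub_eq_zero]

instance (T : C) : Congruence (idealRel T) where
  equivalence :=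
    { refl := fun f => (idealRel_iff T f f).2 rfl
      symm := fun h => (idealRel_iff T _ _).2 ((idealRel_iff T _ _).1 h).symm
      trans := fun h h' => (idealRel_iff T _ _).2
        (((idealRel_iff T _ _).1 h).trans ((idealRel_iff T _ _).1 h')) }
  comp_left f _ _ h := by
    rw [idealRel_iff] at h ⊢
    rw [Functor.map_comp, Functor.map_comp, h]
  comp_right g h := by
    rw [idealRel_iff] at h ⊢
    rw [Functor.map_comp, Functor.map_comp, h]

/-- The quotient category `𝒯 / I`. -/
abbrev QuotientByIdeal (T : C) : Type u := CategoryTheory.Quotient (idealRel T)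

instance (T : C) : Preadditive (QuotientByIdeal T) :=
  CategoryTheory.Quotient.preadditive (idealRel T) (fun _ _ _ _ _ _ hf hg => by
    rw [idealRel_iff] at hf hg ⊢
    rw [Functor.map_add, Functor.map_add, hf, hg])

/-- The functor `𝒯 / I ⥤ 𝒟` induced by `𝒯(T, -)`. -/
def inducedFunctor (T : C) : QuotientByIdeal T ⥤ (imageD T).FullSubcategory :=
  CategoryTheory.Quotient.lift (idealRel T) (homFunctor T).toEssImage (fun X Y f g h =>
    (imageD T).ι.map_injective (X := (homFunctor T).toEssImage.obj X)
      (Y := (homFunctor T).toEssImage.obj Y) ((idealRel_iff T f g).1 h))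

variable (k : Type w) [Field k] [Linear k C] [HasFiniteBiproducts C] {d : ℕ}

/-- The common part of (a) and (strong a): each `f : T₁ ⟶ T₀` as in the condition has a completion
to a `(d+2)`-angle `T₁ ⟶ T₀ ⟶ X_d ⟶ ⋯ ⟶ X_1 ⟶ Σ^d T₁` that satisfies the requirement `R`. -/
def ConditionAWith (𝒜 : Angulation d C) (T : C) (R : SuspSeq d 𝒜.susp.functor → Prop) : Prop :=
  ∀ M : ModuleCat.{v} (End T)ᵐᵒᵖ, IsFinDim k M → ExtVanishesFrom d (imageD T) M →
    ∀ (T₁ T₀ : C), IsAdd T T₁ → IsAdd T T₀ → ∀ (f : T₁ ⟶ T₀) (p : (homFunctor T).obj T₀ ⟶ M),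
      IsMinProjPresentation ((homFunctor T).map f) p →
        ∃ Z : SuspSeq d 𝒜.susp.functor, 𝒜.IsAngle Z ∧
          Nonempty (Arrow.mk Z.first ≅ Arrow.mk f) ∧ R Z

/-- Condition (a): some `h_i` with `1 ≤ i ≤ d + 1` satisfies `𝒯(T, h_i) = 0`.  The morphisms
`h_{d+1}, …, h_1` are all but the first morphism of the angle, hence `h_{i+1}` is `map i` of the
left rotation. -/
def ConditionA (𝒜 : Angulation d C) (T : C) : Prop :=
  ConditionAWith k 𝒜 T fun Z => ∃ i : Fin (d + 1), (homFunctor T).map (Z.rotate.map i) = 0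

/-- Condition (strong a): `𝒯(T, h_d) = 0`. -/
def ConditionStrongA (𝒜 : Angulation d C) (T : C) : Prop :=
  ConditionAWith k 𝒜 T fun Z =>
    (homFunctor T).map (Z.rotate.map (⟨d - 1, by omega⟩ : Fin (d + 1))) = 0

/-- The common part of (a') and (strong a'): each `g : S T₁ ⟶ S T₀` as in the condition has a
completion to a `(d+2)`-angle `Σ^{-d} S T₀ ⟶ X_d ⟶ ⋯ ⟶ X_1 ⟶ S T₁ ⟶ S T₀` that satisfies the
requirement `R`; here `g` is the connecting morphism of the angle.  (Every object of `add (S T)` is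
isomorphic to `S T'` for some `T'` in `add T`.) -/
def ConditionA'With (𝒜 : Angulation d C) (S : SerreFunctor k C) (T : C)
    (R : SuspSeq d 𝒜.susp.functor → Prop) : Prop :=
  ∀ N : ModuleCat.{v} (End T)ᵐᵒᵖ, IsFinDim k N → ExtVanishesTo d (imageD T) N →
    ∀ (T₁ T₀ : C), IsAdd T T₁ → IsAdd T T₀ →
      ∀ (g : S.equiv.functor.obj T₁ ⟶ S.equiv.functor.obj T₀)
        (u : N ⟶ (homFunctor T).obj (S.equiv.functor.obj T₁)),
      IsMinInjCopresentation u ((homFunctor T).map g) →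
        ∃ Z : SuspSeq d 𝒜.susp.functor, 𝒜.IsAngle Z ∧
          Nonempty (Arrow.mk Z.conn ≅ Arrow.mk g) ∧ R Z

/-- Condition (a'): some `h_i` with `1 ≤ i ≤ d + 1` satisfies `𝒯(T, h_i) = 0`.  The morphisms
`h_{d+1}, …, h_1` are all morphisms of the angle but the connecting one, `h_{i+1}` being
`map i`. -/
def ConditionA' (𝒜 : Angulation d C) (S : SerreFunctor k C) (T : C) : Prop :=
  ConditionA'With k 𝒜 S T fun Z => ∃ i : Fin (d + 1), (homFunctor T).map (Z.map i) = 0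

/-- Condition (strong a'): `𝒯(T, h_2) = 0` (for `d ≥ 1`). -/
def ConditionStrongA' (𝒜 : Angulation d C) (S : SerreFunctor k C) (T : C) : Prop :=
  ConditionA'With k 𝒜 S T fun Z => (homFunctor T).map (Z.map (1 : Fin (d + 1))) = 0

/-- Condition (b): each indecomposable `X` with `𝒯(T, X) ≠ 0` has a `(d+2)`-angle
`T_d ⟶ ⋯ ⟶ T_0 ⟶ X ⟶ Σ^d T_d` with all `T_i` in `add T`, whose connecting morphism `h` satisfies
`𝒯(T, h) = 0`. -/
def ConditionB (𝒜 : Angulation d C) (T : C) : Prop :=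
  ∀ X : C, Indecomposable X → Nontrivial (T ⟶ X) →
    ∃ Z : SuspSeq d 𝒜.susp.functor, 𝒜.IsAngle Z ∧
      Nonempty (Z.obj (0 : Fin (d + 1)).castSucc ≅ X) ∧ (∀ i : Fin (d + 1), IsAdd T (Z.obj i.succ)) ∧
        (homFunctor T).map Z.conn = 0

end Conditions

end DAngulated

end

noncomputable section

namespace DAngulated

attribute [local instance] hasBinaryBiproducts_of_finite_biproducts

/-! ### Fitting idempotents -/

/-- `e` is an idempotent on which `a` is invertible and off which `a` is nilpotent. -/
structure IsFitting {M : Type*} [Monoid M] (a e : M) : Prop where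
  idem : e * e = e
  fac : ∃ x, a * x = e ∧ x * a = e
  absorb : ∃ N : ℕ, a ^ (N + 1) * e = a ^ (N + 1)

namespace IsFitting

section Monoid

variable {M N : Type*} [Monoid M] [Monoid N]

lemma map {a e : M} (h : IsFitting a e) (f : M →* N) : IsFitting (f a) (f e) where
  idem := by rw [← map_mul, h.idem]
  fac := by
    obtain ⟨x, h₁, h₂⟩ := h.fac
    exact ⟨f x, by rw [← map_mul, h₁], by rw [← map_mul, h₂]⟩
  absorb := by
    obtain ⟨n, hn⟩ := h.absorb
    exact ⟨n, by rw [← map_pow, ← map_mul, hn]⟩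

lemma of_idem {e : M} (h : e * e = e) : IsFitting e e :=
  ⟨h, ⟨1, by simp, by simp⟩, ⟨0, by simpa using h⟩⟩

lemma exists_pow_fac {a e : M} (h : IsFitting a e) (n : ℕ) :
    ∃ y, a ^ (n + 1) * y = e ∧ y * a ^ (n + 1) = e := by
  obtain ⟨x, h₁, h₂⟩ := h.fac
  have hc : Commute a x := h₁.trans h₂.symm
  have he : e ^ (n + 1) = e := IsIdempotentElem.pow_succ_eq n h.idem
  refine ⟨x ^ (n + 1), ?_, ?_⟩
  · rw [← hc.mul_pow, h₁, he]
  · rw [← hc.symm.mul_pow, h₂, he]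

lemma absorb' {a e : M} (h : IsFitting a e) : ∃ N : ℕ, e * a ^ (N + 1) = a ^ (N + 1) := by
  obtain ⟨n, hn⟩ := h.absorb
  obtain ⟨x, h₁, h₂⟩ := h.fac
  have hc : Commute a x := h₁.trans h₂.symm
  have hae : Commute a e := by rw [← h₁]; exact (Commute.refl a).mul_right hc
  exact ⟨n, by rw [← (hae.pow_left _).eq, hn]⟩

end Monoid

theorem exists_of_finite (k : Type*) {R : Type*} [Field k] [Ring R] [Algebra k R]
    [Module.Finite k R] (a : R) : ∃ e : R, IsFitting a e := by
  classical
  have hm : minpoly k a ≠ 0 := minpoly.ne_zero (Algebra.IsIntegral.isIntegral a)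
  obtain ⟨n, q, hq, hX⟩ : ∃ (n : ℕ) (q : Polynomial k), minpoly k a = Polynomial.X ^ n * q ∧
      ¬ Polynomial.X ∣ q := by
    obtain ⟨q, hq, hX⟩ := Polynomial.exists_eq_pow_rootMultiplicity_mul_and_not_dvd _ hm 0
    exact ⟨_, q, by simpa using hq, by simpa using hX⟩
  have hcop : IsCoprime (Polynomial.X ^ (n + 1) : Polynomial k) q := by
    refine IsCoprime.pow_left ?_
    refine (Polynomial.irreducible_X.coprime_iff_not_dvd).2 hX
  obtain ⟨u, v, huv⟩ := hcop
  obtain ⟨A, hAX, hAm⟩ : ∃ A : Polynomial k →ₐ[k] R, A Polynomial.X = a ∧ A (minpoly k a) = 0 :=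
    ⟨Polynomial.aeval a, Polynomial.aeval_X a, minpoly.aeval k a⟩
  have hA : A (Polynomial.X ^ (n + 1) * q) = 0 := by
    have : (Polynomial.X ^ (n + 1) * q : Polynomial k) = Polynomial.X * minpoly k a := by
      rw [hq]; ring
    rw [this, map_mul, hAm, mul_zero]
  refine ⟨A (u * Polynomial.X ^ (n + 1)), ?_, ⟨A (u * Polynomial.X ^ n), ?_, ?_⟩, n, ?_⟩
  · have : (u * Polynomial.X ^ (n + 1) * (u * Polynomial.X ^ (n + 1)) : Polynomial k) =
        u * Polynomial.X ^ (n + 1) - u * v * (Polynomial.X ^ (n + 1) * q) := by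
      linear_combination (u * Polynomial.X ^ (n + 1)) * huv
    rw [← map_mul, this, map_sub, map_mul A (u * v), hA]; simp
  · rw [show a * A (u * Polynomial.X ^ n) = A Polynomial.X * A (u * Polynomial.X ^ n) by rw [hAX],
      ← map_mul, show (Polynomial.X * (u * Polynomial.X ^ n) : Polynomial k) =
        u * Polynomial.X ^ (n + 1) by ring]
  · rw [show A (u * Polynomial.X ^ n) * a = A (u * Polynomial.X ^ n) * A Polynomial.X by rw [hAX],
      ← map_mul, show (u * Polynomial.X ^ n * Polynomial.X : Polynomial k) =
        u * Polynomial.X ^ (n + 1) by ring]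
  · have : (Polynomial.X ^ (n + 1) * (u * Polynomial.X ^ (n + 1)) : Polynomial k) =
        Polynomial.X ^ (n + 1) - v * (Polynomial.X ^ (n + 1) * q) := by
      linear_combination (Polynomial.X ^ (n + 1)) * huv
    rw [show a ^ (n + 1) = A (Polynomial.X ^ (n + 1)) by rw [map_pow, hAX], ← map_mul, this,
      map_sub, map_mul A v, hA]; simp

end IsFitting

section Fitting

variable {C : Type u} [Category.{v} C]

/-- `e` is a Fitting idempotent of the endomorphism `φ`. -/
abbrev IsFittingEnd {X : C} (φ e : X ⟶ X) : Prop := IsFitting (M := End X) φ e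

lemma comp_end_pow {X Y : C} (α : X ⟶ Y) (φ : X ⟶ X) (ψ : Y ⟶ Y) (h : α ≫ ψ = φ ≫ α) (n : ℕ) :
    α ≫ (End.of ψ ^ n : End Y) = (End.of φ ^ n : End X) ≫ α := by
  induction n with
  | zero => simp
  | succ n ih =>
    rw [pow_succ, pow_succ, End.mul_def, End.mul_def, ← Category.assoc, h, Category.assoc, ih,
      Category.assoc]

namespace IsFittingEnd

/-- Fitting idempotents are natural. -/
lemma comp_eq {X Y : C} {φ e : X ⟶ X} {ψ e' : Y ⟶ Y} (h : IsFittingEnd φ e) (h' : IsFittingEnd ψ e')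
    (α : X ⟶ Y) (hα : α ≫ ψ = φ ≫ α) : α ≫ e' = e ≫ α := by
  have h₁ : e ≫ α ≫ e' = α ≫ e' := by
    obtain ⟨N, hN⟩ := h.absorb
    obtain ⟨y, hy, hy'⟩ := h'.exists_pow_fac N
    have hN' : e ≫ (End.of φ ^ (N + 1) : End X) = (End.of φ ^ (N + 1) : End X) := hN
    have hy2 : (End.of ψ ^ (N + 1) : End Y) ≫ y = e' := hy'
    rw [← hy2, ← Category.assoc α, comp_end_pow α φ ψ hα, Category.assoc, ← Category.assoc e, hN']
  have h₂ : e ≫ α ≫ e' = e ≫ α := by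
    obtain ⟨N, hN⟩ := h'.absorb'
    obtain ⟨y, hy, hy'⟩ := h.exists_pow_fac N
    have hN' : (End.of ψ ^ (N + 1) : End Y) ≫ e' = (End.of ψ ^ (N + 1) : End Y) := hN
    have hy2 : y ≫ (End.of φ ^ (N + 1) : End X) = e := hy
    rw [← hy2, Category.assoc, Category.assoc, ← Category.assoc _ α, ← comp_end_pow α φ ψ hα,
      Category.assoc, hN']
  rw [← h₁, h₂]

protected lemma id (X : C) : IsFittingEnd (𝟙 X) (𝟙 X) := IsFitting.of_idem (M := End X) (by simp)

lemma unique {X : C} {φ e e' : X ⟶ X} (h : IsFittingEnd φ e) (h' : IsFittingEnd φ e') : e = e' := by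
  simpa using (comp_eq h h' (𝟙 X) (by simp)).symm

lemma eq_id {X : C} {e : X ⟶ X} (h : IsFittingEnd (𝟙 X) e) : e = 𝟙 X :=
  h.unique (IsFittingEnd.id X)

lemma functor_map {D : Type*} [Category D] (F : C ⥤ D) {X : C} {φ e : X ⟶ X} (h : IsFittingEnd φ e) :
    IsFittingEnd (F.map φ) (F.map e) :=
  IsFitting.map h (F.mapEnd X)

lemma comp_self {X : C} {φ e : X ⟶ X} (h : IsFittingEnd φ e) : e ≫ e = e := h.idem

lemma exists_fac {X : C} {φ e : X ⟶ X} (h : IsFittingEnd φ e) : ∃ x, φ ≫ x = e ∧ x ≫ φ = e := by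
  obtain ⟨x, h₁, h₂⟩ := h.fac
  exact ⟨x, h₂, h₁⟩

lemma comp_of_comp_eq {X Y : C} {φ e : X ⟶ X} (h : IsFittingEnd φ e) (g : Y ⟶ X) (hg : g ≫ φ = g) :
    g ≫ e = g := by
  simpa using (IsFittingEnd.id Y).comp_eq h g (by simpa using hg)

lemma comp_of_eq_comp {X Y : C} {φ e : X ⟶ X} (h : IsFittingEnd φ e) (g : X ⟶ Y) (hg : φ ≫ g = g) :
    e ≫ g = g := by
  simpa using (h.comp_eq (IsFittingEnd.id Y) g (by simpa using hg.symm)).symm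

end IsFittingEnd

end Fitting

section Linear

variable (k : Type w) [Field k] {C : Type u} [Category.{v} C] [Preadditive C] [Linear k C]

lemma exists_isFitting (hfin : ∀ X Y : C, Module.Finite k (X ⟶ Y)) {X : C} (φ : X ⟶ X) :
    ∃ e : X ⟶ X, IsFittingEnd φ e := by
  have : Module.Finite k (End X) := hfin X X
  exact IsFitting.exists_of_finite k (End.of φ)

variable [HasFiniteBiproducts C] [IsIdempotentComplete C]

/-- The complement of a split idempotent. -/
lemma exists_iso_biprod_of_idem {X : C} (e : X ⟶ X) (he : e ≫ e = e) :
    ∃ (Y Z : C) (φ : X ≅ Y ⊞ Z), φ.hom ≫ biprod.fst ≫ biprod.inl ≫ φ.inv = e := by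
  obtain ⟨Y, i, r, hir, hri⟩ := IsIdempotentComplete.idempotents_split X e he
  have he' : (𝟙 X - e) ≫ (𝟙 X - e) = 𝟙 X - e := by simp [he]
  obtain ⟨Z, j, s, hjs, hsj⟩ := IsIdempotentComplete.idempotents_split X (𝟙 X - e) he'
  have his : i ≫ s = 0 := by
    have : i ≫ s ≫ j = 0 := by
      rw [hsj, ← hri, Preadditive.comp_sub, ← Category.assoc, hir]; simp
    have := congrArg (· ≫ s) this
    simpa [hjs] using this
  have hjr : j ≫ r = 0 := by
    have h1 : j ≫ r ≫ i = 0 := by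
      have : r ≫ i = 𝟙 X - s ≫ j := by rw [hsj, hri]; simp
      rw [this, Preadditive.comp_sub, ← Category.assoc, hjs]; simp
    have := congrArg (· ≫ r) h1
    simpa [hir] using this
  refine ⟨Y, Z, ⟨biprod.lift r s, biprod.desc i j, ?_, ?_⟩, ?_⟩
  · simp [hri, hsj]
  · ext <;> simp [hir, hjs, his, hjr]
  · simp [hri]

/-- The endomorphism ring of an indecomposable object is local. -/
lemma isIso_or_nilpotent (hfin : ∀ X Y : C, Module.Finite k (X ⟶ Y)) {X : C}
    (hX : Indecomposable X) (φ : X ⟶ X) :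
    IsIso φ ∨ ∃ N : ℕ, (End.of φ) ^ (N + 1) = 0 := by
  obtain ⟨e, he⟩ := exists_isFitting k hfin φ
  obtain ⟨Y, Z, ψ, hψ⟩ := exists_iso_biprod_of_idem e he.idem
  rcases hX.2 Y Z ψ with h | h
  · right
    have : e = 0 := by rw [← hψ, h.eq_of_src biprod.inl 0]; simp
    obtain ⟨N, hN⟩ := he.absorb
    refine ⟨N, ?_⟩
    rw [← hN, this]
    exact mul_zero _
  · left
    have h1 : e = 𝟙 X := by
      have : biprod.fst ≫ biprod.inl = 𝟙 (Y ⊞ Z) := by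
        rw [← biprod.total, h.eq_of_tgt biprod.snd 0]; simp
      rw [← hψ, ← Category.assoc biprod.fst, this]; simp
    obtain ⟨x, hx, hx'⟩ := he.fac
    exact ⟨x, hx'.trans h1, hx.trans h1⟩

end Linear

/-! ### Long exact sequences of `(d+2)`-angles -/

section Angles

variable {C : Type u} [Category.{v} C] [Preadditive C]

lemma sign_smul_cancel (m : ℕ) {A B : C} {a b : A ⟶ B}
    (h : ((-1 : ℤ) ^ m) • a = ((-1 : ℤ) ^ m) • b) : a = b := by
  rcases neg_one_pow_eq_or ℤ m with h' | h'
  · rwa [h', one_smul, one_smul] at h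
  · rwa [h', neg_one_smul, neg_one_smul, neg_inj] at h

lemma exists_isZero [HasFiniteBiproducts C] : ∃ Z : C, IsZero Z :=
  have : HasZeroObject C := hasZeroObject_of_hasTerminal_object
  ⟨_, isZero_zero C⟩

namespace SuspSeq

variable {d : ℕ} (S : C ⥤ C)

/-- The sequence with an identity `W ⟶ W` at position `j`, and a given (zero) object elsewhere. -/
def pair (Z W : C) (j : Fin (d + 1)) : SuspSeq d S where
  obj i := if i = j.succ ∨ i = j.castSucc then W else Z
  map i := if h : i = j then eqToHom (by simp [h]) else 0
  conn := 0

variable {S} {Z W : C} {j : Fin (d + 1)}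

lemma pair_isZero (hZ : IsZero Z) {i : Fin (d + 2)} (h₁ : i ≠ j.succ) (h₂ : i ≠ j.castSucc) :
    IsZero ((pair S Z W j).obj i) := by
  simpa [pair, h₁, h₂] using hZ

/-- The upper object of the identity in `pair`. -/
def pairIsoSucc : (pair S Z W j).obj j.succ ≅ W := eqToIso (by simp [pair])

/-- The lower object of the identity in `pair`. -/
def pairIsoCastSucc : (pair S Z W j).obj j.castSucc ≅ W := eqToIso (by simp [pair])

lemma pair_map : (pair S Z W j).map j = pairIsoSucc.hom ≫ pairIsoCastSucc.inv := by
  have : (pair S Z W j).map j = eqToHom (by simp [pair]) := dif_pos rfl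
  rw [this, pairIsoSucc, pairIsoCastSucc, eqToIso.hom, eqToIso.inv, eqToHom_trans]

instance : IsIso ((pair S Z W j).map j) := by rw [pair_map]; infer_instance

end SuspSeq

namespace Angulation

variable [HasFiniteBiproducts C]

section

variable {d : ℕ} (𝒜 : Angulation d C)

/-- A sequence with an isomorphism at one place and zero objects elsewhere is an angle. -/
lemma isAngle_of_isIso (i : Fin (d + 1)) (Z : SuspSeq d 𝒜.susp.functor)
    (h : IsIso (Z.map i)) (h0 : ∀ j, j ≠ i.succ → j ≠ i.castSucc → IsZero (Z.obj j)) :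
    𝒜.IsAngle Z := by
  induction i using Fin.reverseInduction generalizing Z with
  | last =>
    refine 𝒜.trivial_mem Z h fun j => h0 _ (fun h => ?_) (fun h => ?_)
    · have := congrArg Fin.val h
      simp at this; omega
    · have := congrArg Fin.val h
      simp at this; omega
  | cast i ih =>
    refine (𝒜.rotate_mem_iff Z).2 (ih Z.rotate h fun j h₁ h₂ => ?_)
    induction j using Fin.cases with
    | zero =>
      refine 𝒜.susp.functor.map_isZero (h0 _ (fun h => ?_) (fun h => ?_))
      · have := congrArg Fin.val h
        simp at this; omega
      · have := congrArg Fin.val h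
        simp at this; omega
    | succ j =>
      exact h0 _ (fun h => h₁ (congrArg Fin.succ (Fin.castSucc_injective _ h)))
        (fun h => h₂ (congrArg Fin.succ (Fin.castSucc_injective _ h)))

lemma pair_mem {Z : C} (hZ : IsZero Z) (W : C) (j : Fin (d + 1)) :
    𝒜.IsAngle (SuspSeq.pair 𝒜.susp.functor Z W j) :=
  𝒜.isAngle_of_isIso j _ inferInstance fun _ => SuspSeq.pair_isZero hZ

end

variable {n : ℕ} (𝒜 : Angulation (n + 1) C)

variable {𝒜} {X : SuspSeq (n + 1) 𝒜.susp.functor}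

lemma first_comp (hX : 𝒜.IsAngle X) :
    X.first ≫ X.map (Fin.last n).castSucc = 0 := by
  obtain ⟨Z, hZ⟩ := exists_isZero (C := C)
  set P := SuspSeq.pair 𝒜.susp.functor Z (X.obj (Fin.last (n + 1)).succ) (Fin.last (n + 1))
  obtain ⟨φ, h₁, h₂⟩ := 𝒜.exists_hom P X (𝒜.pair_mem hZ _ _) hX SuspSeq.pairIsoSucc.hom
    (SuspSeq.pairIsoCastSucc.hom ≫ X.first) (by
      change Chain.map _ _ ≫ _ = _
      rw [SuspSeq.pair_map]; simp)
  have h := φ.comm (Fin.last n).castSucc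
  have hz : IsZero (P.obj (Fin.last n).castSucc.castSucc) := by
    refine SuspSeq.pair_isZero hZ ?_ ?_
    · intro h
      have := congrArg Fin.val h
      simp at this
      omega
    · intro h
      have := congrArg Fin.val h
      simp at this
  rw [hz.eq_of_src (φ.app _) 0, comp_zero] at h
  replace h : 0 = φ.app (Fin.last (n + 1)).castSucc ≫ X.map (Fin.last n).castSucc := h
  rw [h₂, Category.assoc] at h
  rw [← cancel_epi (SuspSeq.pairIsoCastSucc (S := 𝒜.susp.functor) (Z := Z)
    (W := X.obj (Fin.last (n + 1)).succ) (j := Fin.last (n + 1))).hom, ← h, comp_zero]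

lemma lift_first (hX : 𝒜.IsAngle X) {W : C} (g : W ⟶ X.obj (Fin.last (n + 1)).castSucc)
    (hg : g ≫ X.map (Fin.last n).castSucc = 0) : ∃ h, h ≫ X.first = g := by
  obtain ⟨Z, hZ⟩ := exists_isZero (C := C)
  set P := SuspSeq.pair 𝒜.susp.functor Z W (Fin.last (n + 1)) with hP
  obtain ⟨φ, h₁, h₂⟩ := 𝒜.exists_hom P.rotate X.rotate
    ((𝒜.rotate_mem_iff _).1 (𝒜.pair_mem hZ _ _)) ((𝒜.rotate_mem_iff _).1 hX)
    ((SuspSeq.pairIsoCastSucc (j := Fin.last (n + 1))).hom ≫ g) 0 (by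
      have : (SuspSeq.pairIsoCastSucc (S := 𝒜.susp.functor) (Z := Z)
        (j := Fin.last (n + 1)).hom ≫ g) ≫ X.map (Fin.last n).castSucc = 0 := by
        rw [Category.assoc, hg, comp_zero]
      exact comp_zero.trans this.symm)
  have h := φ.comm_conn
  rw [h₁] at h
  let φ₀ : 𝒜.susp.functor.obj (P.obj (Fin.last (n + 1)).succ) ⟶
    𝒜.susp.functor.obj (X.obj (Fin.last (n + 1)).succ) := φ.app 0
  replace h : (((-1 : ℤ) ^ (n + 1 + 2)) • 𝒜.susp.functor.map P.first) ≫
      𝒜.susp.functor.map (SuspSeq.pairIsoCastSucc.hom ≫ g) =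
      φ₀ ≫ (((-1 : ℤ) ^ (n + 1 + 2)) • 𝒜.susp.functor.map X.first) := h
  rw [Preadditive.zsmul_comp, Preadditive.comp_zsmul] at h
  replace h := sign_smul_cancel _ h
  rw [← 𝒜.susp.functor.map_preimage φ₀, ← Functor.map_comp, ← Functor.map_comp] at h
  replace h := 𝒜.susp.functor.map_injective h
  have hPf : P.first = SuspSeq.pairIsoSucc.hom ≫ SuspSeq.pairIsoCastSucc.inv := SuspSeq.pair_map
  rw [hPf, Category.assoc, Iso.inv_hom_id_assoc] at h
  exact ⟨SuspSeq.pairIsoSucc.inv ≫ 𝒜.susp.functor.preimage φ₀, by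
    rw [Category.assoc, ← h, Iso.inv_hom_id_assoc]⟩

lemma desc_first (hX : 𝒜.IsAngle X) {Y : C} (g : X.obj (Fin.last (n + 1)).castSucc ⟶ Y)
    (hg : X.first ≫ g = 0) : ∃ h, X.map (Fin.last n).castSucc ≫ h = g := by
  obtain ⟨Z, hZ⟩ := exists_isZero (C := C)
  obtain ⟨φ, h₁, h₂⟩ := 𝒜.exists_hom X (SuspSeq.pair 𝒜.susp.functor Z Y (Fin.last n).castSucc) hX
    (𝒜.pair_mem hZ _ _) 0
    (g ≫ (SuspSeq.pairIsoSucc (j := (Fin.last n).castSucc)).inv) (by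
      rw [zero_comp, ← Category.assoc]
      exact (congrArg (· ≫ _) hg).trans zero_comp)
  have h := φ.comm (Fin.last n).castSucc
  rw [SuspSeq.pair_map] at h
  replace h₂ : φ.app (Fin.last n).castSucc.succ =
    g ≫ (SuspSeq.pairIsoSucc (j := (Fin.last n).castSucc)).inv := h₂
  rw [h₂, Category.assoc, Iso.inv_hom_id_assoc] at h
  exact ⟨φ.app (Fin.last n).castSucc.castSucc ≫ SuspSeq.pairIsoCastSucc.hom, by
    rw [← Category.assoc, h, Category.assoc, Iso.inv_hom_id, Category.comp_id]⟩

/-- Composites of consecutive morphisms in an angle vanish. -/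
lemma comp_eq_zero (hX : 𝒜.IsAngle X) (i : Fin (n + 1)) :
    (X.map i.succ : X.obj i.succ.succ ⟶ X.obj i.succ.castSucc) ≫
      (X.map i.castSucc : X.obj i.succ.castSucc ⟶ X.obj i.castSucc.castSucc) = 0 := by
  induction i using Fin.reverseInduction generalizing X with
  | last => exact first_comp hX
  | cast i ih => exact ih ((𝒜.rotate_mem_iff _).1 hX)

lemma isComplex (hX : 𝒜.IsAngle X) : X.toChain.IsComplex := comp_eq_zero hX

lemma final_comp_conn (hX : 𝒜.IsAngle X) : X.final ≫ X.conn = 0 :=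
  comp_eq_zero ((𝒜.rotate_mem_iff _).1 hX) 0

lemma conn_comp_first (hX : 𝒜.IsAngle X) : X.conn ≫ 𝒜.susp.functor.map X.first = 0 := by
  have h := final_comp_conn ((𝒜.rotate_mem_iff _).1 hX)
  replace h : X.conn ≫ (((-1 : ℤ) ^ (n + 1 + 2)) • 𝒜.susp.functor.map X.first) = 0 := h
  rw [Preadditive.comp_zsmul] at h
  exact sign_smul_cancel _ (h.trans (smul_zero _).symm)

lemma exists_lift (hX : 𝒜.IsAngle X) (i : Fin (n + 1)) {W : C} (g : W ⟶ X.obj i.succ.castSucc)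
    (hg : g ≫ (X.map i.castSucc : X.obj i.succ.castSucc ⟶ X.obj i.castSucc.castSucc) = 0) :
    ∃ h : W ⟶ X.obj i.succ.succ,
      h ≫ (X.map i.succ : X.obj i.succ.succ ⟶ X.obj i.succ.castSucc) = g := by
  induction i using Fin.reverseInduction generalizing X with
  | last => exact lift_first hX g hg
  | cast i ih => exact ih ((𝒜.rotate_mem_iff _).1 hX) g hg

lemma exists_lift_final (hX : 𝒜.IsAngle X) {W : C} (g : W ⟶ X.obj (0 : Fin (n + 2)).castSucc)
    (hg : g ≫ X.conn = 0) : ∃ h, h ≫ X.final = g :=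
  exists_lift ((𝒜.rotate_mem_iff _).1 hX) 0 g hg

lemma exists_lift_conn (hX : 𝒜.IsAngle X) {W : C}
    (g : W ⟶ 𝒜.susp.functor.obj (X.obj (Fin.last (n + 1)).succ))
    (hg : g ≫ 𝒜.susp.functor.map X.first = 0) : ∃ h, h ≫ X.conn = g := by
  refine exists_lift_final ((𝒜.rotate_mem_iff _).1 hX) g ?_
  change g ≫ (((-1 : ℤ) ^ (n + 1 + 2)) • 𝒜.susp.functor.map X.first) = 0
  rw [Preadditive.comp_zsmul, hg, smul_zero]

lemma exists_desc (hX : 𝒜.IsAngle X) (i : Fin (n + 1)) {Y : C} (g : X.obj i.succ.castSucc ⟶ Y)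
    (hg : (X.map i.succ : X.obj i.succ.succ ⟶ X.obj i.succ.castSucc) ≫ g = 0) :
    ∃ h : X.obj i.castSucc.castSucc ⟶ Y,
      (X.map i.castSucc : X.obj i.succ.castSucc ⟶ X.obj i.castSucc.castSucc) ≫ h = g := by
  induction i using Fin.reverseInduction generalizing X with
  | last => exact desc_first hX g hg
  | cast i ih => exact ih ((𝒜.rotate_mem_iff _).1 hX) g hg

lemma exists_desc_final (hX : 𝒜.IsAngle X) {Y : C} (g : X.obj (0 : Fin (n + 2)).castSucc ⟶ Y)
    (hg : X.final ≫ g = 0) : ∃ h, X.conn ≫ h = g :=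
  exists_desc ((𝒜.rotate_mem_iff _).1 hX) 0 g hg

end Angulation

namespace SuspSeq

variable {d : ℕ} {S : C ⥤ C} [S.Full] [S.Faithful]

/-- A morphism between rotations of sequences comes from a morphism of sequences. -/
lemma exists_hom_of_rotate {X Y : SuspSeq d S} (φ : X.rotate.Hom Y.rotate) :
    ∃ ψ : X.Hom Y, ∀ i : Fin (d + 1), ψ.app i.castSucc = φ.app i.succ := by
  let φ₀ : S.obj (X.obj (Fin.last d).succ) ⟶ S.obj (Y.obj (Fin.last d).succ) := φ.app 0
  let f' : ∀ i : Fin (d + 1), X.obj i.castSucc ⟶ Y.obj i.castSucc := fun i => φ.app i.succ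
  have hf : ∀ i : Fin d, (X.map i.castSucc : X.obj i.succ.castSucc ⟶ X.obj i.castSucc.castSucc) ≫
      f' i.castSucc = f' i.succ ≫
        (Y.map i.castSucc : Y.obj i.succ.castSucc ⟶ Y.obj i.castSucc.castSucc) :=
    fun i => φ.comm i.succ
  have hf₀ : X.conn ≫ φ₀ = f' 0 ≫ Y.conn := φ.comm 0
  have h : (((-1 : ℤ) ^ (d + 2)) • S.map X.first) ≫ S.map (f' (Fin.last d)) =
      φ₀ ≫ (((-1 : ℤ) ^ (d + 2)) • S.map Y.first) := φ.comm_conn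
  rw [Preadditive.zsmul_comp, Preadditive.comp_zsmul] at h
  replace h := sign_smul_cancel _ h
  let f : ∀ i : Fin (d + 2), X.obj i ⟶ Y.obj i := Fin.lastCases (S.preimage φ₀) f'
  have f1 : f (Fin.last d).succ = S.preimage φ₀ := Fin.lastCases_last
  have f2 : ∀ i : Fin (d + 1), f i.castSucc = f' i := fun i => Fin.lastCases_castSucc _
  refine ⟨⟨f, ?_, ?_⟩, f2⟩
  · intro i
    induction i using Fin.lastCases with
    | last =>
      rw [f1, f2]
      apply S.map_injective
      rw [S.map_comp, S.map_comp, S.map_preimage]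
      exact h
    | cast i =>
      rw [f2]
      have : f i.castSucc.succ = f' i.succ := f2 i.succ
      rw [this]
      exact hf i
  · rw [f1, S.map_preimage]
    have : f (Fin.castSucc 0) = f' 0 := f2 0
    rw [this]
    exact hf₀

end SuspSeq

namespace Angulation

variable [HasFiniteBiproducts C] {n : ℕ} {𝒜 : Angulation (n + 1) C}

/-- Two adjacent components of a morphism of angles may be prescribed. -/
lemma exists_hom_of_comm {X Y : SuspSeq (n + 1) 𝒜.susp.functor} (hX : 𝒜.IsAngle X)
    (hY : 𝒜.IsAngle Y) (i : Fin (n + 2)) (a : X.obj i.succ ⟶ Y.obj i.succ)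
    (b : X.obj i.castSucc ⟶ Y.obj i.castSucc) (hab : X.map i ≫ b = a ≫ Y.map i) :
    ∃ φ : X.Hom Y, φ.app i.succ = a ∧ φ.app i.castSucc = b := by
  induction i using Fin.reverseInduction generalizing X Y with
  | last => exact 𝒜.exists_hom X Y hX hY a b hab
  | cast i ih =>
    obtain ⟨φ, h₁, h₂⟩ := ih ((𝒜.rotate_mem_iff _).1 hX) ((𝒜.rotate_mem_iff _).1 hY) a b hab
    obtain ⟨ψ, hψ⟩ := SuspSeq.exists_hom_of_rotate φ
    exact ⟨ψ, (hψ i.succ).trans h₁, (hψ i.castSucc).trans h₂⟩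

/-- An idempotent endomorphism of an angle splits. -/
lemma exists_split {d : ℕ} {𝒜 : Angulation d C} [IsIdempotentComplete C]
    {X : SuspSeq d 𝒜.susp.functor}
    (hX : 𝒜.IsAngle X) (φ : X.Hom X) (hφ : ∀ i, φ.app i ≫ φ.app i = φ.app i) :
    ∃ (Y : SuspSeq d 𝒜.susp.functor) (ι : ∀ i, Y.obj i ⟶ X.obj i) (ρ : ∀ i, X.obj i ⟶ Y.obj i),
      𝒜.IsAngle Y ∧ (∀ i, ι i ≫ ρ i = 𝟙 _) ∧ (∀ i, ρ i ≫ ι i = φ.app i) ∧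
      (∀ i, Y.map i = ι i.succ ≫ X.map i ≫ ρ i.castSucc) ∧
      Y.conn = ι _ ≫ X.conn ≫ 𝒜.susp.functor.map (ρ _) := by
  choose Y ι ρ h₁ h₂ using fun i => IsIdempotentComplete.idempotents_split _ (φ.app i) (hφ i)
  have hι : ∀ i, ι i ≫ φ.app i = ι i := fun i => by rw [← h₂, ← Category.assoc, h₁, Category.id_comp]
  have hρ : ∀ i, φ.app i ≫ ρ i = ρ i := fun i => by rw [← h₂, Category.assoc, h₁, Category.comp_id]
  let Z : SuspSeq d 𝒜.susp.functor :=
    { obj := Y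
      map := fun i => ι i.succ ≫ X.map i ≫ ρ i.castSucc
      conn := ι _ ≫ X.conn ≫ 𝒜.susp.functor.map (ρ _) }
  refine ⟨Z, ι, ρ, ?_, h₁, h₂, fun _ => rfl, rfl⟩
  refine 𝒜.summand_mem Z X ⟨ι, fun i => ?_, ?_⟩ ⟨ρ, fun i => ?_, ?_⟩ h₁ hX
  · simp only [Z, Category.assoc, h₂]
    rw [φ.comm, ← Category.assoc, hι]
  · simp only [Z, Category.assoc, ← Functor.map_comp, h₂]
    rw [φ.comm_conn, ← Category.assoc, hι]
  · simp only [Z, ← Category.assoc, h₂]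
    rw [← φ.comm, Category.assoc, hρ]
  · simp only [Z, ← Category.assoc, h₂]
    rw [← φ.comm_conn, Category.assoc, ← Functor.map_comp, hρ]

end Angulation

end Angles

/-! ### Finite dimensional modules -/

section FinDim

variable (k : Type w) [Field k] {A : Type v} [Ring A] [Algebra k A]

/-- The `k`-vector space underlying an `A`-module. -/
abbrev resMod (M : ModuleCat.{v} A) : Module k M := Module.restrictScalars k A M

attribute [local instance] resMod

instance resMod_tower (M : ModuleCat.{v} A) : IsScalarTower k A M :=
  IsScalarTower.restrictScalars k A M

/-- The `k`-linear map underlying a morphism of `A`-modules. -/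
def resMap {M N : ModuleCat.{v} A} (f : M ⟶ N) : M →ₗ[k] N := f.hom.restrictScalars k

/-- The dimension over `k` of an `A`-module. -/
def dimk (M : ModuleCat.{v} A) : ℕ := Module.finrank k M

variable {k}

lemma isFinDim_of_injective {M N : ModuleCat.{v} A} (f : M ⟶ N) (hf : Function.Injective f.hom)
    (hN : IsFinDim k N) : IsFinDim k M :=
  have : Module.Finite k N := hN
  Module.Finite.of_injective (resMap k f) hf

lemma isFinDim_of_surjective {M N : ModuleCat.{v} A} (f : M ⟶ N) (hf : Function.Surjective f.hom)
    (hM : IsFinDim k M) : IsFinDim k N :=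
  have : Module.Finite k M := hM
  Module.Finite.of_surjective (resMap k f) hf

lemma bijective_of_surjective_of_dimk_le {M N : ModuleCat.{v} A} (f : M ⟶ N)
    (hf : Function.Surjective f.hom) (hM : IsFinDim k M) (h : dimk k M ≤ dimk k N) :
    Function.Bijective f.hom := by
  have : Module.Finite k M := hM
  have hN : Module.Finite k N := isFinDim_of_surjective f hf hM
  have hr := LinearMap.finrank_range_le (resMap k f)
  have ht : LinearMap.range (resMap k f) = ⊤ := LinearMap.range_eq_top.2 hf
  rw [ht, finrank_top] at hr
  exact ⟨(LinearMap.injective_iff_surjective_of_finrank_eq_finrank (f := resMap k f)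
    (le_antisymm h hr)).2 hf, hf⟩

lemma bijective_of_injective_of_dimk_le {M N : ModuleCat.{v} A} (f : M ⟶ N)
    (hf : Function.Injective f.hom) (hN : IsFinDim k N) (h : dimk k N ≤ dimk k M) :
    Function.Bijective f.hom := by
  have : Module.Finite k N := hN
  have hM : Module.Finite k M := isFinDim_of_injective f hf hN
  have hr := LinearMap.finrank_le_finrank_of_injective (f := resMap k f) hf
  exact ⟨hf, (LinearMap.injective_iff_surjective_of_finrank_eq_finrank (f := resMap k f)
    (le_antisymm hr h)).1 hf⟩

end FinDim

section Minimality

variable {A : Type v} [Ring A]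

lemma isSuperfluous_ker_of_forall {P M : ModuleCat.{v} A} [Projective P] {p : P ⟶ M}
    (hp : Function.Surjective p.hom)
    (h : ∀ q : P ⟶ P, q ≫ p = p → Function.Surjective q.hom) :
    IsSuperfluous (LinearMap.ker p.hom) := by
  intro L hL
  have hq : Function.Surjective (p.hom ∘ₗ L.subtype) := by
    intro y
    obtain ⟨x, rfl⟩ := hp y
    obtain ⟨a, ha, b, hb, rfl⟩ := Submodule.mem_sup.1
      (show x ∈ LinearMap.ker p.hom ⊔ L by rw [hL]; trivial)
    refine ⟨⟨b, hb⟩, ?_⟩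
    rw [map_add, LinearMap.mem_ker.1 ha, zero_add]
    rfl
  have : Epi (ModuleCat.ofHom (p.hom ∘ₗ L.subtype)) := (ModuleCat.epi_iff_surjective _).2 hq
  have hs := h (Projective.factorThru p (ModuleCat.ofHom (p.hom ∘ₗ L.subtype)) ≫
    ModuleCat.ofHom L.subtype) (by
      rw [Category.assoc]
      exact Projective.factorThru_comp p (ModuleCat.ofHom (p.hom ∘ₗ L.subtype)))
  rw [eq_top_iff]
  rintro x -
  obtain ⟨y, rfl⟩ := hs x
  exact Subtype.mem _

lemma isEssential_range_of_forall {N I : ModuleCat.{v} A} [Injective I] {u : N ⟶ I}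
    (hu : Function.Injective u.hom)
    (h : ∀ q : I ⟶ I, u ≫ q = u → Function.Injective q.hom) :
    IsEssential (LinearMap.range u.hom) := by
  intro L hL
  have hq : Function.Injective (L.mkQ ∘ₗ u.hom) := by
    rw [← LinearMap.ker_eq_bot, eq_bot_iff]
    intro x hx
    have hx' : u.hom x ∈ L := by
      rw [LinearMap.mem_ker, LinearMap.comp_apply] at hx
      simpa using hx
    have : u.hom x ∈ LinearMap.range u.hom ⊓ L := ⟨⟨x, rfl⟩, hx'⟩
    rw [hL] at this
    exact hu ((Submodule.mem_bot _).1 this |>.trans (map_zero u.hom).symm)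
  have : Mono (ModuleCat.ofHom (L.mkQ ∘ₗ u.hom)) := (ModuleCat.mono_iff_injective _).2 hq
  have hs := h (ModuleCat.ofHom L.mkQ ≫
    Injective.factorThru u (ModuleCat.ofHom (L.mkQ ∘ₗ u.hom))) (by
      rw [← Category.assoc]
      exact Injective.comp_factorThru u (ModuleCat.ofHom (L.mkQ ∘ₗ u.hom)))
  rw [eq_bot_iff]
  intro x hx
  refine (Submodule.mem_bot _).2 (hs ?_)
  rw [map_zero, ModuleCat.hom_comp, LinearMap.comp_apply]
  have : L.mkQ x = 0 := by simpa using hx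
  refine (congrArg _ this).trans ?_
  exact map_zero _

/-- An endomorphism fixing the map with superfluous kernel is surjective. -/
lemma IsSuperfluous.surjective {P M : ModuleCat.{v} A} {p : P ⟶ M}
    (h : IsSuperfluous (LinearMap.ker p.hom)) (q : P ⟶ P) (hq : q ≫ p = p) :
    Function.Surjective q.hom := by
  rw [← LinearMap.range_eq_top]
  refine h _ (eq_top_iff.2 fun x _ => ?_)
  refine Submodule.mem_sup.2 ⟨x - q.hom x, ?_, q.hom x, ⟨x, rfl⟩, sub_add_cancel _ _⟩
  rw [LinearMap.mem_ker, map_sub, sub_eq_zero]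
  exact (congrArg (fun φ => φ.hom x) hq).symm

lemma IsEssential.injective {N I : ModuleCat.{v} A} {u : N ⟶ I}
    (h : IsEssential (LinearMap.range u.hom)) (q : I ⟶ I) (hq : u ≫ q = u) :
    Function.Injective q.hom := by
  rw [← LinearMap.ker_eq_bot]
  refine h _ (eq_bot_iff.2 ?_)
  rintro _ ⟨⟨x, rfl⟩, hx⟩
  have : q.hom (u.hom x) = u.hom x := congrArg (fun φ => φ.hom x) hq
  rw [Submodule.mem_bot, ← this]
  exact hx

/-- The kernel of a morphism of modules. -/
def kerObj {M N : ModuleCat.{v} A} (p : M ⟶ N) : ModuleCat.{v} A :=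
  ModuleCat.of A (LinearMap.ker p.hom)

/-- The inclusion of the kernel. -/
def kerι {M N : ModuleCat.{v} A} (p : M ⟶ N) : kerObj p ⟶ M :=
  ModuleCat.ofHom (LinearMap.ker p.hom).subtype

lemma kerι_injective {M N : ModuleCat.{v} A} (p : M ⟶ N) : Function.Injective (kerι p).hom :=
  Submodule.subtype_injective _

lemma range_kerι {M N : ModuleCat.{v} A} (p : M ⟶ N) :
    LinearMap.range (kerι p).hom = LinearMap.ker p.hom :=
  Submodule.range_subtype _

/-- The cokernel of a morphism of modules. -/
def cokObj {M N : ModuleCat.{v} A} (u : M ⟶ N) : ModuleCat.{v} A :=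
  ModuleCat.of A (N ⧸ LinearMap.range u.hom)

/-- The projection to the cokernel. -/
def cokπ {M N : ModuleCat.{v} A} (u : M ⟶ N) : N ⟶ cokObj u :=
  ModuleCat.ofHom (LinearMap.range u.hom).mkQ

lemma cokπ_surjective {M N : ModuleCat.{v} A} (u : M ⟶ N) : Function.Surjective (cokπ u).hom :=
  Submodule.mkQ_surjective _

lemma ker_cokπ {M N : ModuleCat.{v} A} (u : M ⟶ N) :
    LinearMap.ker (cokπ u).hom = LinearMap.range u.hom :=
  Submodule.ker_mkQ _

lemma range_comp_of_surjective {L M N : ModuleCat.{v} A} (f : L ⟶ M) (g : M ⟶ N)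
    (hf : Function.Surjective f.hom) :
    LinearMap.range (f ≫ g).hom = LinearMap.range g.hom := by
  rw [ModuleCat.hom_comp, LinearMap.range_comp, LinearMap.range_eq_top.2 hf, Submodule.map_top]

lemma ker_comp_of_injective {L M N : ModuleCat.{v} A} (f : L ⟶ M) (g : M ⟶ N)
    (hg : Function.Injective g.hom) :
    LinearMap.ker (f ≫ g).hom = LinearMap.ker f.hom := by
  rw [ModuleCat.hom_comp, LinearMap.ker_comp_of_ker_eq_bot _ (LinearMap.ker_eq_bot.2 hg)]

lemma surjective_of_comp {L M N : ModuleCat.{v} A} {f : L ⟶ M} {g : M ⟶ N}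
    (h : Function.Surjective (f ≫ g).hom) : Function.Surjective g.hom := by
  rw [ModuleCat.hom_comp, LinearMap.coe_comp] at h
  exact h.of_comp

lemma injective_of_comp {L M N : ModuleCat.{v} A} {f : L ⟶ M} {g : M ⟶ N}
    (h : Function.Injective (f ≫ g).hom) : Function.Injective f.hom := by
  rw [ModuleCat.hom_comp, LinearMap.coe_comp] at h
  exact h.of_comp

end Minimality


/-! ### The functor `𝒯(T, -)` -/

section HomFunctor

variable {C : Type u} [Category.{v} C] [Preadditive C] {T : C}

/-- A morphism `T ⟶ X` as an element of the module `𝒯(T, X)`. -/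
def el {X : C} (x : T ⟶ X) : (homFunctor T).obj X := x

/-- An element of the module `𝒯(T, X)` as a morphism `T ⟶ X`. -/
def un {X : C} (x : (homFunctor T).obj X) : T ⟶ X := x

section

variable {X Y : C}

@[simp] lemma el_un (x : (homFunctor T).obj X) : el (un x) = x := rfl
@[simp] lemma un_el (x : T ⟶ X) : un (el x) = x := rfl
lemma map_el (f : X ⟶ Y) (x : T ⟶ X) : ((homFunctor T).map f).hom (el x) = el (x ≫ f) := rfl
lemma el_add (x y : T ⟶ X) : el (x + y) = el x + el y := rfl
@[simp] lemma el_zero : el (0 : T ⟶ X) = 0 := rfl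
lemma el_surj (m : (homFunctor T).obj X) : ∃ x, el x = m := ⟨un m, rfl⟩
lemma el_sum {n : ℕ} (x : Fin n → (T ⟶ X)) : el (∑ j, x j) = ∑ j, el (x j) :=
  map_sum (⟨⟨el, el_zero⟩, el_add⟩ : (T ⟶ X) →+ (homFunctor T).obj X) x Finset.univ

/-- A morphism `T ⟶ T` as a scalar. -/
def sc (γ : T ⟶ T) : (End T)ᵐᵒᵖ := MulOpposite.op γ

lemma sc_smul_el (γ : T ⟶ T) (x : T ⟶ X) : sc γ • el x = el (γ ≫ x) := rfl
lemma sc_add (γ δ : T ⟶ T) : sc (γ + δ) = sc γ + sc δ := rfl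
lemma sc_mul (γ δ : T ⟶ T) : sc γ * sc δ = sc (γ ≫ δ) := rfl
lemma sc_surj (γ : (End T)ᵐᵒᵖ) : ∃ δ : T ⟶ T, sc δ = γ := ⟨MulOpposite.unop γ, rfl⟩
@[simp] lemma sc_one : sc (𝟙 T) = 1 := rfl
@[simp] lemma sc_zero : sc (0 : T ⟶ T) = 0 := rfl

lemma homFunctor_map_eq_zero_iff (f : X ⟶ Y) :
    (homFunctor T).map f = 0 ↔ ∀ t : T ⟶ X, t ≫ f = 0 := by
  constructor
  · intro h t
    have := congrArg (fun φ => φ.hom (el t)) h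
    exact this
  · intro h
    ext t
    exact h t

end

section IsAdd

variable [HasFiniteBiproducts C]

lemma isAdd_iff {X : C} : IsAdd T X ↔
    ∃ (n : ℕ) (s : Fin n → (X ⟶ T)) (t : Fin n → (T ⟶ X)), ∑ j, s j ≫ t j = 𝟙 X := by
  constructor
  · rintro ⟨n, ⟨r⟩⟩
    refine ⟨n, fun j => r.i ≫ biproduct.π _ j, fun j => biproduct.ι (fun _ => T) j ≫ r.r, ?_⟩
    have h := r.retract
    rw [← Category.id_comp r.r, ← biproduct.total, Preadditive.sum_comp, Preadditive.comp_sum] at h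
    simpa using h
  · rintro ⟨n, s, t, h⟩
    refine ⟨n, ⟨⟨biproduct.lift s, biproduct.desc t, ?_⟩⟩⟩
    rw [biproduct.lift_desc, h]

lemma IsAdd.of_retract {X Y : C} (hX : IsAdd T X) (i : Y ⟶ X) (r : X ⟶ Y) (h : i ≫ r = 𝟙 Y) :
    IsAdd T Y := by
  obtain ⟨n, ⟨ρ⟩⟩ := hX
  exact ⟨n, ⟨(Retract.mk i r h).trans ρ⟩⟩

lemma isAdd_of_isZero {X : C} (h : IsZero X) : IsAdd T X :=
  isAdd_iff.2 ⟨0, Fin.elim0, Fin.elim0, h.eq_of_src _ _⟩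

lemma isAdd_biproduct (n : ℕ) : IsAdd T (⨁ fun _ : Fin n => T) := ⟨n, ⟨Retract.refl _⟩⟩

lemma eq_sum_of_sum_eq {X : C} {n : ℕ} {s : Fin n → (X ⟶ T)} {t : Fin n → (T ⟶ X)}
    (h : ∑ j, s j ≫ t j = 𝟙 X) (m : (homFunctor T).obj X) :
    m = ∑ j, sc (un m ≫ s j) • el (t j) := by
  simp only [sc_smul_el, Category.assoc]
  rw [← el_sum, ← Preadditive.comp_sum, h, Category.comp_id, el_un]

lemma IsAdd.map_injective {X Y : C} (hX : IsAdd T X) {f g : X ⟶ Y}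
    (h : (homFunctor T).map f = (homFunctor T).map g) : f = g := by
  obtain ⟨n, s, t, hst⟩ := isAdd_iff.1 hX
  rw [← sub_eq_zero, ← Functor.map_sub, homFunctor_map_eq_zero_iff] at h
  rw [← sub_eq_zero, ← Category.id_comp (f - g), ← hst, Preadditive.sum_comp]
  refine Finset.sum_eq_zero fun j _ => ?_
  rw [Category.assoc, h, comp_zero]

/-- A linear map out of `𝒯(T, X)`, with `X ∈ add T`, is determined by generators. -/
lemma hom_apply_eq_sum {X : C} {n : ℕ} {s : Fin n → (X ⟶ T)} {t : Fin n → (T ⟶ X)}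
    (h : ∑ j, s j ≫ t j = 𝟙 X) {M : ModuleCat.{v} (End T)ᵐᵒᵖ} (θ : (homFunctor T).obj X ⟶ M)
    (m : (homFunctor T).obj X) : θ.hom m = ∑ j, sc (un m ≫ s j) • θ.hom (el (t j)) := by
  conv_lhs => rw [eq_sum_of_sum_eq h m, map_sum]
  simp only [map_smul]

lemma IsAdd.exists_map_eq {X Y : C} (hX : IsAdd T X)
    (θ : (homFunctor T).obj X ⟶ (homFunctor T).obj Y) : ∃ f, (homFunctor T).map f = θ := by
  obtain ⟨n, s, t, hst⟩ := isAdd_iff.1 hX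
  refine ⟨∑ j, s j ≫ un (θ.hom (el (t j))), ?_⟩
  ext m
  rw [hom_apply_eq_sum hst θ m, ← el_un m, map_el, un_el, Preadditive.comp_sum, el_sum]
  refine Finset.sum_congr rfl fun j _ => ?_
  rw [← Category.assoc, ← sc_smul_el, el_un]

end IsAdd

/-- The `Γ`-linear map `𝒯(T, X) ⟶ M` with `x ↦ ∑ (x s_j) m_j`. -/
def coordMap {X : C} {n : ℕ} (s : Fin n → (X ⟶ T)) {M : ModuleCat.{v} (End T)ᵐᵒᵖ}
    (m : Fin n → M) : (homFunctor T).obj X ⟶ M :=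
  ModuleCat.ofHom
    { toFun := fun x => ∑ j, sc (un x ≫ s j) • m j
      map_add' := fun x y => by
        rw [← Finset.sum_add_distrib]
        refine Finset.sum_congr rfl fun j _ => ?_
        rw [← add_smul, ← sc_add, ← Preadditive.add_comp]
        rfl
      map_smul' := fun γ x => by
        rw [RingHom.id_apply, Finset.smul_sum]
        refine Finset.sum_congr rfl fun j _ => ?_
        obtain ⟨δ, rfl⟩ := sc_surj γ
        rw [smul_smul, sc_mul, ← Category.assoc]
        rfl }

lemma coordMap_apply {X : C} {n : ℕ} (s : Fin n → (X ⟶ T)) {M : ModuleCat.{v} (End T)ᵐᵒᵖ}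
    (m : Fin n → M) (x : (homFunctor T).obj X) :
    (coordMap s m).hom x = ∑ j, sc (un x ≫ s j) • m j := rfl

lemma IsAdd.projective [HasFiniteBiproducts C] {X : C} (hX : IsAdd T X) :
    Projective ((homFunctor T).obj X) where
  factors {M N} θ e he := by
    obtain ⟨n, s, t, hst⟩ := isAdd_iff.1 hX
    have he' := (ModuleCat.epi_iff_surjective e).1 he
    choose m hm using fun j => he' (θ.hom (el (t j)))
    refine ⟨coordMap s m, ?_⟩
    ext x
    rw [hom_apply_eq_sum hst θ x, ModuleCat.hom_comp, LinearMap.comp_apply, coordMap_apply, map_sum]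
    refine Finset.sum_congr rfl fun j _ => ?_
    rw [map_smul, hm]

variable (k : Type w) [Field k] [Linear k C]

lemma algebraMap_smul_el (c : k) {X : C} (x : T ⟶ X) :
    algebraMap k (End T)ᵐᵒᵖ c • el x = el (c • x) := by
  change el ((c • 𝟙 T) ≫ x) = _
  rw [Linear.smul_comp, Category.id_comp]

lemma isFinDim_hom (hfin : ∀ X Y : C, Module.Finite k (X ⟶ Y)) (X : C) :
    IsFinDim k ((homFunctor T).obj X) := by
  have := hfin T X
  let : Module k ((homFunctor T).obj X) := Module.restrictScalars k (End T)ᵐᵒᵖ _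
  let f : (T ⟶ X) →ₗ[k] (homFunctor T).obj X :=
    { toFun := el
      map_add' := el_add
      map_smul' := fun c x => (algebraMap_smul_el k c x).symm }
  exact Module.Finite.of_surjective f el_surj

variable {k}

variable [HasFiniteBiproducts C]

lemma exists_epi {M : ModuleCat.{v} (End T)ᵐᵒᵖ} (hM : IsFinDim k M) :
    ∃ (X : C) (p : (homFunctor T).obj X ⟶ M), IsAdd T X ∧ Function.Surjective p.hom := by
  let := resMod k M
  have : Module.Finite k M := hM
  obtain ⟨n, m, hm⟩ := Module.Finite.exists_fin (R := k) (M := M)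
  refine ⟨⨁ fun _ : Fin n => T, coordMap (fun j => biproduct.π _ j) m, isAdd_biproduct n, ?_⟩
  rw [← LinearMap.range_eq_top, eq_top_iff]
  intro y _
  have hy : y ∈ Submodule.span k (Set.range m) := by rw [hm]; trivial
  induction hy using Submodule.span_induction with
  | mem x hx =>
    obtain ⟨j, rfl⟩ := hx
    refine ⟨el (biproduct.ι (fun _ : Fin n => T) j), ?_⟩
    rw [coordMap_apply, Finset.sum_eq_single j]
    · rw [un_el, biproduct.ι_π_self, sc_one, one_smul]
    · intro b _ hb
      rw [un_el, biproduct.ι_π_ne _ hb.symm, sc_zero, zero_smul]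
    · simp
  | zero => exact zero_mem _
  | add x y _ _ hx hy => exact add_mem (hx trivial) (hy trivial)
  | smul c x _ hx =>
    exact Submodule.smul_mem _ (algebraMap k (End T)ᵐᵒᵖ c) (hx trivial)

variable [IsIdempotentComplete C]

/-- Finite dimensional modules have projective covers of the form `𝒯(T, X)`, `X ∈ add T`. -/
lemma exists_projectiveCover (hfin : ∀ X Y : C, Module.Finite k (X ⟶ Y))
    {M : ModuleCat.{v} (End T)ᵐᵒᵖ} (hM : IsFinDim k M) :
    ∃ (X : C) (p : (homFunctor T).obj X ⟶ M), IsAdd T X ∧ Function.Surjective p.hom ∧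
      IsSuperfluous (LinearMap.ker p.hom) := by
  classical
  let P : ℕ → Prop := fun m => ∃ (X : C) (p : (homFunctor T).obj X ⟶ M), IsAdd T X ∧
    Function.Surjective p.hom ∧ dimk k ((homFunctor T).obj X) = m
  have hP : ∃ m, P m := by
    obtain ⟨X, p, h₁, h₂⟩ := exists_epi (T := T) hM
    exact ⟨_, X, p, h₁, h₂, rfl⟩
  obtain ⟨X, p, hX, hp, hd⟩ := Nat.find_spec hP
  have := hX.projective
  refine ⟨X, p, hX, hp, isSuperfluous_ker_of_forall hp fun q hq => ?_⟩
  obtain ⟨φ, rfl⟩ := hX.exists_map_eq q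
  obtain ⟨e, he⟩ := exists_isFitting k hfin φ
  have hep : (homFunctor T).map e ≫ p = p := (he.functor_map _).comp_of_eq_comp p hq
  obtain ⟨Y, i, r, hir, hri⟩ := IsIdempotentComplete.idempotents_split X e he.idem
  have hY : IsAdd T Y := hX.of_retract i r hir
  have hs : Function.Surjective ((homFunctor T).map i ≫ p).hom := by
    have h : Function.Surjective ((homFunctor T).map r ≫ (homFunctor T).map i ≫ p).hom := by
      rw [← Category.assoc, ← Functor.map_comp, hri, hep]; exact hp
    exact surjective_of_comp h
  have hle : dimk k ((homFunctor T).obj X) ≤ dimk k ((homFunctor T).obj Y) := by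
    rw [hd]; exact Nat.find_min' hP ⟨Y, _, hY, hs, rfl⟩
  have hinj : Function.Injective ((homFunctor T).map i).hom := by
    rw [← ModuleCat.mono_iff_injective]
    have : IsSplitMono i := ⟨⟨r, hir⟩⟩
    infer_instance
  have hi := (bijective_of_injective_of_dimk_le _ hinj (isFinDim_hom k hfin X) hle).2
  have hr : Function.Surjective ((homFunctor T).map r).hom := by
    rw [← ModuleCat.epi_iff_surjective]
    have : IsSplitEpi r := ⟨⟨i, hir⟩⟩
    infer_instance
  obtain ⟨x, -, hx⟩ := he.exists_fac
  have h : Function.Surjective ((homFunctor T).map x ≫ (homFunctor T).map φ).hom := by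
    rw [← Functor.map_comp, hx, ← hri, Functor.map_comp]
    exact hi.comp hr
  exact surjective_of_comp h

/-- The kernel of a morphism from `𝒯(T, X)` has a projective cover `𝒯(T, Y)`, `Y ∈ add T`. -/
lemma exists_cover_ker (hfin : ∀ X Y : C, Module.Finite k (X ⟶ Y)) {X : C}
    {M : ModuleCat.{v} (End T)ᵐᵒᵖ} (p : (homFunctor T).obj X ⟶ M) :
    ∃ (Y : C) (f : Y ⟶ X), IsAdd T Y ∧
      LinearMap.range ((homFunctor T).map f).hom = LinearMap.ker p.hom ∧
      IsSuperfluous (LinearMap.ker ((homFunctor T).map f).hom) := by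
  have hfd : IsFinDim k (kerObj p) :=
    isFinDim_of_injective _ (kerι_injective p) (isFinDim_hom k hfin X)
  obtain ⟨Y, q, hY, hq, hs⟩ := exists_projectiveCover hfin hfd
  obtain ⟨f, hf⟩ := hY.exists_map_eq (q ≫ kerι p)
  refine ⟨Y, f, hY, ?_, ?_⟩
  · rw [hf, range_comp_of_surjective _ _ hq, range_kerι]
  · rwa [hf, ker_comp_of_injective _ _ (kerι_injective p)]

lemma exists_minProjPresentation (hfin : ∀ X Y : C, Module.Finite k (X ⟶ Y))
    {M : ModuleCat.{v} (End T)ᵐᵒᵖ} (hM : IsFinDim k M) :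
    ∃ (T₁ T₀ : C) (f : T₁ ⟶ T₀) (p : (homFunctor T).obj T₀ ⟶ M), IsAdd T T₁ ∧ IsAdd T T₀ ∧
      IsMinProjPresentation ((homFunctor T).map f) p := by
  obtain ⟨T₀, p, h₀, hp, hs⟩ := exists_projectiveCover hfin hM
  obtain ⟨T₁, f, h₁, hr, hs'⟩ := exists_cover_ker hfin p
  exact ⟨T₁, T₀, f, p, h₁, h₀, h₁.projective, h₀.projective, hr, LinearMap.range_eq_top.2 hp,
    hs', hs⟩

end HomFunctor

/-! ### Injective modules from a Serre functor -/

section Serre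

variable {k : Type w} [Field k] {C : Type u} [Category.{v} C] [Preadditive C] [Linear k C] {T : C}

namespace SerreFunctor

lemma additive [HasFiniteBiproducts C] (S : SerreFunctor k C) : S.equiv.functor.Additive :=
  S.equiv.functor.additive_of_preserves_binary_products

attribute [local instance] resMod

variable (S : SerreFunctor k C)

/-- The linear form on `𝒯(T, S T) ≅ D 𝒯(T, T)` that evaluates at the identity. -/
def ev (w : T ⟶ S.equiv.functor.obj T) : k := (S.duality T T).symm w (𝟙 T)

lemma ev_comp {X : C} (v : T ⟶ X) (u : X ⟶ S.equiv.functor.obj T) :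
    S.ev (v ≫ u) = (S.duality T X).symm u v := by
  have h := S.naturality_right T v ((S.duality T X).symm u)
  rw [LinearEquiv.apply_symm_apply] at h
  rw [ev, ← h, LinearEquiv.symm_apply_apply]
  simp

lemma eq_of_ev {u v : T ⟶ S.equiv.functor.obj T}
    (h : ∀ γ : T ⟶ T, S.ev (γ ≫ u) = S.ev (γ ≫ v)) : u = v := by
  apply (S.duality T T).symm.injective
  ext γ
  rw [← ev_comp, ← ev_comp, h]

lemma ev_add (u v : T ⟶ S.equiv.functor.obj T) : S.ev (u + v) = S.ev u + S.ev v := by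
  simp [ev]

lemma ev_smul (c : k) (u : T ⟶ S.equiv.functor.obj T) : S.ev (c • u) = c * S.ev u := by
  simp [ev]

/-- The linear form `ev` on the module `𝒯(T, S T)`. -/
def evLin : ((homFunctor T).obj (S.equiv.functor.obj T)) →ₗ[k] k where
  toFun m := S.ev (un m)
  map_add' m m' := S.ev_add (un m) (un m')
  map_smul' c m := by
    obtain ⟨x, rfl⟩ := el_surj m
    have : (c • el x : (homFunctor T).obj (S.equiv.functor.obj T)) = el (c • x) :=
      algebraMap_smul_el k c x
    rw [this, un_el, un_el, ev_smul]
    rfl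

lemma evLin_el (x : T ⟶ S.equiv.functor.obj T) : S.evLin (el x) = S.ev x := rfl

/-- `Γ`-linear maps to `𝒯(T, S T)` are determined by the composite with `ev`. -/
lemma hom_ext_ev {M : ModuleCat.{v} (End T)ᵐᵒᵖ}
    {θ θ' : M ⟶ (homFunctor T).obj (S.equiv.functor.obj T)}
    (h : ∀ m, S.evLin (θ.hom m) = S.evLin (θ'.hom m)) : θ = θ' := by
  ext m
  rw [← el_un (θ.hom m), ← el_un (θ'.hom m)]
  refine congrArg el (S.eq_of_ev fun γ => ?_)
  have := h (sc γ • m)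
  rw [θ.hom.map_smul, θ'.hom.map_smul, ← el_un (θ.hom m), ← el_un (θ'.hom m), sc_smul_el, sc_smul_el] at this
  exact this

/-- The functional `γ ↦ l (γ m)` on `End T`. -/
def dualAux {M : ModuleCat.{v} (End T)ᵐᵒᵖ} (l : M →ₗ[k] k) (m : M) : Module.Dual k (T ⟶ T) where
  toFun γ := l (sc γ • m)
  map_add' γ δ := by rw [sc_add, add_smul, map_add]
  map_smul' c γ := by
    have : sc (c • γ) • m = c • (sc γ • m) := by
      change _ = algebraMap k (End T)ᵐᵒᵖ c • (sc γ • m)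
      rw [smul_smul]
      congr 1
      change sc (c • γ) = sc ((c • 𝟙 T) ≫ γ)
      rw [Linear.smul_comp, Category.id_comp]
    rw [this, map_smul]
    rfl

lemma dualAux_apply {M : ModuleCat.{v} (End T)ᵐᵒᵖ} (l : M →ₗ[k] k) (m : M) (γ : T ⟶ T) :
    dualAux l m γ = l (sc γ • m) := rfl

/-- Linear forms on a module correspond to `Γ`-linear maps to `𝒯(T, S T)`. -/
def ofDualLin {M : ModuleCat.{v} (End T)ᵐᵒᵖ} (l : M →ₗ[k] k) :
    M →ₗ[(End T)ᵐᵒᵖ] (homFunctor T).obj (S.equiv.functor.obj T) where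
  toFun m := el (S.duality T T (dualAux l m))
  map_add' m m' := by
    rw [← el_add, ← map_add]
    congr 2
    ext γ
    simp [dualAux_apply]
  map_smul' γ m := by
    obtain ⟨δ, rfl⟩ := sc_surj γ
    rw [RingHom.id_apply, sc_smul_el, ← S.naturality_right T δ]
    congr 2
    ext γ
    simp only [LinearMap.comp_apply, dualAux_apply, Linear.rightComp_apply, smul_smul, sc_mul]

/-- The morphism of modules underlying `ofDualLin`. -/
def ofDual {M : ModuleCat.{v} (End T)ᵐᵒᵖ} (l : M →ₗ[k] k) :
    M ⟶ (homFunctor T).obj (S.equiv.functor.obj T) :=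
  ModuleCat.ofHom (S.ofDualLin l)

lemma evLin_ofDual {M : ModuleCat.{v} (End T)ᵐᵒᵖ} (l : M →ₗ[k] k) (m : M) :
    S.evLin ((S.ofDual l).hom m) = l m := by
  change (S.duality T T).symm (S.duality T T (dualAux l m)) (𝟙 T) = _
  rw [LinearEquiv.symm_apply_apply, dualAux_apply, sc_one, one_smul]

lemma injective_obj : Injective ((homFunctor T).obj (S.equiv.functor.obj T)) where
  factors {M N} θ f hf := by
    have hinj : Function.Injective (resMap k f) := (ModuleCat.mono_iff_injective f).1 hf
    obtain ⟨g, hg⟩ := (resMap k f).exists_leftInverse_of_injective (LinearMap.ker_eq_bot.2 hinj)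
    refine ⟨S.ofDual (S.evLin ∘ₗ resMap k θ ∘ₗ g), S.hom_ext_ev fun m => ?_⟩
    rw [ModuleCat.hom_comp, LinearMap.comp_apply, evLin_ofDual]
    have : g (f.hom m) = m := congrArg (fun φ => φ m) hg
    rw [LinearMap.comp_apply, LinearMap.comp_apply, this]
    rfl

lemma map_injective_obj {X : C} {u v : X ⟶ S.equiv.functor.obj T}
    (h : (homFunctor T).map u = (homFunctor T).map v) : u = v := by
  apply (S.duality T X).symm.injective
  ext x
  rw [← ev_comp, ← ev_comp]
  exact congrArg (fun φ => S.evLin (φ.hom (el x))) h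

lemma exists_map_eq_obj {X : C}
    (θ : (homFunctor T).obj X ⟶ (homFunctor T).obj (S.equiv.functor.obj T)) :
    ∃ u, (homFunctor T).map u = θ := by
  let l : Module.Dual k (T ⟶ X) :=
    { toFun := fun x => S.evLin (θ.hom (el x))
      map_add' := fun x y => by rw [el_add, map_add, map_add]
      map_smul' := fun c x => by
        rw [← algebraMap_smul_el, map_smul]
        exact S.evLin.map_smul c _ }
  refine ⟨S.duality T X l, S.hom_ext_ev fun m => ?_⟩
  obtain ⟨x, rfl⟩ := el_surj m
  rw [map_el, evLin_el, ev_comp, LinearEquiv.symm_apply_apply]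
  rfl

lemma exists_map_apply_ne_zero {M : ModuleCat.{v} (End T)ᵐᵒᵖ} {m : M} (hm : m ≠ 0) :
    ∃ θ : M ⟶ (homFunctor T).obj (S.equiv.functor.obj T), θ.hom m ≠ 0 := by
  obtain ⟨l, hl⟩ : ∃ l : M →ₗ[k] k, l m ≠ 0 := by
    by_contra! h
    exact hm ((Module.forall_dual_apply_eq_zero_iff k m).1 h)
  refine ⟨S.ofDual l, fun h => hl ?_⟩
  rw [← S.evLin_ofDual l, h, map_zero]

end SerreFunctor

variable [HasFiniteBiproducts C] (S : SerreFunctor k C)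

lemma IsAdd.serre_sum {X : C} (hX : IsAdd T X) : ∃ (n : ℕ)
    (s : Fin n → (S.equiv.functor.obj X ⟶ S.equiv.functor.obj T))
    (t : Fin n → (S.equiv.functor.obj T ⟶ S.equiv.functor.obj X)), ∑ j, s j ≫ t j = 𝟙 _ := by
  have := S.additive
  obtain ⟨n, s, t, h⟩ := isAdd_iff.1 hX
  refine ⟨n, fun j => S.equiv.functor.map (s j), fun j => S.equiv.functor.map (t j), ?_⟩
  simp only [← Functor.map_comp]
  rw [← Functor.map_sum, h, CategoryTheory.Functor.map_id]

lemma IsAdd.serre_injective {X : C} (hX : IsAdd T X) :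
    Injective ((homFunctor T).obj (S.equiv.functor.obj X)) where
  factors {M N} θ f hf := by
    obtain ⟨n, s, t, h⟩ := hX.serre_sum S
    have := S.injective_obj (T := T)
    refine ⟨∑ j, Injective.factorThru (θ ≫ (homFunctor T).map (s j)) f ≫ (homFunctor T).map (t j),
      ?_⟩
    simp only [Preadditive.comp_sum, ← Category.assoc, Injective.comp_factorThru]
    simp only [Category.assoc]
    rw [← Preadditive.comp_sum]
    simp only [← Functor.map_comp]
    rw [← Functor.map_sum, h, CategoryTheory.Functor.map_id, Category.comp_id]

lemma IsAdd.serre_map_injective {X Y : C} (hX : IsAdd T X) {u v : Y ⟶ S.equiv.functor.obj X}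
    (huv : (homFunctor T).map u = (homFunctor T).map v) : u = v := by
  obtain ⟨n, s, t, h⟩ := hX.serre_sum S
  rw [← Category.comp_id u, ← Category.comp_id v, ← h, Preadditive.comp_sum, Preadditive.comp_sum]
  refine Finset.sum_congr rfl fun j _ => ?_
  have : u ≫ s j = v ≫ s j := S.map_injective_obj (by rw [Functor.map_comp, huv, Functor.map_comp])
  rw [← Category.assoc, this, Category.assoc]

lemma IsAdd.serre_exists_map_eq {X Y : C} (hX : IsAdd T X)
    (θ : (homFunctor T).obj Y ⟶ (homFunctor T).obj (S.equiv.functor.obj X)) :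
    ∃ u, (homFunctor T).map u = θ := by
  obtain ⟨n, s, t, h⟩ := hX.serre_sum S
  choose u hu using fun j => S.exists_map_eq_obj (θ ≫ (homFunctor T).map (s j))
  refine ⟨∑ j, u j ≫ t j, ?_⟩
  simp only [Functor.map_sum, Functor.map_comp, hu, Category.assoc]
  rw [← Preadditive.comp_sum]
  simp only [← Functor.map_comp]
  rw [← Functor.map_sum, h, CategoryTheory.Functor.map_id, Category.comp_id]

attribute [local instance] resMod in
lemma exists_mono {N : ModuleCat.{v} (End T)ᵐᵒᵖ} (hN : IsFinDim k N) :
    ∃ (X : C) (u : N ⟶ (homFunctor T).obj (S.equiv.functor.obj X)), IsAdd T X ∧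
      Function.Injective u.hom := by
  have := S.additive
  have : Module.Finite k N := hN
  let b := Module.finBasis k N
  let X : C := ⨁ fun _ : Fin (Module.finrank k N) => T
  refine ⟨X, ∑ j, S.ofDual (b.coord j) ≫
    (homFunctor T).map (S.equiv.functor.map (biproduct.ι (fun _ => T) j)), isAdd_biproduct _, ?_⟩
  set u := ∑ j, S.ofDual (b.coord j) ≫
    (homFunctor T).map (S.equiv.functor.map (biproduct.ι (fun _ => T) j)) with hu
  rw [← LinearMap.ker_eq_bot, eq_bot_iff]
  intro x hx
  rw [LinearMap.mem_ker] at hx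
  refine (Submodule.mem_bot _).2 (b.ext_elem fun i => ?_)
  have h1 : u ≫ (homFunctor T).map (S.equiv.functor.map (biproduct.π (fun _ => T) i)) =
      S.ofDual (b.coord i) := by
    rw [hu, Preadditive.sum_comp, Finset.sum_eq_single i]
    · rw [Category.assoc, ← Functor.map_comp, ← Functor.map_comp, biproduct.ι_π_self,
        CategoryTheory.Functor.map_id, CategoryTheory.Functor.map_id, Category.comp_id]
    · intro j _ hj
      rw [Category.assoc, ← Functor.map_comp, ← Functor.map_comp, biproduct.ι_π_ne _ hj,
        Functor.map_zero, Functor.map_zero, comp_zero]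
    · simp
  have h2 := S.evLin_ofDual (b.coord i) x
  rw [← h1, ModuleCat.hom_comp, LinearMap.comp_apply, hx, map_zero, map_zero] at h2
  rw [map_zero, Finsupp.zero_apply]
  exact h2.symm

variable [IsIdempotentComplete C]

/-- Finite dimensional modules have injective envelopes of the form `𝒯(T, S X)`, `X ∈ add T`. -/
lemma exists_injectiveEnvelope (hfin : ∀ X Y : C, Module.Finite k (X ⟶ Y))
    {N : ModuleCat.{v} (End T)ᵐᵒᵖ} (hN : IsFinDim k N) :
    ∃ (X : C) (u : N ⟶ (homFunctor T).obj (S.equiv.functor.obj X)), IsAdd T X ∧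
      Function.Injective u.hom ∧ IsEssential (LinearMap.range u.hom) := by
  classical
  let P : ℕ → Prop := fun m => ∃ (X : C) (u : N ⟶ (homFunctor T).obj (S.equiv.functor.obj X)),
    IsAdd T X ∧ Function.Injective u.hom ∧
      dimk k ((homFunctor T).obj (S.equiv.functor.obj X)) = m
  have hP : ∃ m, P m := by
    obtain ⟨X, p, h₁, h₂⟩ := exists_mono (T := T) S hN
    exact ⟨_, X, p, h₁, h₂, rfl⟩
  obtain ⟨X, u, hX, hu, hd⟩ := Nat.find_spec hP
  have := hX.serre_injective S
  refine ⟨X, u, hX, hu, isEssential_range_of_forall hu fun q hq => ?_⟩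
  obtain ⟨φ', rfl⟩ := hX.serre_exists_map_eq S q
  obtain ⟨φ, rfl⟩ := S.equiv.functor.map_surjective φ'
  obtain ⟨e, he⟩ := exists_isFitting k hfin φ
  have heu : u ≫ (homFunctor T).map (S.equiv.functor.map e) = u :=
    ((he.functor_map S.equiv.functor).functor_map (homFunctor T)).comp_of_comp_eq u hq
  obtain ⟨Y, i, r, hir, hri⟩ := IsIdempotentComplete.idempotents_split X e he.idem
  have hY : IsAdd T Y := hX.of_retract i r hir
  have hs : Function.Injective (u ≫ (homFunctor T).map (S.equiv.functor.map r)).hom := by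
    have h : Function.Injective ((u ≫ (homFunctor T).map (S.equiv.functor.map r)) ≫
        (homFunctor T).map (S.equiv.functor.map i)).hom := by
      rw [Category.assoc, ← Functor.map_comp, ← Functor.map_comp, hri, heu]; exact hu
    exact injective_of_comp h
  have hle : dimk k ((homFunctor T).obj (S.equiv.functor.obj X)) ≤
      dimk k ((homFunctor T).obj (S.equiv.functor.obj Y)) := by
    rw [hd]; exact Nat.find_min' hP ⟨Y, _, hY, hs, rfl⟩
  have hsurj : Function.Surjective ((homFunctor T).map (S.equiv.functor.map r)).hom := by
    rw [← ModuleCat.epi_iff_surjective]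
    have : IsSplitEpi r := ⟨⟨i, hir⟩⟩
    infer_instance
  have hr := (bijective_of_surjective_of_dimk_le _ hsurj (isFinDim_hom k hfin _) hle).1
  have hi : Function.Injective ((homFunctor T).map (S.equiv.functor.map i)).hom := by
    rw [← ModuleCat.mono_iff_injective]
    have : IsSplitMono i := ⟨⟨r, hir⟩⟩
    infer_instance
  obtain ⟨x, hx, -⟩ := he.exists_fac
  have h : Function.Injective ((homFunctor T).map (S.equiv.functor.map φ) ≫
      (homFunctor T).map (S.equiv.functor.map x)).hom := by
    rw [← Functor.map_comp, ← Functor.map_comp, hx, ← hri, Functor.map_comp, Functor.map_comp]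
    exact hi.comp hr
  exact injective_of_comp h

lemma exists_minInjCopresentation (hfin : ∀ X Y : C, Module.Finite k (X ⟶ Y))
    {N : ModuleCat.{v} (End T)ᵐᵒᵖ} (hN : IsFinDim k N) :
    ∃ (T₁ T₀ : C) (g : S.equiv.functor.obj T₁ ⟶ S.equiv.functor.obj T₀)
      (u : N ⟶ (homFunctor T).obj (S.equiv.functor.obj T₁)), IsAdd T T₁ ∧ IsAdd T T₀ ∧
      IsMinInjCopresentation u ((homFunctor T).map g) := by
  obtain ⟨T₁, u, h₁, hu, he⟩ := exists_injectiveEnvelope S hfin hN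
  have hQ : IsFinDim k (cokObj u) :=
    isFinDim_of_surjective _ (cokπ_surjective u) (isFinDim_hom k hfin _)
  obtain ⟨T₀, v, h₀, hv, he'⟩ := exists_injectiveEnvelope S hfin hQ
  obtain ⟨g, hg⟩ := h₀.serre_exists_map_eq S (cokπ u ≫ v)
  refine ⟨T₁, T₀, g, u, h₁, h₀, h₁.serre_injective S, h₀.serre_injective S,
    LinearMap.ker_eq_bot.2 hu, ?_, he, ?_⟩
  · rw [hg, ker_comp_of_injective _ _ hv, ker_cokπ]
  · rwa [hg, range_comp_of_surjective _ _ (cokπ_surjective u)]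

end Serre

/-! ### Dimension shifting -/

section Ext

variable {A : Type v} [Ring A]

/-- `Ext^j(X, Y) = 0`. -/
abbrev ExtZero (X Y : ModuleCat.{v} A) (j : ℕ) : Prop := Subsingleton (Abelian.Ext X Y j)

/-- `0 ⟶ L ⟶ M ⟶ N ⟶ 0` is exact. -/
structure SES {L M N : ModuleCat.{v} A} (f : L ⟶ M) (g : M ⟶ N) : Prop where
  inj : Function.Injective f.hom
  exact : LinearMap.range f.hom = LinearMap.ker g.hom
  surj : Function.Surjective g.hom

lemma comp_eq_zero_of_range_eq_ker {L M N : ModuleCat.{v} A} {f : L ⟶ M} {g : M ⟶ N}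
    (h : LinearMap.range f.hom = LinearMap.ker g.hom) : f ≫ g = 0 := by
  ext x
  have : f.hom x ∈ LinearMap.ker g.hom := by rw [← h]; exact ⟨x, rfl⟩
  exact this

namespace SES

variable {L M N : ModuleCat.{v} A} {f : L ⟶ M} {g : M ⟶ N} (h : SES f g)

lemma shortExact (h : SES f g) :
    (ShortComplex.mk f g (comp_eq_zero_of_range_eq_ker h.exact)).ShortExact :=
  ShortComplex.ShortExact.mk' ((ShortComplex.moduleCat_exact_iff_range_eq_ker _).2 h.exact)
    ((ModuleCat.mono_iff_injective f).2 h.inj) ((ModuleCat.epi_iff_surjective g).2 h.surj)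

open Abelian

lemma extZero_of_succ (h : SES f g) {W : ModuleCat.{v} A} {j : ℕ} (h₁ : ExtZero W M j)
    (h₂ : ExtZero W L (j + 1)) : ExtZero W N j := by
  refine subsingleton_of_forall_eq 0 fun x => ?_
  obtain ⟨y, rfl⟩ := Ext.covariant_sequence_exact₃ W h.shortExact x rfl (Subsingleton.elim _ _)
  rw [Subsingleton.elim y 0, Ext.zero_comp]

lemma extZero_succ (h : SES f g) {W : ModuleCat.{v} A} {j : ℕ} (h₁ : ExtZero W M (j + 1))
    (h₂ : ExtZero W N j) : ExtZero W L (j + 1) := by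
  refine subsingleton_of_forall_eq 0 fun x => ?_
  obtain ⟨y, rfl⟩ := Ext.covariant_sequence_exact₁ W h.shortExact x (Subsingleton.elim _ _)
    (rfl : j + 1 = j + 1)
  rw [Subsingleton.elim y 0, Ext.zero_comp]

lemma extZero_one (h : SES f g) {W : ModuleCat.{v} A} (h₁ : ExtZero W M 1)
    (h₂ : ∀ φ : W ⟶ N, ∃ ψ, ψ ≫ g = φ) : ExtZero W L 1 := by
  refine subsingleton_of_forall_eq 0 fun x => ?_
  obtain ⟨y, rfl⟩ := Ext.covariant_sequence_exact₁ W h.shortExact x (Subsingleton.elim _ _)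
    (zero_add 1)
  obtain ⟨φ, rfl⟩ := (Ext.mk₀_bijective _ _).2 y
  obtain ⟨ψ, rfl⟩ := h₂ φ
  rw [← Ext.mk₀_comp_mk₀, Ext.comp_assoc (a₂₃ := 1) _ _ _ (by lia) (by lia) (by lia)]
  have := h.shortExact.comp_extClass
  exact (congrArg (fun z => (Ext.mk₀ ψ).comp z (zero_add 1)) this).trans (Ext.comp_zero _ _ _ _ _)

lemma exists_lift (h : SES f g) {W : ModuleCat.{v} A} (h₁ : ExtZero W L 1) (φ : W ⟶ N) :
    ∃ ψ, ψ ≫ g = φ := by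
  obtain ⟨y, hy⟩ := Ext.covariant_sequence_exact₃ W h.shortExact (Ext.mk₀ φ) (zero_add 1)
    (Subsingleton.elim _ _)
  obtain ⟨ψ, rfl⟩ := (Ext.mk₀_bijective _ _).2 y
  rw [Ext.mk₀_comp_mk₀] at hy
  exact ⟨ψ, (Ext.mk₀_bijective _ _).1 hy⟩

lemma extZero_of_succ' (h : SES f g) {W : ModuleCat.{v} A} {j : ℕ} (h₁ : ExtZero M W j)
    (h₂ : ExtZero N W (j + 1)) : ExtZero L W j := by
  refine subsingleton_of_forall_eq 0 fun x => ?_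
  have h₂' : ExtZero N W (1 + j) := by rwa [add_comm]
  obtain ⟨y, rfl⟩ := Ext.contravariant_sequence_exact₁ h.shortExact W x rfl (Subsingleton.elim _ _)
  rw [Subsingleton.elim y 0, Ext.comp_zero]

lemma extZero_succ' (h : SES f g) {W : ModuleCat.{v} A} {j : ℕ} (h₁ : ExtZero M W (j + 1))
    (h₂ : ExtZero L W j) : ExtZero N W (j + 1) := by
  refine subsingleton_of_forall_eq 0 fun x => ?_
  obtain ⟨y, rfl⟩ := Ext.contravariant_sequence_exact₃ h.shortExact W x (Subsingleton.elim _ _)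
    (add_comm 1 j)
  rw [Subsingleton.elim y 0, Ext.comp_zero]

lemma extZero_one' (h : SES f g) {W : ModuleCat.{v} A} (h₁ : ExtZero M W 1)
    (h₂ : ∀ φ : L ⟶ W, ∃ ψ, f ≫ ψ = φ) : ExtZero N W 1 := by
  refine subsingleton_of_forall_eq 0 fun x => ?_
  obtain ⟨y, rfl⟩ := Ext.contravariant_sequence_exact₃ h.shortExact W x (Subsingleton.elim _ _)
    (add_zero 1)
  obtain ⟨φ, rfl⟩ := (Ext.mk₀_bijective _ _).2 y
  obtain ⟨ψ, rfl⟩ := h₂ φ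
  rw [← Ext.mk₀_comp_mk₀, ← Ext.comp_assoc (a₁₂ := 1) _ _ _ (by lia) (by lia) (by lia)]
  have := h.shortExact.extClass_comp
  exact (congrArg (fun z => z.comp (Ext.mk₀ ψ) (add_zero 1)) this).trans
    (Ext.zero_comp _ _ _ _ _)

lemma exists_extension (h : SES f g) {W : ModuleCat.{v} A} (h₁ : ExtZero N W 1) (φ : L ⟶ W) :
    ∃ ψ, f ≫ ψ = φ := by
  obtain ⟨y, hy⟩ := Ext.contravariant_sequence_exact₁ h.shortExact W (Ext.mk₀ φ) (add_zero 1)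
    (Subsingleton.elim _ _)
  obtain ⟨ψ, rfl⟩ := (Ext.mk₀_bijective _ _).2 y
  rw [Ext.mk₀_comp_mk₀] at hy
  exact ⟨ψ, (Ext.mk₀_bijective _ _).1 hy⟩

end SES

lemma ExtZero.of_retract_left {X X' W : ModuleCat.{v} A} {j : ℕ} (h : ExtZero X W j)
    (i : X' ⟶ X) (r : X ⟶ X') (hir : i ≫ r = 𝟙 X') : ExtZero X' W j := by
  refine subsingleton_of_forall_eq 0 fun x => ?_
  rw [← Abelian.Ext.mk₀_id_comp x, ← hir, ← Abelian.Ext.mk₀_comp_mk₀_assoc,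
    Subsingleton.elim ((Abelian.Ext.mk₀ r).comp x (zero_add j)) 0, Abelian.Ext.comp_zero]

lemma ExtZero.of_retract_right {X X' W : ModuleCat.{v} A} {j : ℕ} (h : ExtZero W X j)
    (i : X' ⟶ X) (r : X ⟶ X') (hir : i ≫ r = 𝟙 X') : ExtZero W X' j := by
  refine subsingleton_of_forall_eq 0 fun x => ?_
  rw [← Abelian.Ext.comp_mk₀_id x, ← hir, ← Abelian.Ext.mk₀_comp_mk₀,
    ← Abelian.Ext.comp_assoc (a₁₂ := j) _ _ _ (by lia) (by lia) (by lia),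
    Subsingleton.elim (x.comp (Abelian.Ext.mk₀ i) (add_zero j)) 0, Abelian.Ext.zero_comp]

lemma ExtZero.of_sum_left {X X₁ X₂ W : ModuleCat.{v} A} {j : ℕ} (h₁ : ExtZero X₁ W j)
    (h₂ : ExtZero X₂ W j) (p₁ : X ⟶ X₁) (i₁ : X₁ ⟶ X) (p₂ : X ⟶ X₂) (i₂ : X₂ ⟶ X)
    (h : p₁ ≫ i₁ + p₂ ≫ i₂ = 𝟙 X) : ExtZero X W j := by
  refine subsingleton_of_forall_eq 0 fun x => ?_
  rw [← Abelian.Ext.mk₀_id_comp x, ← h, Abelian.Ext.mk₀_add, Abelian.Ext.add_comp,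
    ← Abelian.Ext.mk₀_comp_mk₀_assoc, ← Abelian.Ext.mk₀_comp_mk₀_assoc,
    Subsingleton.elim ((Abelian.Ext.mk₀ i₁).comp x (zero_add j)) 0,
    Subsingleton.elim ((Abelian.Ext.mk₀ i₂).comp x (zero_add j)) 0, Abelian.Ext.comp_zero,
    Abelian.Ext.comp_zero, add_zero]

lemma extZero_of_projective (P W : ModuleCat.{v} A) [Projective P] {j : ℕ} (hj : 1 ≤ j) :
    ExtZero P W j := by
  obtain ⟨j, rfl⟩ := Nat.exists_eq_add_of_le' hj
  exact Abelian.Ext.subsingleton_of_projective P W j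

/-- The image of a morphism of modules. -/
def imObj {M N : ModuleCat.{v} A} (f : M ⟶ N) : ModuleCat.{v} A :=
  ModuleCat.of A (LinearMap.range f.hom)

/-- The inclusion of the image. -/
def imι {M N : ModuleCat.{v} A} (f : M ⟶ N) : imObj f ⟶ N :=
  ModuleCat.ofHom (LinearMap.range f.hom).subtype

/-- The projection to the image. -/
def imπ {M N : ModuleCat.{v} A} (f : M ⟶ N) : M ⟶ imObj f :=
  ModuleCat.ofHom f.hom.rangeRestrict

section Image

variable {M N : ModuleCat.{v} A} (f : M ⟶ N)

lemma imπ_imι : imπ f ≫ imι f = f := rfl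

lemma imι_injective : Function.Injective (imι f).hom := Submodule.subtype_injective _

lemma imπ_surjective : Function.Surjective (imπ f).hom := LinearMap.surjective_rangeRestrict _

lemma range_imι : LinearMap.range (imι f).hom = LinearMap.range f.hom := Submodule.range_subtype _

lemma ker_imπ : LinearMap.ker (imπ f).hom = LinearMap.ker f.hom := LinearMap.ker_rangeRestrict _

lemma ses_im {L : ModuleCat.{v} A} {e : L ⟶ M} {f : M ⟶ N}
    (h : LinearMap.range e.hom = LinearMap.ker f.hom) : SES (imι e) (imπ f) where
  inj := imι_injective e
  exact := by rw [range_imι, ker_imπ, h]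
  surj := imπ_surjective f

end Image

lemma isIso_of_bijective {M N : ModuleCat.{v} A} {f : M ⟶ N} (h₁ : Function.Injective f.hom)
    (h₂ : Function.Surjective f.hom) : IsIso f :=
  have := (ModuleCat.mono_iff_injective f).2 h₁
  have := (ModuleCat.epi_iff_surjective f).2 h₂
  isIso_of_mono_of_epi f

lemma isIso_imι {M N : ModuleCat.{v} A} {f : M ⟶ N} (h : Function.Surjective f.hom) :
    IsIso (imι f) :=
  isIso_of_bijective (imι_injective f) (surjective_of_comp (f := imπ f) h)

lemma isIso_imπ {M N : ModuleCat.{v} A} {f : M ⟶ N} (h : Function.Injective f.hom) :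
    IsIso (imπ f) :=
  isIso_of_bijective (injective_of_comp (g := imι f) h) (imπ_surjective f)

/-- A morphism that vanishes on the kernel of a surjection factors. -/
lemma exists_desc_of_ker_le {M N W : ModuleCat.{v} A} (f : M ⟶ N) (hf : Function.Surjective f.hom)
    (g : M ⟶ W) (h : LinearMap.ker f.hom ≤ LinearMap.ker g.hom) : ∃ g', f ≫ g' = g := by
  refine ⟨ModuleCat.ofHom
    ((LinearMap.ker f.hom).liftQ g.hom h ∘ₗ (f.hom.quotKerEquivOfSurjective hf).symm), ?_⟩
  ext x
  have hx : (f.hom.quotKerEquivOfSurjective hf).symm (f.hom x) =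
      (LinearMap.ker f.hom).mkQ x := by
    rw [LinearEquiv.symm_apply_eq]; rfl
  change (LinearMap.ker f.hom).liftQ g.hom h ((f.hom.quotKerEquivOfSurjective hf).symm (f.hom x)) =
    g.hom x
  rw [hx]
  rfl

/-- A morphism into the image of an injection factors. -/
lemma exists_lift_of_range_le {M N W : ModuleCat.{v} A} (f : M ⟶ N)
    (hf : Function.Injective f.hom) (g : W ⟶ N)
    (h : LinearMap.range g.hom ≤ LinearMap.range f.hom) : ∃ g', g' ≫ f = g := by
  refine ⟨ModuleCat.ofHom ((LinearEquiv.ofInjective f.hom hf).symm.toLinearMap ∘ₗ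
    LinearMap.codRestrict _ g.hom fun x => h ⟨x, rfl⟩), ?_⟩
  ext x
  have := LinearEquiv.apply_symm_apply (LinearEquiv.ofInjective f.hom hf)
    (⟨g.hom x, h ⟨x, rfl⟩⟩ : LinearMap.range f.hom)
  exact congrArg Subtype.val this

lemma range_le_ker_of_comp_eq_zero {L M W : ModuleCat.{v} A} {e : L ⟶ M} {g : M ⟶ W}
    (h : e ≫ g = 0) : LinearMap.range e.hom ≤ LinearMap.ker g.hom := by
  rintro _ ⟨x, rfl⟩
  exact congrArg (fun φ => φ.hom x) h

section ChainExact

variable {d : ℕ} (Q : Chain d (ModuleCat.{v} A))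

/-- Exactness at the inner terms of a sequence. -/
def InnerExact : Prop := ∀ i : Fin d,
  LinearMap.range (Q.map i.succ : Q.obj i.succ.succ ⟶ Q.obj i.succ.castSucc).hom =
    LinearMap.ker (Q.map i.castSucc : Q.obj i.succ.castSucc ⟶ Q.obj i.castSucc.castSucc).hom

variable {Q} (hQ : InnerExact Q)

lemma InnerExact.ses (hQ : InnerExact Q) (i : Fin d) :
    SES (M := Q.obj i.succ.castSucc) (imι (Q.map i.succ)) (imπ (Q.map i.castSucc)) := ses_im (hQ i)

variable {W : ModuleCat.{v} A}

lemma InnerExact.extZero_im (hQ : InnerExact Q) (hs : Function.Surjective Q.final.hom)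
    (hW : ∀ i : Fin (d + 1), ∀ j, 1 ≤ j → j < d → ExtZero (Q.obj i.castSucc) W j)
    (i : Fin (d + 1)) (j : ℕ) (hj : 1 ≤ j) (hij : j + i.val < d) :
    ExtZero (imObj (Q.map i)) W j := by
  induction i using Fin.induction generalizing j with
  | zero =>
    have := isIso_imι hs
    exact (hW 0 j hj (by simpa using hij)).of_retract_left (imι (Q.map 0)) (inv (imι Q.final))
      (IsIso.hom_inv_id (imι Q.final))
  | succ i ih =>
    simp only [Fin.val_succ] at hij
    exact (hQ.ses i).extZero_of_succ' (hW i.succ j hj (by omega))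
      (ih (j + 1) (by omega) (by simp only [Fin.val_castSucc]; omega))

/-- Exactness of `Hom(-, W)` on an exact sequence, when the relevant extensions vanish. -/
lemma InnerExact.exists_desc (hQ : InnerExact Q) (hs : Function.Surjective Q.final.hom)
    (hW : ∀ i : Fin (d + 1), ∀ j, 1 ≤ j → j < d → ExtZero (Q.obj i.castSucc) W j)
    (i : Fin d) (g : Q.obj i.succ.castSucc ⟶ W)
    (hg : (Q.map i.succ : Q.obj i.succ.succ ⟶ Q.obj i.succ.castSucc) ≫ g = 0) :
    ∃ h : Q.obj i.castSucc.castSucc ⟶ W,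
      (Q.map i.castSucc : Q.obj i.succ.castSucc ⟶ Q.obj i.castSucc.castSucc) ≫ h = g := by
  obtain ⟨g', hg'⟩ := exists_desc_of_ker_le (M := Q.obj i.succ.castSucc) (imπ (Q.map i.castSucc))
    (imπ_surjective _) g (by
      rw [ker_imπ]; exact (hQ i).symm.le.trans (range_le_ker_of_comp_eq_zero hg))
  have key : ∀ m : Fin (d + 1), m.val < d → ∀ g' : imObj (Q.map m) ⟶ W,
      ∃ h, imι (Q.map m) ≫ h = g' := by
    intro m
    induction m using Fin.cases with
    | zero =>
      intro _ g'
      have := isIso_imι hs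
      exact ⟨inv (imι Q.final) ≫ g', IsIso.hom_inv_id_assoc (imι Q.final) g'⟩
    | succ m =>
      intro hm g'
      simp only [Fin.val_succ] at hm
      exact (hQ.ses m).exists_extension
        (hQ.extZero_im hs hW m.castSucc 1 le_rfl (by simp only [Fin.val_castSucc]; omega)) g'
  obtain ⟨h, hh⟩ := key i.castSucc i.isLt g'
  refine ⟨h, ?_⟩
  rw [← hg', ← hh, ← Category.assoc]
  rfl

lemma InnerExact.extZero_im' (hQ : InnerExact Q) (hs : Function.Injective Q.first.hom)
    (hW : ∀ i : Fin (d + 1), ∀ j, 1 ≤ j → j < d → ExtZero W (Q.obj i.succ) j)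
    (i : Fin (d + 1)) (j : ℕ) (hj : 1 ≤ j) (hij : j < i.val) :
    ExtZero W (imObj (Q.map i)) j := by
  induction i using Fin.reverseInduction generalizing j with
  | last =>
    have := isIso_imπ hs
    exact (hW (Fin.last d) j hj (by simpa using hij)).of_retract_right
      (inv (imπ Q.first)) (imπ Q.first) (IsIso.inv_hom_id (imπ Q.first))
  | cast i ih =>
    simp only [Fin.val_castSucc] at hij
    exact (hQ.ses i).extZero_of_succ (hW i.castSucc j hj (by omega))
      (ih (j + 1) (by omega) (by simp only [Fin.val_succ]; omega))

/-- Exactness of `Hom(W, -)` on an exact sequence, when the relevant extensions vanish. -/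
lemma InnerExact.exists_lift (hQ : InnerExact Q) (hs : Function.Injective Q.first.hom)
    (hW : ∀ i : Fin (d + 1), ∀ j, 1 ≤ j → j < d → ExtZero W (Q.obj i.succ) j)
    (i : Fin d) (g : W ⟶ Q.obj i.succ.castSucc)
    (hg : g ≫ (Q.map i.castSucc : Q.obj i.succ.castSucc ⟶ Q.obj i.castSucc.castSucc) = 0) :
    ∃ h : W ⟶ Q.obj i.succ.succ,
      h ≫ (Q.map i.succ : Q.obj i.succ.succ ⟶ Q.obj i.succ.castSucc) = g := by
  obtain ⟨g', hg'⟩ := exists_lift_of_range_le (N := Q.obj i.succ.castSucc) (imι (Q.map i.succ))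
    (imι_injective _) g (by
      rw [range_imι]; exact (range_le_ker_of_comp_eq_zero hg).trans (hQ i).symm.le)
  have key : ∀ m : Fin (d + 1), 1 ≤ m.val → ∀ g' : W ⟶ imObj (Q.map m),
      ∃ h, h ≫ imπ (Q.map m) = g' := by
    intro m
    induction m using Fin.lastCases with
    | last =>
      intro _ g'
      have := isIso_imπ hs
      exact ⟨g' ≫ inv (imπ Q.first), by
        rw [Category.assoc]
        exact (congrArg (g' ≫ ·) (IsIso.inv_hom_id (imπ Q.first))).trans (Category.comp_id _)⟩
    | cast m =>
      intro hm g'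
      simp only [Fin.val_castSucc] at hm
      exact (hQ.ses m).exists_lift
        (hQ.extZero_im' hs hW m.succ 1 le_rfl (by simp only [Fin.val_succ]; omega)) g'
  obtain ⟨h, hh⟩ := key i.succ (by simp) g'
  refine ⟨h, ?_⟩
  rw [← hg', ← hh, Category.assoc]
  rfl

end ChainExact

/-- `M` has an `𝒳`-coresolution of length `n`. -/
def CoRes (𝒳 : ObjectProperty (ModuleCat.{v} A)) : ℕ → ModuleCat.{v} A → Prop
  | 0, M => 𝒳 M
  | n + 1, M => ∃ (E M' : ModuleCat.{v} A) (f : M ⟶ E) (g : E ⟶ M'), 𝒳 E ∧ SES f g ∧ CoRes 𝒳 n M'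

/-- `M` has an `𝒳`-resolution of length `n`. -/
def Res (𝒳 : ObjectProperty (ModuleCat.{v} A)) : ℕ → ModuleCat.{v} A → Prop
  | 0, M => 𝒳 M
  | n + 1, M => ∃ (E M' : ModuleCat.{v} A) (f : M' ⟶ E) (g : E ⟶ M), 𝒳 E ∧ SES f g ∧ Res 𝒳 n M'

variable {𝒳 : ObjectProperty (ModuleCat.{v} A)} {d : ℕ}

lemma CoRes.mem (hrigid : ∀ X Y, 𝒳 X → 𝒳 Y → ∀ j, 1 ≤ j → j < d → ExtZero X Y j)
    (hret : ∀ (M X : ModuleCat.{v} A) (i : M ⟶ X) (r : X ⟶ M), i ≫ r = 𝟙 M → 𝒳 X → 𝒳 M)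
    {n : ℕ} {M : ModuleCat.{v} A} (hn : n < d) (h : CoRes 𝒳 n M)
    (hM : ∀ X, 𝒳 X → ∀ j, 1 ≤ j → j ≤ n → ExtZero X M j) : 𝒳 M := by
  induction n generalizing M with
  | zero => exact h
  | succ n ih =>
    obtain ⟨E, M', f, g, hE, hs, h'⟩ := h
    have hM' : 𝒳 M' := ih (by omega) h' fun X hX j h₁ h₂ =>
      hs.extZero_of_succ (hrigid X E hX hE j h₁ (by omega)) (hM X hX (j + 1) (by omega) (by omega))
    obtain ⟨r, hr⟩ := hs.exists_extension (hM M' hM' 1 le_rfl (by omega)) (𝟙 M)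
    exact hret M E f r hr hE

lemma Res.mem (hrigid : ∀ X Y, 𝒳 X → 𝒳 Y → ∀ j, 1 ≤ j → j < d → ExtZero X Y j)
    (hret : ∀ (M X : ModuleCat.{v} A) (i : M ⟶ X) (r : X ⟶ M), i ≫ r = 𝟙 M → 𝒳 X → 𝒳 M)
    {n : ℕ} {M : ModuleCat.{v} A} (hn : n < d) (h : Res 𝒳 n M)
    (hM : ∀ X, 𝒳 X → ∀ j, 1 ≤ j → j ≤ n → ExtZero M X j) : 𝒳 M := by
  induction n generalizing M with
  | zero => exact h
  | succ n ih =>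
    obtain ⟨E, M', f, g, hE, hs, h'⟩ := h
    have hM' : 𝒳 M' := ih (by omega) h' fun X hX j h₁ h₂ =>
      hs.extZero_of_succ' (hrigid E X hE hX j h₁ (by omega)) (hM X hX (j + 1) (by omega) (by omega))
    obtain ⟨r, hr⟩ := hs.exists_lift (hM M' hM' 1 le_rfl (by omega)) (𝟙 M)
    exact hret M E r g hr hE

end Ext

section Exactness

variable {A : Type v} [Ring A]

lemma exact_of_comm_left {P₁ P₀ Q₁ Q₀ M : ModuleCat.{v} A} {f : P₁ ⟶ P₀} {g : Q₁ ⟶ Q₀}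
    {p : P₀ ⟶ M} (a : Q₁ ≅ P₁) (b : Q₀ ≅ P₀) (h : g ≫ b.hom = a.hom ≫ f)
    (hp : LinearMap.range f.hom = LinearMap.ker p.hom) :
    LinearMap.range g.hom = LinearMap.ker (b.hom ≫ p).hom := by
  have h' : g = a.hom ≫ f ≫ b.inv := by rw [← Category.assoc, ← h]; simp
  apply le_antisymm
  · apply range_le_ker_of_comp_eq_zero
    rw [← Category.assoc, h, Category.assoc, comp_eq_zero_of_range_eq_ker hp, comp_zero]
  · intro x hx
    have hx' : b.hom.hom x ∈ LinearMap.ker p.hom := hx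
    rw [← hp] at hx'
    obtain ⟨y, hy⟩ := hx'
    refine ⟨a.inv.hom y, ?_⟩
    have : a.inv ≫ g = f ≫ b.inv := by rw [h']; simp
    refine (congrArg (fun φ => φ.hom y) this).trans ?_
    refine (congrArg b.inv.hom hy).trans ?_
    exact congrArg (fun φ => φ.hom x) b.hom_inv_id

lemma exact_of_comm_right {I₁ I₀ J₁ J₀ N : ModuleCat.{v} A} {f : I₁ ⟶ I₀} {g : J₁ ⟶ J₀}
    {u : N ⟶ I₁} (a : J₁ ≅ I₁) (b : J₀ ≅ I₀) (h : g ≫ b.hom = a.hom ≫ f)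
    (hu : LinearMap.range u.hom = LinearMap.ker f.hom) :
    LinearMap.range (u ≫ a.inv).hom = LinearMap.ker g.hom := by
  have h' : g = a.hom ≫ f ≫ b.inv := by rw [← Category.assoc, ← h]; simp
  apply le_antisymm
  · apply range_le_ker_of_comp_eq_zero
    rw [h', Category.assoc, Iso.inv_hom_id_assoc, ← Category.assoc,
      comp_eq_zero_of_range_eq_ker hu, zero_comp]
  · intro x hx
    have hx' : a.hom.hom x ∈ LinearMap.ker f.hom := by
      have h2 := congrArg (fun φ => φ.hom x) h
      rw [LinearMap.mem_ker] at hx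
      refine LinearMap.mem_ker.2 (Eq.trans h2.symm ?_)
      exact (congrArg b.hom.hom hx).trans (map_zero _)
    rw [← hu] at hx'
    obtain ⟨y, hy⟩ := hx'
    refine ⟨y, ?_⟩
    refine (congrArg a.inv.hom hy).trans ?_
    exact congrArg (fun φ => φ.hom x) a.hom_inv_id

lemma exists_iso_of_ker_eq {M N N' : ModuleCat.{v} A} {f : M ⟶ N} {g : M ⟶ N'}
    (hf : Function.Surjective f.hom) (hg : Function.Surjective g.hom)
    (h : LinearMap.ker f.hom = LinearMap.ker g.hom) : ∃ e : N ≅ N', f ≫ e.hom = g := by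
  obtain ⟨a, ha⟩ := exists_desc_of_ker_le f hf g h.le
  obtain ⟨b, hb⟩ := exists_desc_of_ker_le g hg f h.symm.le
  have := (ModuleCat.epi_iff_surjective f).2 hf
  have := (ModuleCat.epi_iff_surjective g).2 hg
  exact ⟨⟨a, b, by rw [← cancel_epi f, ← Category.assoc, ha, hb, Category.comp_id],
    by rw [← cancel_epi g, ← Category.assoc, hb, ha, Category.comp_id]⟩, ha⟩

lemma exists_iso_of_range_eq {M N N' : ModuleCat.{v} A} {f : N ⟶ M} {g : N' ⟶ M}
    (hf : Function.Injective f.hom) (hg : Function.Injective g.hom)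
    (h : LinearMap.range f.hom = LinearMap.range g.hom) : ∃ e : N ≅ N', e.hom ≫ g = f := by
  obtain ⟨a, ha⟩ := exists_lift_of_range_le g hg f h.le
  obtain ⟨b, hb⟩ := exists_lift_of_range_le f hf g h.symm.le
  have := (ModuleCat.mono_iff_injective f).2 hf
  have := (ModuleCat.mono_iff_injective g).2 hg
  exact ⟨⟨a, b, by rw [← cancel_mono f, Category.assoc, hb, ha, Category.id_comp],
    by rw [← cancel_mono g, Category.assoc, ha, hb, Category.id_comp]⟩, ha⟩

lemma isZero_imObj {M N : ModuleCat.{v} A} {f : M ⟶ N} (h : f = 0) : IsZero (imObj f) := by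
  rw [IsZero.iff_id_eq_zero]
  have := (ModuleCat.epi_iff_surjective (imπ f)).2 (imπ_surjective f)
  have := (ModuleCat.mono_iff_injective (imι f)).2 (imι_injective f)
  rw [← cancel_epi (imπ f), ← cancel_mono (imι f)]
  simp [imπ_imι, h]

end Exactness

/-- The image of a sequence under a functor. -/
def Chain.mapChain {d : ℕ} {C : Type*} [Category C] {D : Type*} [Category D] (F : C ⥤ D)
    (P : Chain d C) : Chain d D where
  obj i := F.obj (P.obj i)
  map i := F.map (P.map i)

section

variable {C : Type u} [Category.{v} C] [Preadditive C] {T : C}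

lemma range_eq_ker_of_lift {X Y Z : C} (f : X ⟶ Y) (g : Y ⟶ Z) (hfg : f ≫ g = 0)
    (h : ∀ t : T ⟶ Y, t ≫ g = 0 → ∃ s, s ≫ f = t) :
    LinearMap.range ((homFunctor T).map f).hom = LinearMap.ker ((homFunctor T).map g).hom := by
  apply le_antisymm
  · exact range_le_ker_of_comp_eq_zero (by rw [← Functor.map_comp, hfg, Functor.map_zero])
  · intro x hx
    obtain ⟨s, hs⟩ := h (un x) hx
    exact ⟨el s, hs⟩

/-- Fullness on the cokernel of a morphism in `add T`. -/
lemma exists_map_eq_of_desc [HasFiniteBiproducts C] {P₂ P₁ X Y : C} {b : P₂ ⟶ P₁} {a : P₁ ⟶ X}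
    (h₂ : IsAdd T P₂) (h₁ : IsAdd T P₁) (hba : b ≫ a = 0)
    (ha : Function.Surjective ((homFunctor T).map a).hom)
    (hdesc : ∀ ψ : P₁ ⟶ Y, b ≫ ψ = 0 → ∃ f, a ≫ f = ψ)
    (θ : (homFunctor T).obj X ⟶ (homFunctor T).obj Y) : ∃ f, (homFunctor T).map f = θ := by
  obtain ⟨ψ, hψ⟩ := h₁.exists_map_eq ((homFunctor T).map a ≫ θ)
  obtain ⟨f, hf⟩ := hdesc ψ (h₂.map_injective (by
    rw [Functor.map_comp, hψ, ← Category.assoc, ← Functor.map_comp, hba, Functor.map_zero,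
      zero_comp, Functor.map_zero]))
  have := (ModuleCat.epi_iff_surjective _).2 ha
  refine ⟨f, ?_⟩
  rw [← cancel_epi ((homFunctor T).map a), ← hψ, ← hf, Functor.map_comp]

/-- Extension of morphisms from the image of a morphism. -/
lemma exists_imι_comp_eq [HasFiniteBiproducts C] {P₂ P₁ X Y : C} {b : P₂ ⟶ P₁} {a : P₁ ⟶ X}
    (h₂ : IsAdd T P₂) (h₁ : IsAdd T P₁) (hba : b ≫ a = 0)
    (hdesc : ∀ ψ : P₁ ⟶ Y, b ≫ ψ = 0 → ∃ f, a ≫ f = ψ)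
    (φ : imObj ((homFunctor T).map a) ⟶ (homFunctor T).obj Y) :
    ∃ θ : (homFunctor T).obj X ⟶ (homFunctor T).obj Y, imι ((homFunctor T).map a) ≫ θ = φ := by
  obtain ⟨ψ, hψ⟩ := h₁.exists_map_eq (imπ ((homFunctor T).map a) ≫ φ)
  have := (ModuleCat.epi_iff_surjective _).2 (imπ_surjective ((homFunctor T).map a))
  have := (ModuleCat.mono_iff_injective _).2 (imι_injective ((homFunctor T).map a))
  obtain ⟨f, hf⟩ := hdesc ψ (h₂.map_injective (by
    have h0 : (homFunctor T).map b ≫ imπ ((homFunctor T).map a) = 0 := by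
      rw [← cancel_mono (imι ((homFunctor T).map a)), Category.assoc, imπ_imι, zero_comp,
        ← Functor.map_comp, hba, Functor.map_zero]
    rw [Functor.map_comp, hψ, ← Category.assoc, h0, zero_comp, Functor.map_zero]))
  refine ⟨(homFunctor T).map f, ?_⟩
  rw [← cancel_epi (imπ ((homFunctor T).map a)), ← hψ, ← hf, Functor.map_comp, ← Category.assoc,
    imπ_imι]

variable [HasFiniteBiproducts C]

namespace Angulation

variable {n : ℕ} {𝒜 : Angulation (n + 1) C} {Z : SuspSeq (n + 1) 𝒜.susp.functor}

lemma innerExact (T : C) (hZ : 𝒜.IsAngle Z) :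
    InnerExact (Chain.mapChain (homFunctor T) Z.toChain) := fun i =>
  range_eq_ker_of_lift _ _ (comp_eq_zero hZ i) fun t ht => exists_lift hZ i t ht

lemma range_final (T : C) (hZ : 𝒜.IsAngle Z) :
    LinearMap.range ((homFunctor T).map Z.final).hom =
      LinearMap.ker ((homFunctor T).map Z.conn).hom :=
  range_eq_ker_of_lift _ _ (final_comp_conn hZ) fun t ht => exists_lift_final hZ t ht

lemma final_surjective (hZ : 𝒜.IsAngle Z) (h : (homFunctor T).map Z.conn = 0) :
    Function.Surjective ((homFunctor T).map Z.final).hom := by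
  rw [← LinearMap.range_eq_top, range_final T hZ, h]
  exact LinearMap.ker_zero

/-- Fullness on the last term of an angle as in condition (b). -/
lemma exists_map_eq_of_isAdd (hZ : 𝒜.IsAngle Z) (hT : ∀ i : Fin (n + 2), IsAdd T (Z.obj i.succ))
    (h : (homFunctor T).map Z.conn = 0) {Y : C}
    (θ : (homFunctor T).obj (Z.obj (0 : Fin (n + 2)).castSucc) ⟶ (homFunctor T).obj Y) :
    ∃ f, (homFunctor T).map f = θ := by
  exact exists_map_eq_of_desc (b := (Z.map (0 : Fin (n + 1)).succ :
      Z.obj (0 : Fin (n + 1)).succ.succ ⟶ Z.obj (0 : Fin (n + 1)).succ.castSucc))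
    (hT _) (hT 0) (comp_eq_zero hZ 0) (final_surjective hZ h) (exists_desc hZ 0) θ

lemma ses (T : C) (hZ : 𝒜.IsAngle Z) (i : Fin (n + 1)) :
    SES (M := (homFunctor T).obj (Z.obj i.succ.castSucc))
      (imι ((homFunctor T).map (Z.map i.succ : Z.obj i.succ.succ ⟶ Z.obj i.succ.castSucc)))
      (imπ ((homFunctor T).map
        (Z.map i.castSucc : Z.obj i.succ.castSucc ⟶ Z.obj i.castSucc.castSucc))) :=
  (innerExact T hZ).ses i

/-- Extensions into `𝒟` vanish on the last term of an angle as in condition (b). -/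
lemma extZero_im_of_isAdd (hZ : 𝒜.IsAngle Z) (hT : ∀ i : Fin (n + 2), IsAdd T (Z.obj i.succ))
    (Y : C) (j : ℕ) (i : Fin (n + 2)) (hj : 1 ≤ j) (hij : j + i.val ≤ n) :
    ExtZero (imObj ((homFunctor T).map (Z.map i))) ((homFunctor T).obj Y) j := by
  induction j, hj using Nat.le_induction generalizing i with
  | base =>
    obtain ⟨i, rfl⟩ : ∃ i' : Fin n, i = i'.castSucc.castSucc :=
      ⟨⟨i.val, by omega⟩, rfl⟩
    have hP : Projective ((homFunctor T).obj (Z.obj i.castSucc.succ.castSucc)) :=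
      (hT i.castSucc.castSucc).projective
    refine (ses T hZ i.castSucc).extZero_one' (extZero_of_projective _ _ le_rfl) ?_
    exact exists_imι_comp_eq (b := (Z.map i.succ.succ :
      Z.obj i.succ.succ.succ ⟶ Z.obj i.succ.succ.castSucc)) (hT _) (hT i.castSucc.succ)
      (comp_eq_zero hZ i.succ) (exists_desc hZ i.succ)
  | succ j hj ih =>
    obtain ⟨i, rfl⟩ : ∃ i' : Fin (n + 1), i = i'.castSucc := ⟨⟨i.val, by omega⟩, rfl⟩
    have hP : Projective ((homFunctor T).obj (Z.obj i.succ.castSucc)) :=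
      (hT i.castSucc).projective
    simp only [Fin.val_castSucc] at hij
    exact (ses T hZ i).extZero_succ' (extZero_of_projective _ _ (by omega))
      (ih i.succ (by simp only [Fin.val_succ]; omega))

lemma extZero_of_isAdd (hZ : 𝒜.IsAngle Z) (hT : ∀ i : Fin (n + 2), IsAdd T (Z.obj i.succ))
    (h : (homFunctor T).map Z.conn = 0) (Y : C) (j : ℕ) (hj : 1 ≤ j) (hjn : j ≤ n) :
    ExtZero ((homFunctor T).obj (Z.obj (0 : Fin (n + 2)).castSucc)) ((homFunctor T).obj Y) j := by
  have := isIso_imι (final_surjective hZ h)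
  exact (extZero_im_of_isAdd hZ hT Y j 0 hj (by simpa using hjn)).of_retract_left
    (inv (imι ((homFunctor T).map Z.final))) (imι ((homFunctor T).map Z.final))
    (IsIso.inv_hom_id _)

end Angulation

/-- Induction along decompositions into indecomposable objects. -/
lemma induction_indecomposable {k : Type w} [Field k] [Linear k C]
    (hfin : ∀ X Y : C, Module.Finite k (X ⟶ Y)) {P : C → Prop} (hzero : ∀ X, IsZero X → P X)
    (hsum : ∀ X Y Z, (X ≅ Y ⊞ Z) → P Y → P Z → P X) (hind : ∀ X, Indecomposable X → P X) (X : C) :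
    P X := by
  have hlt : ∀ (X Y Z : C), (X ≅ Y ⊞ Z) → ¬ IsZero Z →
      Module.finrank k (Y ⟶ Y) < Module.finrank k (X ⟶ X) := by
    intro X Y Z e hZ
    have := hfin
    let f : ((Y ⟶ Y) × (Z ⟶ Z)) →ₗ[k] (X ⟶ X) :=
      { toFun := fun a => e.hom ≫ (biprod.fst ≫ a.1 ≫ biprod.inl + biprod.snd ≫ a.2 ≫ biprod.inr) ≫
          e.inv
        map_add' := by intros; simp; abel
        map_smul' := by intros; simp }
    have hf : Function.Injective f := by
      rw [← LinearMap.ker_eq_bot, LinearMap.ker_eq_bot']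
      rintro ⟨a, b⟩ h
      replace h : e.hom ≫ (biprod.fst ≫ a ≫ biprod.inl + biprod.snd ≫ b ≫ biprod.inr) ≫
          e.inv = 0 := h
      have h1 : biprod.fst ≫ a ≫ biprod.inl + biprod.snd ≫ b ≫ biprod.inr = 0 := by
        rw [← cancel_epi e.hom, ← cancel_mono e.inv]; simpa using h
      have ha := congrArg (fun φ => biprod.inl ≫ φ ≫ biprod.fst) h1
      have hb := congrArg (fun φ => biprod.inr ≫ φ ≫ biprod.snd) h1
      simp at ha hb
      rw [ha, hb]; rfl
    have h1 := LinearMap.finrank_le_finrank_of_injective hf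
    rw [Module.finrank_prod] at h1
    have : 0 < Module.finrank k (Z ⟶ Z) := by
      have : Nontrivial (Z ⟶ Z) := ⟨𝟙 Z, 0, fun h => hZ ((IsZero.iff_id_eq_zero Z).2 h)⟩
      exact Module.finrank_pos
    omega
  generalize hm : Module.finrank k (X ⟶ X) = m
  induction m using Nat.strong_induction_on generalizing X with
  | _ m ih =>
    by_cases h0 : IsZero X
    · exact hzero X h0
    by_cases hX : Indecomposable X
    · exact hind X hX
    · have : ∃ Y Z, ∃ _ : X ≅ Y ⊞ Z, ¬ IsZero Y ∧ ¬ IsZero Z := by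
        by_contra! hcon
        refine hX ⟨h0, fun Y Z e => ?_⟩
        by_cases hY : IsZero Y
        · exact Or.inl hY
        · exact Or.inr (hcon Y Z e hY)
      obtain ⟨Y, Z, e, hY, hZ⟩ := this
      exact hsum X Y Z e (ih _ (hm ▸ hlt X Y Z e hZ) Y rfl)
        (ih _ (hm ▸ hlt X Z Y (e ≪≫ biprod.braiding Y Z) hY) Z rfl)

variable {k : Type w} [Field k] [Linear k C] {n : ℕ} {𝒜 : Angulation (n + 1) C}

/-- Condition (b) implies that `𝒯(T, -)` is full and `𝒟` is rigid. -/
lemma ConditionB.full_and_rigid (hfin : ∀ X Y : C, Module.Finite k (X ⟶ Y))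
    (hb : ConditionB 𝒜 T) (X : C) :
    (∀ (Y : C) (θ : (homFunctor T).obj X ⟶ (homFunctor T).obj Y),
      ∃ f, (homFunctor T).map f = θ) ∧
    ∀ (Y : C) (j : ℕ), 1 ≤ j → j < n + 1 →
      ExtZero ((homFunctor T).obj X) ((homFunctor T).obj Y) j := by
  have hz : ∀ X : C, IsZero ((homFunctor T).obj X) →
      (∀ (Y : C) (θ : (homFunctor T).obj X ⟶ (homFunctor T).obj Y),
        ∃ f, (homFunctor T).map f = θ) ∧
      ∀ (Y : C) (j : ℕ), 1 ≤ j → j < n + 1 →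
        ExtZero ((homFunctor T).obj X) ((homFunctor T).obj Y) j := by
    intro X hX
    have : Projective ((homFunctor T).obj X) := ⟨fun _ _ _ => ⟨0, hX.eq_of_src _ _⟩⟩
    exact ⟨fun Y θ => ⟨0, hX.eq_of_src _ _⟩, fun Y j hj _ => extZero_of_projective _ _ hj⟩
  induction X using induction_indecomposable hfin with
  | hzero X hX => exact hz X ((homFunctor T).map_isZero hX)
  | hsum X Y Z e hY hZ =>
    have h1 : e.hom ≫ biprod.fst ≫ biprod.inl ≫ e.inv + e.hom ≫ biprod.snd ≫ biprod.inr ≫ e.inv =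
        𝟙 X := by
      rw [← Preadditive.comp_add, ← Category.assoc biprod.fst, ← Category.assoc biprod.snd,
        ← Preadditive.add_comp, biprod.total]
      simp
    refine ⟨fun W θ => ?_, fun W j hj hjn => ?_⟩
    · obtain ⟨a, ha⟩ := hY.1 W ((homFunctor T).map (biprod.inl ≫ e.inv) ≫ θ)
      obtain ⟨b, hb⟩ := hZ.1 W ((homFunctor T).map (biprod.inr ≫ e.inv) ≫ θ)
      refine ⟨e.hom ≫ biprod.fst ≫ a + e.hom ≫ biprod.snd ≫ b, ?_⟩
      simp only [Functor.map_add, Functor.map_comp, ha, hb]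
      simp only [← Category.assoc]
      rw [← Preadditive.add_comp]
      simp only [← Functor.map_comp, ← Functor.map_add]
      simp only [Category.assoc]
      rw [h1, CategoryTheory.Functor.map_id, Category.id_comp]
    · refine (hY.2 W j hj hjn).of_sum_left (hZ.2 W j hj hjn)
        ((homFunctor T).map (e.hom ≫ biprod.fst)) ((homFunctor T).map (biprod.inl ≫ e.inv))
        ((homFunctor T).map (e.hom ≫ biprod.snd)) ((homFunctor T).map (biprod.inr ≫ e.inv)) ?_
      simp only [← Functor.map_comp, ← Functor.map_add, Category.assoc]
      rw [h1, CategoryTheory.Functor.map_id]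
  | hind X hX =>
    by_cases hn : Nontrivial (T ⟶ X)
    · obtain ⟨Z, hZ, ⟨e⟩, hT, hc⟩ := hb X hX hn
      refine ⟨fun Y θ => ?_, fun Y j hj hjn => ?_⟩
      · obtain ⟨f, hf⟩ := Angulation.exists_map_eq_of_isAdd hZ hT hc ((homFunctor T).map e.hom ≫ θ)
        refine ⟨e.inv ≫ f, ?_⟩
        rw [Functor.map_comp, hf, ← Category.assoc, ← Functor.map_comp, e.inv_hom_id,
          CategoryTheory.Functor.map_id, Category.id_comp]
      · exact (Angulation.extZero_of_isAdd hZ hT hc Y j hj (by omega)).of_retract_left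
          ((homFunctor T).map e.inv) ((homFunctor T).map e.hom) (by
            rw [← Functor.map_comp, e.inv_hom_id, CategoryTheory.Functor.map_id])
    · refine hz X ?_
      rw [not_nontrivial_iff_subsingleton] at hn
      rw [IsZero.iff_id_eq_zero]
      ext x
      exact hn.elim _ _

end

section

variable {C : Type u} [Category.{v} C] [Preadditive C] {T : C}

lemma imageD_obj (X : C) : imageD T ((homFunctor T).obj X) := ⟨X, ⟨Iso.refl _⟩⟩

lemma imageD_of_iso {M N : ModuleCat.{v} (End T)ᵐᵒᵖ} (e : M ≅ N) (h : imageD T M) : imageD T N :=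
  (imageD T).prop_of_iso e h

section Retract

variable {k : Type w} [Field k] [Linear k C] [HasFiniteBiproducts C] [IsIdempotentComplete C]

/-- If `𝒯(T, -)` is full, then `𝒟` is closed under direct summands. -/
lemma imageD_of_retract (hfin : ∀ X Y : C, Module.Finite k (X ⟶ Y))
    (hfull : (homFunctor T).Full) {M N : ModuleCat.{v} (End T)ᵐᵒᵖ} (i : M ⟶ N) (r : N ⟶ M)
    (hir : i ≫ r = 𝟙 M) (hN : imageD T N) : imageD T M := by
  obtain ⟨X, ⟨e⟩⟩ := hN
  obtain ⟨φ, hφ⟩ := (homFunctor T).map_surjective (e.hom ≫ r ≫ i ≫ e.inv)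
  have hid : (e.hom ≫ r ≫ i ≫ e.inv) ≫ (e.hom ≫ r ≫ i ≫ e.inv) = e.hom ≫ r ≫ i ≫ e.inv := by
    simp only [Category.assoc, Iso.inv_hom_id_assoc]
    rw [← Category.assoc i r, hir, Category.id_comp]
  obtain ⟨ε, hε⟩ := exists_isFitting k hfin φ
  have h : (homFunctor T).map ε = e.hom ≫ r ≫ i ≫ e.inv := by
    refine IsFittingEnd.unique (φ := (homFunctor T).map φ) (hε.functor_map _) ?_
    rw [hφ]
    exact IsFitting.of_idem (M := End _) hid
  obtain ⟨Y, j, s, hjs, hsj⟩ := IsIdempotentComplete.idempotents_split X ε hε.idem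
  have hjs' : (homFunctor T).map j ≫ (homFunctor T).map s = 𝟙 _ := by
    rw [← Functor.map_comp, hjs, CategoryTheory.Functor.map_id]
  rw [← hsj, Functor.map_comp] at h
  refine imageD_of_iso ⟨(homFunctor T).map j ≫ e.hom ≫ r, i ≫ e.inv ≫ (homFunctor T).map s, ?_, ?_⟩
    (imageD_obj Y)
  · have h1 : ((homFunctor T).map j ≫ e.hom ≫ r) ≫ i ≫ e.inv ≫ (homFunctor T).map s =
        (homFunctor T).map j ≫ (e.hom ≫ r ≫ i ≫ e.inv) ≫ (homFunctor T).map s := by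
      simp only [Category.assoc]
    rw [h1, ← h, Category.assoc, hjs', Category.comp_id, hjs']
  · have h1 : (i ≫ e.inv ≫ (homFunctor T).map s) ≫ (homFunctor T).map j ≫ e.hom ≫ r =
        i ≫ e.inv ≫ ((homFunctor T).map s ≫ (homFunctor T).map j) ≫ e.hom ≫ r := by
      simp only [Category.assoc]
    rw [h1, h]
    simp only [Category.assoc, Iso.inv_hom_id_assoc]
    rw [← Category.assoc i r, hir, Category.id_comp]

end Retract

lemma imageD_isFinDim {k : Type w} [Field k] [Linear k C]
    (hfin : ∀ X Y : C, Module.Finite k (X ⟶ Y)) {M : ModuleCat.{v} (End T)ᵐᵒᵖ}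
    (h : imageD T M) : IsFinDim k M := by
  obtain ⟨X, ⟨e⟩⟩ := h
  exact isFinDim_of_surjective e.hom ((ModuleCat.epi_iff_surjective _).1 inferInstance)
    (isFinDim_hom k hfin X)

lemma ExtVanishesFrom.of_iso {d : ℕ} {M N : ModuleCat.{v} (End T)ᵐᵒᵖ}
    {𝒳 : ObjectProperty (ModuleCat.{v} (End T)ᵐᵒᵖ)} (h : ExtVanishesFrom d 𝒳 M) (e : M ≅ N) :
    ExtVanishesFrom d 𝒳 N := fun X hX j h₁ h₂ =>
  ExtZero.of_retract_right (h X hX j h₁ h₂) e.inv e.hom e.inv_hom_id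

lemma ExtVanishesTo.of_iso {d : ℕ} {M N : ModuleCat.{v} (End T)ᵐᵒᵖ}
    {𝒳 : ObjectProperty (ModuleCat.{v} (End T)ᵐᵒᵖ)} (h : ExtVanishesTo d 𝒳 M) (e : M ≅ N) :
    ExtVanishesTo d 𝒳 N := fun X hX j h₁ h₂ =>
  ExtZero.of_retract_left (h X hX j h₁ h₂) e.inv e.hom e.inv_hom_id

variable [HasFiniteBiproducts C] {n : ℕ} {𝒜 : Angulation (n + 1) C}

/-- The components of an isomorphism of arrows. -/
lemma exists_isos_of_arrow_iso {C : Type u} [Category.{v} C] {A B A' B' : C} {f : A ⟶ B} {g : A' ⟶ B'}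
    (e : Arrow.mk g ≅ Arrow.mk f) : ∃ (a : A' ≅ A) (b : B' ≅ B), g ≫ b.hom = a.hom ≫ f :=
  ⟨Arrow.leftFunc.mapIso e, Arrow.rightFunc.mapIso e, (Arrow.w e.hom).symm⟩

namespace Angulation

variable {Z : SuspSeq (n + 1) 𝒜.susp.functor}

lemma coRes_im (hZ : 𝒜.IsAngle Z) (i : Fin (n + 2)) (hi : (homFunctor T).map (Z.map i) = 0)
    (m : Fin (n + 2)) (him : i < m) :
    CoRes (imageD T) (m.val - i.val - 1) (imObj ((homFunctor T).map (Z.map m))) := by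
  induction m using Fin.induction with
  | zero => exact absurd him (Fin.not_lt_zero i)
  | succ m ih =>
    have hs := ses T hZ m
    by_cases h : i = m.castSucc
    · subst h
      have h0 : (m.succ.val - m.castSucc.val - 1) = 0 := by simp
      rw [h0]
      have : Function.Surjective (imι ((homFunctor T).map
          (Z.map m.succ : Z.obj m.succ.succ ⟶ Z.obj m.succ.castSucc))).hom := by
        rw [← LinearMap.range_eq_top, hs.exact, ker_imπ]
        exact (congrArg (fun φ => LinearMap.ker (ModuleCat.Hom.hom φ)) hi).trans LinearMap.ker_zero
      have := isIso_of_bijective hs.inj this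
      exact imageD_of_iso (asIso (imι ((homFunctor T).map
          (Z.map m.succ : Z.obj m.succ.succ ⟶ Z.obj m.succ.castSucc)))).symm (imageD_obj _)
    · have hlt : i < m.castSucc := lt_of_le_of_ne (Fin.le_castSucc_iff.2 him) h
      have h0 : m.succ.val - i.val - 1 = (m.castSucc.val - i.val - 1) + 1 := by
        have : i.val < m.val := hlt
        simp only [Fin.val_succ, Fin.val_castSucc]; omega
      rw [h0]
      exact ⟨_, _, _, _, imageD_obj _, hs, ih hlt⟩

lemma res_im (hZ : 𝒜.IsAngle Z) (i : Fin (n + 2)) (hi : (homFunctor T).map (Z.map i) = 0)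
    (m : Fin (n + 2)) (him : m < i) :
    Res (imageD T) (i.val - m.val - 1) (imObj ((homFunctor T).map (Z.map m))) := by
  induction m using Fin.reverseInduction with
  | last => exact absurd him (not_lt.2 (Fin.le_last i))
  | cast m ih =>
    have hs := ses T hZ m
    by_cases h : i = m.succ
    · subst h
      have h0 : (m.succ.val - m.castSucc.val - 1) = 0 := by simp
      rw [h0]
      have : Function.Injective (imπ ((homFunctor T).map
          (Z.map m.castSucc : Z.obj m.succ.castSucc ⟶ Z.obj m.castSucc.castSucc))).hom := by
        rw [← LinearMap.ker_eq_bot, ← hs.exact, range_imι]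
        exact (congrArg (fun φ => LinearMap.range (ModuleCat.Hom.hom φ)) hi).trans
          LinearMap.range_zero
      have := isIso_of_bijective this hs.surj
      exact imageD_of_iso (asIso (imπ ((homFunctor T).map
          (Z.map m.castSucc : Z.obj m.succ.castSucc ⟶ Z.obj m.castSucc.castSucc)))) (imageD_obj _)
    · have hlt : m.succ < i := lt_of_le_of_ne (Fin.castSucc_lt_iff_succ_le.1 him) (Ne.symm h)
      have h0 : i.val - m.castSucc.val - 1 = (i.val - m.succ.val - 1) + 1 := by
        have : m.val + 1 < i.val := hlt
        simp only [Fin.val_succ, Fin.val_castSucc]; omega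
      rw [h0]
      exact ⟨_, _, _, _, imageD_obj _, hs, ih hlt⟩

/-- If `M` is the cokernel of the first map of an angle, it embeds into the next term. -/
lemma ker_eq_of_exact (hZ : 𝒜.IsAngle Z) {M : ModuleCat.{v} (End T)ᵐᵒᵖ}
    {p : (homFunctor T).obj (Z.obj (Fin.last (n + 1)).castSucc) ⟶ M}
    (hp : LinearMap.range ((homFunctor T).map Z.first).hom = LinearMap.ker p.hom) :
    LinearMap.ker p.hom = LinearMap.ker ((homFunctor T).map
      (Z.map (Fin.last n).castSucc : Z.obj (Fin.last (n + 1)).castSucc ⟶ _)).hom :=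
  hp.symm.trans (innerExact T hZ (Fin.last n))

end Angulation

open Angulation

variable {k : Type w} [Field k] [Linear k C]

lemma mem_of_conditionA [IsIdempotentComplete C] (hfin : ∀ X Y : C, Module.Finite k (X ⟶ Y))
    (ha : ConditionA k 𝒜 T) (hfull : (homFunctor T).Full)
    (hrigid : ∀ X Y, imageD T X → imageD T Y → ∀ j, 1 ≤ j → j < n + 1 → ExtZero X Y j)
    {M : ModuleCat.{v} (End T)ᵐᵒᵖ} (hM : IsFinDim k M)
    (hext : ExtVanishesFrom (n + 1) (imageD T) M) : imageD T M := by
  obtain ⟨T₁, T₀, f, p, h₁, h₀, hmin⟩ := exists_minProjPresentation hfin hM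
  obtain ⟨Z, hZ, ⟨e⟩, i, hi⟩ := ha M hM hext T₁ T₀ h₁ h₀ f p hmin
  obtain ⟨a, b, hab⟩ := exists_isos_of_arrow_iso e
  let F := homFunctor T
  have hex := exact_of_comm_left (F.mapIso a) (F.mapIso b) (by
    simp only [Functor.mapIso_hom]
    rw [← Functor.map_comp, hab, Functor.map_comp]) hmin.exact
  have hp : Function.Surjective ((F.mapIso b).hom ≫ p).hom := by
    rw [ModuleCat.hom_comp]
    exact (LinearMap.range_eq_top.1 hmin.surjective).comp
      ((ModuleCat.epi_iff_surjective _).1 inferInstance)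
  have hk := ker_eq_of_exact hZ hex
  obtain ⟨ι, -⟩ := exists_iso_of_ker_eq (imπ_surjective (F.map
      (Z.map (Fin.last n).castSucc : Z.obj (Fin.last (n + 1)).castSucc ⟶ _))) hp
    (by rw [ker_imπ]; exact hk.symm)
  refine imageD_of_iso ι ?_
  have hW : 𝒜.IsAngle Z.rotate := (𝒜.rotate_mem_iff _).1 hZ
  by_cases hlast : i = Fin.last (n + 1)
  · subst hlast
    have h0 : IsZero (imObj (F.map (Z.rotate.map (Fin.last (n + 1))))) := isZero_imObj hi
    obtain ⟨O, hO⟩ := exists_isZero (C := C)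
    exact imageD_of_iso ((F.map_isZero hO).iso h0) (imageD_obj O)
  · have hlt : i < Fin.last (n + 1) := lt_of_le_of_ne (Fin.le_last i) hlast
    have hc := coRes_im hW i hi (Fin.last (n + 1)) hlt
    refine CoRes.mem (d := n + 1) hrigid
      (fun M X i r hir => imageD_of_retract hfin hfull i r hir) ?_ hc fun X hX j hj hj' => ?_
    · simp only [Fin.val_last]; omega
    · simp only [Fin.val_last] at hj'
      exact ExtVanishesFrom.of_iso hext ι.symm X hX j hj (by omega)

lemma mem_of_conditionA' [IsIdempotentComplete C] (hfin : ∀ X Y : C, Module.Finite k (X ⟶ Y))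
    {S : SerreFunctor k C} (ha : ConditionA' k 𝒜 S T) (hfull : (homFunctor T).Full)
    (hrigid : ∀ X Y, imageD T X → imageD T Y → ∀ j, 1 ≤ j → j < n + 1 → ExtZero X Y j)
    {M : ModuleCat.{v} (End T)ᵐᵒᵖ} (hM : IsFinDim k M)
    (hext : ExtVanishesTo (n + 1) (imageD T) M) : imageD T M := by
  obtain ⟨T₁, T₀, g, u, h₁, h₀, hmin⟩ := exists_minInjCopresentation S hfin hM
  obtain ⟨Z, hZ, ⟨e⟩, i, hi⟩ := ha M hM hext T₁ T₀ h₁ h₀ g u hmin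
  obtain ⟨a, b, hab⟩ := exists_isos_of_arrow_iso e
  let F := homFunctor T
  have hex := exact_of_comm_right (F.mapIso a) (F.mapIso b) (by
    simp only [Functor.mapIso_hom]
    rw [← Functor.map_comp, hab, Functor.map_comp]) hmin.exact
  have hu : Function.Injective (u ≫ (F.mapIso a).inv).hom := by
    have := (ModuleCat.mono_iff_injective u).2 (LinearMap.ker_eq_bot.1 hmin.injective)
    exact (ModuleCat.mono_iff_injective _).1 inferInstance
  obtain ⟨ι, -⟩ := exists_iso_of_range_eq (imι_injective (F.map Z.final)) hu
    (by rw [range_imι, range_final T hZ]; exact hex.symm)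
  refine imageD_of_iso ι ?_
  by_cases h0 : i = 0
  · subst h0
    have h0 : IsZero (imObj (F.map Z.final)) := isZero_imObj hi
    obtain ⟨O, hO⟩ := exists_isZero (C := C)
    exact imageD_of_iso ((F.map_isZero hO).iso h0) (imageD_obj O)
  · have hlt : 0 < i := Fin.pos_iff_ne_zero.2 h0
    have hc := res_im hZ i hi 0 hlt
    refine Res.mem (d := n + 1) hrigid
      (fun M X i r hir => imageD_of_retract hfin hfull i r hir) ?_ hc fun X hX j hj hj' => ?_
    · simp only [Fin.val_zero]; omega
    · simp only [Fin.val_zero] at hj'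
      exact ExtVanishesTo.of_iso hext ι.symm X hX j hj (by omega)

lemma exists_leftApproximation [IsIdempotentComplete C] (𝒜 : Angulation (n + 1) C)
    (hfin : ∀ X Y : C, Module.Finite k (X ⟶ Y))
    {M : ModuleCat.{v} (End T)ᵐᵒᵖ} (hM : IsFinDim k M) :
    ∃ (X : ModuleCat.{v} (End T)ᵐᵒᵖ) (f : M ⟶ X), imageD T X ∧
      ∀ (X' : ModuleCat.{v} (End T)ᵐᵒᵖ) (g : M ⟶ X'), imageD T X' → ∃ h : X ⟶ X', f ≫ h = g := by
  obtain ⟨T₁, T₀, f, p, h₁, h₀, hmin⟩ := exists_minProjPresentation hfin hM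
  obtain ⟨Z, hZ, ⟨e⟩⟩ := 𝒜.exists_completion f
  obtain ⟨a, b, hab⟩ := exists_isos_of_arrow_iso e
  let F := homFunctor T
  have hex := exact_of_comm_left (F.mapIso a) (F.mapIso b) (by
    simp only [Functor.mapIso_hom]
    rw [← Functor.map_comp, hab, Functor.map_comp]) hmin.exact
  have hp : Function.Surjective ((F.mapIso b).hom ≫ p).hom := by
    rw [ModuleCat.hom_comp]
    exact (LinearMap.range_eq_top.1 hmin.surjective).comp
      ((ModuleCat.epi_iff_surjective _).1 inferInstance)
  have hk := ker_eq_of_exact hZ hex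
  obtain ⟨u, hu⟩ := exists_desc_of_ker_le _ hp _ hk.le
  refine ⟨_, u, imageD_obj _, ?_⟩
  rintro X' g ⟨Y, ⟨ε⟩⟩
  have hT₀ : IsAdd T (Z.obj (Fin.last (n + 1)).castSucc) :=
    h₀.of_retract b.hom b.inv b.hom_inv_id
  have hT₁ : IsAdd T (Z.obj (Fin.last (n + 1)).succ) :=
    h₁.of_retract a.hom a.inv a.hom_inv_id
  obtain ⟨ψ, hψ⟩ := hT₀.exists_map_eq (((F.mapIso b).hom ≫ p) ≫ g ≫ ε.inv)
  obtain ⟨h, hh⟩ := desc_first hZ ψ (hT₁.map_injective (by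
    rw [Functor.map_comp, hψ, ← Category.assoc, comp_eq_zero_of_range_eq_ker hex, zero_comp,
      Functor.map_zero]))
  have := (ModuleCat.epi_iff_surjective _).2 hp
  refine ⟨F.map h ≫ ε.hom, ?_⟩
  rw [← cancel_epi ((F.mapIso b).hom ≫ p), ← Category.assoc, hu, ← Category.assoc,
    ← Functor.map_comp]
  refine (congrArg (fun x => F.map x ≫ ε.hom) hh).trans ?_
  rw [hψ]
  simp only [Category.assoc, Iso.inv_hom_id, Category.comp_id]

/-- The first morphism of an angle has a weak kernel. -/
lemma Angulation.exists_weakKernel {Z : SuspSeq (n + 1) 𝒜.susp.functor} (hZ : 𝒜.IsAngle Z) :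
    ∃ (X : C) (x : X ⟶ Z.obj (Fin.last (n + 1)).succ), x ≫ Z.first = 0 ∧
      ∀ ⦃Y : C⦄ (t : Y ⟶ Z.obj (Fin.last (n + 1)).succ), t ≫ Z.first = 0 → ∃ s, s ≫ x = t := by
  obtain ⟨x, hx⟩ := 𝒜.susp.functor.map_surjective ((𝒜.susp.counitIso.app _).hom ≫ Z.conn)
  refine ⟨𝒜.susp.inverse.obj (Z.obj (0 : Fin (n + 2)).castSucc), x, ?_, fun Y t ht => ?_⟩
  · apply 𝒜.susp.functor.map_injective
    rw [Functor.map_comp, hx, Category.assoc, conn_comp_first hZ, comp_zero, Functor.map_zero]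
  · obtain ⟨y, hy⟩ := exists_lift_conn hZ (𝒜.susp.functor.map t) (by
      rw [← Functor.map_comp, ht, Functor.map_zero])
    obtain ⟨s, hs⟩ := 𝒜.susp.functor.map_surjective (y ≫ (𝒜.susp.counitIso.app _).inv)
    refine ⟨s, 𝒜.susp.functor.map_injective ?_⟩
    rw [Functor.map_comp, hs, hx, Category.assoc, Iso.inv_hom_id_assoc, hy]

lemma exists_rightApproximation [IsIdempotentComplete C] (𝒜 : Angulation (n + 1) C)
    (hfin : ∀ X Y : C, Module.Finite k (X ⟶ Y)) (S : SerreFunctor k C)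
    {M : ModuleCat.{v} (End T)ᵐᵒᵖ} (hM : IsFinDim k M) :
    ∃ (X : ModuleCat.{v} (End T)ᵐᵒᵖ) (f : X ⟶ M), imageD T X ∧
      ∀ (X' : ModuleCat.{v} (End T)ᵐᵒᵖ) (g : X' ⟶ M), imageD T X' → ∃ h : X' ⟶ X, h ≫ f = g := by
  obtain ⟨T₁, T₀, g, u, h₁, h₀, hmin⟩ := exists_minInjCopresentation S hfin hM
  obtain ⟨Z, hZ, ⟨e⟩⟩ := 𝒜.exists_completion g
  obtain ⟨a, b, hab⟩ := exists_isos_of_arrow_iso e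
  let F := homFunctor T
  have hex := exact_of_comm_right (F.mapIso a) (F.mapIso b) (by
    simp only [Functor.mapIso_hom]
    rw [← Functor.map_comp, hab, Functor.map_comp]) hmin.exact
  have hu : Function.Injective (u ≫ (F.mapIso a).inv).hom := by
    have := (ModuleCat.mono_iff_injective u).2 (LinearMap.ker_eq_bot.1 hmin.injective)
    exact (ModuleCat.mono_iff_injective _).1 inferInstance
  obtain ⟨X, x, hx, hlift⟩ := exists_weakKernel hZ
  have hxe := range_eq_ker_of_lift (T := T) x Z.first hx fun t ht => hlift t ht
  obtain ⟨v, hv⟩ := exists_lift_of_range_le _ hu (F.map x) (hxe.trans hex.symm).le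
  refine ⟨_, v, imageD_obj _, ?_⟩
  rintro X' γ ⟨Y, ⟨ε⟩⟩
  have hug := comp_eq_zero_of_range_eq_ker hmin.exact
  obtain ⟨θ, hθ⟩ := h₁.serre_exists_map_eq S (ε.hom ≫ γ ≫ u)
  have h0 : θ ≫ g = 0 := h₀.serre_map_injective S (by
    rw [Functor.map_comp, hθ, Category.assoc, Category.assoc, hug, comp_zero, comp_zero,
      Functor.map_zero])
  obtain ⟨s, hs⟩ := hlift (θ ≫ a.inv) (by
    have : a.inv ≫ Z.first = g ≫ b.inv := by
      rw [Iso.inv_comp_eq, ← Category.assoc, ← hab, Category.assoc, Iso.hom_inv_id,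
        Category.comp_id]
    rw [Category.assoc, this, ← Category.assoc, h0, zero_comp])
  have := (ModuleCat.mono_iff_injective _).2 hu
  refine ⟨ε.inv ≫ F.map s, ?_⟩
  rw [← cancel_mono (u ≫ (F.mapIso a).inv), Category.assoc, Category.assoc, hv, ← Functor.map_comp]
  refine (congrArg (fun x => ε.inv ≫ F.map x) hs).trans ?_
  rw [Functor.map_comp, hθ]
  simp

/-- Conditions (a), (a') and (b) imply that `𝒟` is `d`-cluster tilting and `𝒯(T, -)` is full. -/
theorem isDClusterTilting_of_conditions [IsIdempotentComplete C]
    (hfin : ∀ X Y : C, Module.Finite k (X ⟶ Y)) {S : SerreFunctor k C}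
    (ha : ConditionA k 𝒜 T) (ha' : ConditionA' k 𝒜 S T) (hb : ConditionB 𝒜 T) :
    IsDClusterTilting k (n + 1) (imageD T) ∧ (homFunctor T).Full := by
  have hG := hb.full_and_rigid hfin
  have hfull : (homFunctor T).Full := ⟨fun {X Y} θ => (hG X).1 Y θ⟩
  have hrigid : ∀ X Y, imageD T X → imageD T Y → ∀ j, 1 ≤ j → j < n + 1 → ExtZero X Y j := by
    rintro X Y ⟨X', ⟨e⟩⟩ ⟨Y', ⟨e'⟩⟩ j h₁ h₂
    exact (((hG X').2 Y' j h₁ h₂).of_retract_left e.inv e.hom e.inv_hom_id).of_retract_right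
      e'.inv e'.hom e'.inv_hom_id
  refine ⟨⟨fun M => ⟨fun h => ⟨imageD_isFinDim hfin h, fun X hX j h₁ h₂ => hrigid M X h hX j h₁ h₂⟩,
    fun h => mem_of_conditionA' hfin ha' hfull hrigid h.1 h.2⟩,
    fun M => ⟨fun h => ⟨imageD_isFinDim hfin h, fun X hX j h₁ h₂ => hrigid X M hX h j h₁ h₂⟩,
    fun h => mem_of_conditionA hfin ha hfull hrigid h.1 h.2⟩,
    fun M hM => exists_rightApproximation 𝒜 hfin S hM,
    fun M hM => exists_leftApproximation 𝒜 hfin hM⟩, hfull⟩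

end

section

variable {C : Type u} [Category.{v} C] [Preadditive C] [HasFiniteBiproducts C]

namespace Angulation

/-- The Fitting summand of an endomorphism of an angle. -/
lemma exists_fitting_split {k : Type w} [Field k] [Linear k C]
    [IsIdempotentComplete C] (hfin : ∀ X Y : C, Module.Finite k (X ⟶ Y))
    {d : ℕ} {𝒜 : Angulation d C} {X : SuspSeq d 𝒜.susp.functor} (hX : 𝒜.IsAngle X)
    (φ : X.Hom X) :
    ∃ (Y : SuspSeq d 𝒜.susp.functor) (ι : ∀ i, Y.obj i ⟶ X.obj i) (ρ : ∀ i, X.obj i ⟶ Y.obj i),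
      𝒜.IsAngle Y ∧ (∀ i, ι i ≫ ρ i = 𝟙 _) ∧ (∀ i, IsFittingEnd (φ.app i) (ρ i ≫ ι i)) ∧
      (∀ i, Y.map i = ι i.succ ≫ X.map i ≫ ρ i.castSucc) ∧
      Y.conn = ι _ ≫ X.conn ≫ 𝒜.susp.functor.map (ρ _) := by
  choose e he using fun i => exists_isFitting k hfin (φ.app i)
  obtain ⟨Y, ι, ρ, h₁, h₂, h₃, h₄⟩ := exists_split hX ⟨e, fun i =>
    ((he _).comp_eq (he _) _ (φ.comm i)), ((he _).comp_eq ((he _).functor_map _) _ φ.comm_conn)⟩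
    fun i => (he i).comp_self
  exact ⟨Y, ι, ρ, h₁, h₂, fun i => by rw [h₃]; exact he i, h₄⟩

end Angulation

lemma rotate_map_eq {d : ℕ} {P : C ⥤ C} {X Y : SuspSeq d P} {ι : ∀ i, Y.obj i ⟶ X.obj i}
    {ρ : ∀ i, X.obj i ⟶ Y.obj i} (hmap : ∀ i, Y.map i = ι i.succ ≫ X.map i ≫ ρ i.castSucc)
    (hconn : Y.conn = ι _ ≫ X.conn ≫ P.map (ρ _)) (i : Fin (d + 1)) :
    ∃ s : X.rotate.obj i.castSucc ⟶ Y.rotate.obj i.castSucc,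
      Y.rotate.map i = (ι i.castSucc : Y.rotate.obj i.succ ⟶ X.rotate.obj i.succ) ≫
        X.rotate.map i ≫ s := by
  induction i using Fin.cases with
  | zero => exact ⟨_, hconn⟩
  | succ i => exact ⟨_, hmap i.castSucc⟩

lemma IsFittingEnd.exists_eq_comp {X Y : C} {φ : X ⟶ X} {ι : Y ⟶ X} {ρ : X ⟶ Y}
    (h : IsFittingEnd φ (ρ ≫ ι)) (hι : ι ≫ ρ = 𝟙 Y) : ∃ z, ι = z ≫ φ := by
  obtain ⟨x, -, hx⟩ := h.exists_fac
  exact ⟨ι ≫ x, by rw [Category.assoc, hx, ← Category.assoc, hι, Category.id_comp]⟩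

lemma IsFittingEnd.exists_comp_eq {X Y : C} {φ : X ⟶ X} {ι : Y ⟶ X} {ρ : X ⟶ Y}
    (h : IsFittingEnd φ (ρ ≫ ι)) (hι : ι ≫ ρ = 𝟙 Y) : ∃ z, ρ = φ ≫ z := by
  obtain ⟨x, hx, -⟩ := h.exists_fac
  exact ⟨x ≫ ρ, by rw [← Category.assoc, hx, Category.assoc, hι, Category.comp_id]⟩

variable {n : ℕ} {𝒜 : Angulation (n + 1) C} {T : C}

/-- Every morphism is, up to isomorphism, the connecting morphism of an angle. -/
lemma Angulation.exists_conn (𝒜 : Angulation (n + 1) C) {A B : C} (g : A ⟶ B) :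
    ∃ Z : SuspSeq (n + 1) 𝒜.susp.functor, 𝒜.IsAngle Z ∧ Nonempty (Arrow.mk Z.conn ≅ Arrow.mk g) := by
  obtain ⟨W, hW, ⟨e⟩⟩ := 𝒜.exists_completion (𝒜.susp.inverse.map g)
  obtain ⟨a, b, hab⟩ := exists_isos_of_arrow_iso e
  refine ⟨W.rotate, (𝒜.rotate_mem_iff _).1 hW, ?_⟩
  let a' : 𝒜.susp.functor.obj (W.obj (Fin.last (n + 1)).succ) ≅ A :=
    𝒜.susp.functor.mapIso a ≪≫ 𝒜.susp.counitIso.app A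
  let b' : 𝒜.susp.functor.obj (W.obj (Fin.last (n + 1)).castSucc) ≅ B :=
    𝒜.susp.functor.mapIso b ≪≫ 𝒜.susp.counitIso.app B
  have hab' : 𝒜.susp.functor.map W.first ≫ b'.hom = a'.hom ≫ g := by
    have h := congrArg 𝒜.susp.functor.map hab
    rw [Functor.map_comp, Functor.map_comp] at h
    simp only [a', b', Iso.trans_hom, Functor.mapIso_hom, Iso.app_hom]
    rw [← Category.assoc, h, Category.assoc, Category.assoc]
    congr 1
    exact 𝒜.susp.counitIso.hom.naturality g
  let s : ℤˣ := (-1) ^ (n + 1 + 2)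
  let b'' : 𝒜.susp.functor.obj (W.obj (Fin.last (n + 1)).castSucc) ≅ B :=
    ⟨s.val • b'.hom, s.inv • b'.inv, by simp [smul_smul], by simp [smul_smul]⟩
  refine ⟨Arrow.isoMk a' b'' ?_⟩
  change a'.hom ≫ g = (((-1 : ℤ) ^ (n + 1 + 2)) • 𝒜.susp.functor.map W.first) ≫ (s.val • b'.hom)
  rw [Preadditive.zsmul_comp, Preadditive.comp_zsmul, smul_smul, hab']
  have : (-1 : ℤ) ^ (n + 1 + 2) * s.val = 1 := by
    simp [s, ← mul_pow]
  rw [this, one_smul]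

lemma eq_id_of_idem_of_epi {D : Type*} [Category D] {X : D} {e : X ⟶ X} (h : e ≫ e = e) [Epi e] :
    e = 𝟙 X := by rw [← cancel_epi e, h, Category.comp_id]

lemma eq_id_of_idem_of_mono {D : Type*} [Category D] {X : D} {e : X ⟶ X} (h : e ≫ e = e) [Mono e] :
    e = 𝟙 X := by rw [← cancel_mono e, h, Category.id_comp]

lemma map_eq_zero_of_epi {D : Type*} [Category D] [Preadditive D] (F : C ⥤ D) [F.Additive]
    {A X B V Y U : C} {p : A ⟶ X} {α : X ⟶ B} {h : B ⟶ V} (hp : Epi (F.map p))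
    (h0 : (p ≫ α) ≫ h = 0) {ι : Y ⟶ B} {z : Y ⟶ X} (hι : ι = z ≫ α) (s : V ⟶ U) :
    F.map (ι ≫ h ≫ s) = 0 := by
  have h1 : F.map (α ≫ h) = 0 := by
    rw [← cancel_epi (F.map p), ← Functor.map_comp, ← Category.assoc, h0, Functor.map_zero,
      comp_zero]
  rw [hι, Category.assoc, ← Category.assoc α, Functor.map_comp, Functor.map_comp, h1, zero_comp,
    comp_zero]

lemma map_eq_zero_of_mono {D : Type*} [Category D] [Preadditive D] (F : C ⥤ D) [F.Additive]
    {A X B V Y U : C} {i : X ⟶ A} {α : B ⟶ X} {h : V ⟶ B} (hi : Mono (F.map i))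
    (h0 : h ≫ α ≫ i = 0) {ρ : B ⟶ Y} {z : X ⟶ Y} (hρ : ρ = α ≫ z) (s : U ⟶ V) :
    F.map (s ≫ h ≫ ρ) = 0 := by
  have h1 : F.map (h ≫ α) = 0 := by
    rw [← cancel_mono (F.map i), ← Functor.map_comp, Category.assoc, h0, Functor.map_zero,
      zero_comp]
  rw [hρ, ← Category.assoc h, Functor.map_comp, Functor.map_comp, h1, zero_comp, comp_zero]

lemma comp_eq_of_eq_comp {D : Type*} [Category D] {A B A' B' : D} {y : A' ⟶ B'} {ι₁ : A' ⟶ A}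
    {f : A ⟶ B} {ρ₀ : B ⟶ B'} {ι₀ : B' ⟶ B} (hy : y = ι₁ ≫ f ≫ ρ₀) (h : ρ₀ ≫ ι₀ = 𝟙 B) :
    y ≫ ι₀ = ι₁ ≫ f := by
  rw [hy, Category.assoc, Category.assoc, h, Category.comp_id]

lemma conj_idem {D : Type*} [Category D] {X Y : D} (a : X ≅ Y) {e : X ⟶ X} (h : e ≫ e = e) :
    (a.inv ≫ e ≫ a.hom) ≫ (a.inv ≫ e ≫ a.hom) = a.inv ≫ e ≫ a.hom := by
  simp only [Category.assoc, Iso.hom_inv_id_assoc]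
  rw [← Category.assoc e e, h]

lemma eq_id_of_conj {D : Type*} [Category D] {X Y : D} (a : X ≅ Y) {e : X ⟶ X}
    (h : a.inv ≫ e ≫ a.hom = 𝟙 Y) : e = 𝟙 X := by
  rw [Iso.inv_comp_eq, Category.comp_id] at h
  rw [← cancel_mono a.hom, h, Category.id_comp]

open Angulation

variable {k : Type w} [Field k] [Linear k C] [IsIdempotentComplete C]

/-- If `𝒟` is `d`-cluster tilting and `𝒯(T, -)` is full, then (strong a) holds. -/
theorem conditionStrongA (hfin : ∀ X Y : C, Module.Finite k (X ⟶ Y))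
    (hD : IsDClusterTilting k (n + 1) (imageD T)) (hfull : (homFunctor T).Full) :
    ConditionStrongA k 𝒜 T := by
  intro M hM hext T₁ T₀ h₁ h₀ f p hmin
  obtain ⟨X, ⟨ε⟩⟩ := (hD.mem_iff_from M).2 ⟨hM, hext⟩
  obtain ⟨Z, hZ, ⟨e⟩⟩ := 𝒜.exists_completion f
  obtain ⟨a, b, hab⟩ := exists_isos_of_arrow_iso e
  let F := homFunctor T
  have hT₀ : IsAdd T (Z.obj (Fin.last (n + 1)).castSucc) :=
    h₀.of_retract b.hom b.inv b.hom_inv_id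
  have hT₁ : IsAdd T (Z.obj (Fin.last (n + 1)).succ) :=
    h₁.of_retract a.hom a.inv a.hom_inv_id
  obtain ⟨p', hp'⟩ := hT₀.exists_map_eq ((F.mapIso b).hom ≫ p ≫ ε.inv)
  have hsurj : Function.Surjective (F.map p').hom := by
    have := (ModuleCat.epi_iff_surjective p).2 (LinearMap.range_eq_top.1 hmin.surjective)
    rw [hp']
    exact (ModuleCat.epi_iff_surjective _).1 inferInstance
  have hex : LinearMap.range (F.map Z.first).hom = LinearMap.ker (F.map p').hom := by
    rw [hp', ← Category.assoc, ker_comp_of_injective _ ε.inv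
      ((ModuleCat.mono_iff_injective _).1 inferInstance)]
    exact exact_of_comm_left (F.mapIso a) (F.mapIso b) (by
      simp only [Functor.mapIso_hom]
      rw [← Functor.map_comp, hab, Functor.map_comp]) hmin.exact
  obtain ⟨β, hβ⟩ := desc_first hZ p' (hT₁.map_injective (by
    rw [Functor.map_comp, comp_eq_zero_of_range_eq_ker hex, Functor.map_zero]))
  obtain ⟨α', hα'⟩ := exists_desc_of_ker_le _ hsurj
    (F.map (Z.map (Fin.last n).castSucc : Z.obj (Fin.last (n + 1)).castSucc ⟶ _))
    (ker_eq_of_exact hZ hex).le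
  obtain ⟨α, rfl⟩ := F.map_surjective α'
  have hα : p' ≫ α = Z.map (Fin.last n).castSucc := hT₀.map_injective (by
    rw [Functor.map_comp]; exact hα')
  obtain ⟨φ, hφ₁, hφ₀⟩ := exists_hom_of_comm hZ hZ (Fin.last n).castSucc (𝟙 _) (β ≫ α) (by
    rw [Category.id_comp, ← Category.assoc]
    exact (congrArg (· ≫ α) hβ).trans hα)
  obtain ⟨Y, ι, ρ, hY, hιρ, hfit, hmap, hconn⟩ := exists_fitting_split hfin hZ φ
  have e₀ : ρ (Fin.last (n + 1)).castSucc ≫ ι (Fin.last (n + 1)).castSucc = 𝟙 _ := by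
    have h := hfit (Fin.last n).castSucc.succ
    rw [hφ₁] at h
    exact h.eq_id
  have e₁ : ρ (Fin.last (n + 1)).succ ≫ ι (Fin.last (n + 1)).succ = 𝟙 _ := by
    have h := φ.comm (Fin.last (n + 1))
    have h₂ : φ.app (Fin.last (n + 1)).castSucc = 𝟙 _ := hφ₁
    rw [h₂, Category.comp_id] at h
    have h₃ := (hfit _).comp_of_eq_comp Z.first h.symm
    refine eq_id_of_conj a (h₁.map_injective ?_)
    have hf : (a.inv ≫ (ρ (Fin.last (n + 1)).succ ≫ ι (Fin.last (n + 1)).succ) ≫ a.hom) ≫ f = f := by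
      rw [Category.assoc, Category.assoc, ← hab, ← Category.assoc _ Z.first, h₃, hab,
        Iso.inv_hom_id_assoc]
    have := (ModuleCat.epi_iff_surjective _).2 (hmin.superfluous₁.surjective (F.map _) (by
      rw [← Functor.map_comp]; exact congrArg F.map hf))
    rw [CategoryTheory.Functor.map_id]
    exact eq_id_of_idem_of_epi (by
      rw [← Functor.map_comp]; exact congrArg F.map (conj_idem a (hfit _).comp_self))
  refine ⟨Y, hY, ⟨Arrow.isoMk (⟨ι _, ρ _, hιρ _, e₁⟩ ≪≫ a) (⟨ι _, ρ _, hιρ _, e₀⟩ ≪≫ b) ?_⟩, ?_⟩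
  · change (ι _ ≫ a.hom) ≫ f = Y.first ≫ ι _ ≫ b.hom
    rw [Category.assoc, ← hab, ← Category.assoc, ← Category.assoc]
    exact congrArg (· ≫ b.hom) (comp_eq_of_eq_comp (hmap (Fin.last (n + 1))) e₀).symm
  · obtain ⟨s, hs⟩ := rotate_map_eq hmap hconn (Fin.last n).castSucc
    obtain ⟨z, hz⟩ := (hfit (Fin.last n).castSucc.castSucc).exists_eq_comp (hιρ _)
    rw [hφ₀] at hz
    have hW : 𝒜.IsAngle Z.rotate := (𝒜.rotate_mem_iff _).1 hZ
    have h0 : (Z.map (Fin.last n).castSucc : Z.obj (Fin.last n).castSucc.succ ⟶ _) ≫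
      Z.rotate.map (Fin.last n).castSucc = 0 := comp_eq_zero hW (Fin.last n)
    rw [← Category.assoc] at hz
    have h1 := (congrArg (fun x => x ≫ (Z.rotate.map (Fin.last n).castSucc :
      Z.obj (Fin.last n).castSucc.castSucc ⟶ _)) hα).trans h0
    exact (congrArg F.map hs).trans
      (map_eq_zero_of_epi F ((ModuleCat.epi_iff_surjective _).2 hsurj) h1 hz s)

/-- If `𝒟` is `d`-cluster tilting and `𝒯(T, -)` is full, then (strong a') holds. -/
theorem conditionStrongA' (hfin : ∀ X Y : C, Module.Finite k (X ⟶ Y)) (S : SerreFunctor k C)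
    (hD : IsDClusterTilting k (n + 1) (imageD T)) (hfull : (homFunctor T).Full) :
    ConditionStrongA' k 𝒜 S T := by
  intro N hN hext T₁ T₀ h₁ h₀ g u hmin
  obtain ⟨X, ⟨ε⟩⟩ := (hD.mem_iff_to N).2 ⟨hN, hext⟩
  obtain ⟨Z, hZ, ⟨e⟩⟩ := 𝒜.exists_conn g
  obtain ⟨a, b, hab⟩ := exists_isos_of_arrow_iso e
  let F := homFunctor T
  obtain ⟨i', hi'⟩ := h₁.serre_exists_map_eq S (ε.hom ≫ u)
  have hinj : Function.Injective (F.map (i' ≫ a.inv)).hom := by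
    have := (ModuleCat.mono_iff_injective u).2 (LinearMap.ker_eq_bot.1 hmin.injective)
    have : Mono (F.map i') := by rw [hi']; infer_instance
    rw [Functor.map_comp]
    exact (ModuleCat.mono_iff_injective _).1 inferInstance
  have hex : LinearMap.range (F.map (i' ≫ a.inv)).hom = LinearMap.ker (F.map Z.conn).hom := by
    rw [Functor.map_comp]
    refine exact_of_comm_right (F.mapIso a) (F.mapIso b) (by
      simp only [Functor.mapIso_hom]
      rw [← Functor.map_comp, hab, Functor.map_comp]) ?_
    rw [hi', range_comp_of_surjective _ _ ((ModuleCat.epi_iff_surjective _).1 inferInstance)]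
    exact hmin.exact
  have hinjX : ∀ {W : C} {x y : W ⟶ Z.obj (0 : Fin (n + 2)).castSucc}, F.map x = F.map y → x = y := by
    intro W x y hxy
    rw [← cancel_mono a.hom]
    exact h₁.serre_map_injective S (by rw [Functor.map_comp, hxy, Functor.map_comp])
  have hconn0 : (i' ≫ a.inv) ≫ Z.conn = 0 := by
    rw [← cancel_mono b.hom, Category.assoc, Category.assoc, hab, Iso.inv_hom_id_assoc, zero_comp]
    refine h₀.serre_map_injective S ?_
    rw [Functor.map_comp, hi', Category.assoc, comp_eq_zero_of_range_eq_ker hmin.exact, comp_zero,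
      Functor.map_zero]
  obtain ⟨β, hβ⟩ := exists_lift_final hZ _ hconn0
  obtain ⟨α', hα'⟩ := exists_lift_of_range_le _ hinj (F.map Z.final)
    ((range_final T hZ).trans hex.symm).le
  obtain ⟨α, rfl⟩ := F.map_surjective α'
  have hα : α ≫ i' ≫ a.inv = Z.final := hinjX (by
    rw [Functor.map_comp]; exact hα')
  obtain ⟨φ, hφ₁, hφ₀⟩ := exists_hom_of_comm hZ hZ 0 (α ≫ β) (𝟙 _) (by
    rw [Category.comp_id, Category.assoc]
    exact ((congrArg (α ≫ ·) hβ).trans hα).symm)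
  obtain ⟨Y, ι, ρ, hY, hιρ, hfit, hmap, hconn⟩ := exists_fitting_split hfin hZ φ
  have e₀ : ρ (0 : Fin (n + 2)).castSucc ≫ ι (0 : Fin (n + 2)).castSucc = 𝟙 _ := by
    have h := hfit (0 : Fin (n + 2)).castSucc
    rw [hφ₀] at h
    exact h.eq_id
  have e₁ : 𝒜.susp.functor.map (ρ (Fin.last (n + 1)).succ) ≫
      𝒜.susp.functor.map (ι (Fin.last (n + 1)).succ) = 𝟙 _ := by
    rw [← Functor.map_comp]
    have h := φ.comm_conn
    rw [hφ₀, Category.id_comp] at h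
    have hfit' := (hfit (Fin.last (n + 1)).succ).functor_map 𝒜.susp.functor
    have h₃ := hfit'.comp_of_comp_eq Z.conn h
    refine eq_id_of_conj b (h₀.serre_map_injective S ?_)
    have hg : g ≫ (b.inv ≫ 𝒜.susp.functor.map (ρ (Fin.last (n + 1)).succ ≫
        ι (Fin.last (n + 1)).succ) ≫ b.hom) = g := by
      have : g ≫ b.inv = a.inv ≫ Z.conn := by
        rw [Iso.eq_inv_comp, ← Category.assoc, ← hab, Category.assoc, Iso.hom_inv_id]
        exact Category.comp_id _
      rw [← Category.assoc, this, Category.assoc, ← Category.assoc Z.conn, h₃, hab,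
        Iso.inv_hom_id_assoc]
    have := (ModuleCat.mono_iff_injective _).2 (hmin.essential₀.injective (F.map _) (by
      rw [← Functor.map_comp]; exact congrArg F.map hg))
    rw [CategoryTheory.Functor.map_id]
    exact eq_id_of_idem_of_mono (by
      rw [← Functor.map_comp]; exact congrArg F.map (conj_idem b hfit'.comp_self))
  refine ⟨Y, hY, ⟨Arrow.isoMk (⟨ι _, ρ _, hιρ _, e₀⟩ ≪≫ a)
    (⟨𝒜.susp.functor.map (ι _), 𝒜.susp.functor.map (ρ _), by
      rw [← Functor.map_comp, hιρ]; exact CategoryTheory.Functor.map_id _ _, e₁⟩ ≪≫ b) ?_⟩, ?_⟩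
  · change (ι _ ≫ a.hom) ≫ g = Y.conn ≫ 𝒜.susp.functor.map (ι _) ≫ b.hom
    rw [Category.assoc, ← hab, ← Category.assoc, ← Category.assoc]
    exact congrArg (· ≫ b.hom) (comp_eq_of_eq_comp hconn e₁).symm
  · obtain ⟨z, hz⟩ := (hfit (0 : Fin (n + 2)).succ).exists_comp_eq (hιρ _)
    rw [hφ₁] at hz
    rw [Category.assoc] at hz
    have h1 := (congrArg (fun x => (Z.map (0 : Fin (n + 1)).succ :
        _ ⟶ Z.obj (0 : Fin (n + 2)).succ) ≫ x) hα).trans (comp_eq_zero hZ 0)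
    exact (congrArg F.map (hmap (0 : Fin (n + 1)).succ)).trans
      (map_eq_zero_of_mono F ((ModuleCat.mono_iff_injective _).2 hinj) h1 hz _)

end

section

variable {C : Type u} [Category.{v} C] [Preadditive C]

namespace Chain

variable {d : ℕ}

/-- Exactness of all `Hom(-, Y)` at the inner terms of a sequence. -/
def IsCoexact (P : Chain d C) : Prop :=
  ∀ (i : Fin d) (Y : C) (g : P.obj i.succ.castSucc ⟶ Y),
    (P.map i.succ : P.obj i.succ.succ ⟶ P.obj i.succ.castSucc) ≫ g = 0 →
      ∃ h : P.obj i.castSucc.castSucc ⟶ Y,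
        (P.map i.castSucc : P.obj i.succ.castSucc ⟶ P.obj i.castSucc.castSucc) ≫ h = g

/-- Families of morphisms compatible with the morphisms of two sequences. -/
def IsChainMap {P Q : Chain d C} (f : ∀ i, P.obj i ⟶ Q.obj i) : Prop :=
  ∀ i : Fin (d + 1), P.map i ≫ f i.castSucc = f i.succ ≫ Q.map i

/-- A morphism of the first morphisms of two sequences extends to the sequences. -/
lemma IsCoexact.exists_chainMap {P Q : Chain d C} (hP : P.IsCoexact) (hQ : Q.IsComplex)
    (a : P.obj (Fin.last d).succ ⟶ Q.obj (Fin.last d).succ)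
    (b : P.obj (Fin.last d).castSucc ⟶ Q.obj (Fin.last d).castSucc)
    (hab : P.first ≫ b = a ≫ Q.first) :
    ∃ f : ∀ i, P.obj i ⟶ Q.obj i, IsChainMap f ∧ f (Fin.last d).succ = a ∧
      f (Fin.last d).castSucc = b := by
  have key : ∀ m : Fin (d + 1), ∃ f : ∀ i, P.obj i ⟶ Q.obj i, f (Fin.last d).succ = a ∧
      f (Fin.last d).castSucc = b ∧ ∀ i : Fin (d + 1), m ≤ i →
        P.map i ≫ f i.castSucc = f i.succ ≫ Q.map i := by
    intro m
    induction m using Fin.reverseInduction with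
    | last =>
      refine ⟨Fin.lastCases a (Fin.lastCases b fun i => 0), ?_, ?_, fun i hi => ?_⟩
      · exact Fin.lastCases_last
      · exact (Fin.lastCases_castSucc _).trans Fin.lastCases_last
      · obtain rfl := Fin.last_le_iff.1 hi
        have h₁ : (Fin.lastCases a (Fin.lastCases b fun i => 0) : ∀ i, P.obj i ⟶ Q.obj i)
          (Fin.last d).succ = a := Fin.lastCases_last
        have h₂ : (Fin.lastCases a (Fin.lastCases b fun i => 0) : ∀ i, P.obj i ⟶ Q.obj i)
          (Fin.last d).castSucc = b := (Fin.lastCases_castSucc _).trans Fin.lastCases_last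
        rw [h₁, h₂]
        exact hab
    | cast m ih =>
      obtain ⟨f, ha, hb, hf⟩ := ih
      obtain ⟨h, hh⟩ := hP m _ (f m.succ.castSucc ≫
        (Q.map m.castSucc : Q.obj m.succ.castSucc ⟶ Q.obj m.castSucc.castSucc)) (by
          rw [← Category.assoc]
          refine (congrArg (· ≫ _) (hf m.succ le_rfl)).trans ?_
          rw [Category.assoc]
          exact (congrArg (_ ≫ ·) (hQ m)).trans comp_zero)
      have hne : ∀ j : Fin (d + 1), m.castSucc < j → j.castSucc ≠ m.castSucc.castSucc :=
        fun j hj h => (ne_of_gt hj) (Fin.castSucc_injective _ h)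
      have hne' : ∀ j : Fin (d + 1), m.castSucc ≤ j → j.succ ≠ m.castSucc.castSucc := by
        intro j hj h
        have h1 := congrArg Fin.val h
        have h2 : m.val ≤ j.val := hj
        simp only [Fin.val_succ, Fin.val_castSucc] at h1
        omega
      have hlt : m.castSucc < Fin.last d := Fin.castSucc_lt_last m
      refine ⟨Function.update f m.castSucc.castSucc h, ?_, ?_, fun i hi => ?_⟩
      · rw [Function.update_of_ne (hne' _ hlt.le), ha]
      · rw [Function.update_of_ne (hne _ hlt), hb]
      · rw [Function.update_of_ne (hne' i hi)]
        rcases hi.eq_or_lt with rfl | hi'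
        · rw [Function.update_self]
          exact hh
        · rw [Function.update_of_ne (hne i hi')]
          exact hf i (Fin.castSucc_lt_iff_succ_le.1 hi')
  obtain ⟨f, ha, hb, hf⟩ := key 0
  exact ⟨f, fun i => hf i (Fin.zero_le i), ha, hb⟩

lemma homotopy_step {A B E : C} {m : A ⟶ B} {φ : A ⟶ A} {ψ : B ⟶ B} {g : E ⟶ A} {s : A ⟶ E}
    {t : B ⟶ A} (h : m ≫ ψ = φ ≫ m) (hgm : g ≫ m = 0) (ht : m ≫ t = 𝟙 _ - φ - s ≫ g) :
    m ≫ (𝟙 _ - ψ - t ≫ m) = 0 := by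
  rw [Preadditive.comp_sub, Preadditive.comp_sub, h, ← Category.assoc, ht]
  simp only [Preadditive.sub_comp, Category.assoc, hgm, comp_zero, Category.comp_id,
    Category.id_comp, sub_zero, sub_self]

/-- An endomorphism of a sequence which is the identity at the first two terms is homotopic
to the identity up to a morphism on the last term that vanishes on the next to last one. -/
lemma IsCoexact.exists_homotopy {P : Chain d C} (hP : P.IsCoexact) (hP' : P.IsComplex)
    {f : ∀ i, P.obj i ⟶ P.obj i} (hf : IsChainMap f)
    (hb : f (Fin.last d).castSucc = 𝟙 _) (i : Fin (d + 1)) :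
    ∃ s : P.obj i.castSucc ⟶ P.obj i.succ,
      P.map i ≫ (𝟙 _ - f i.castSucc - s ≫ P.map i) = 0 := by
  induction i using Fin.reverseInduction with
  | last => exact ⟨0, by rw [hb]; simp⟩
  | cast i ih =>
    obtain ⟨s, hs⟩ := ih
    obtain ⟨t, ht⟩ := hP i _ _ hs
    exact ⟨t, homotopy_step (hf i.castSucc) (hP' i) ht⟩

end Chain

/-- Composites of morphisms running through a chain of choices. -/
lemma exists_sequence {D : Type*} [Category D] (p : ℕ → ∀ ⦃A B : D⦄, (A ⟶ B) → Prop)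
    (r : ∀ ⦃A B E : D⦄, (A ⟶ B) → (B ⟶ E) → Prop)
    (h : ∀ (j : ℕ) ⦃A B : D⦄ (f : A ⟶ B), p j f → ∃ (E : D) (g : E ⟶ A), p (j + 1) g ∧ r g f)
    (q : ∀ ⦃A B : D⦄, (A ⟶ B) → Prop) {A B : D} (f : A ⟶ B) (hf : p 0 f) (hq : q f) :
    ∃ (o : ℕ → D) (m : ∀ j, o (j + 1) ⟶ o j), o 0 = B ∧ q (m 0) ∧
      (∀ j, p j (m j)) ∧ ∀ j, r (m (j + 1)) (m j) := by
  choose E g hg hr using h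
  let σ : ℕ → Type _ := fun j => { a : Σ A B : D, A ⟶ B // p j a.2.2 }
  let st : ∀ j, σ j := fun j => Nat.rec ⟨⟨A, B, f⟩, hf⟩
    (fun j a => ⟨⟨E j a.1.2.2 a.2, a.1.1, g j a.1.2.2 a.2⟩, hg _ _ _⟩) j
  exact ⟨fun j => (st j).1.2.1, fun j => (st j).1.2.2, rfl, hq, fun j => (st j).2,
    fun j => hr _ _ _⟩

variable {T : C} {k : Type w} [Field k] [Linear k C] [HasFiniteBiproducts C]

/-- Projective resolutions in terms of `add T`. -/
lemma exists_resolution [IsIdempotentComplete C] (hfin : ∀ X Y : C, Module.Finite k (X ⟶ Y))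
    (d : ℕ) (X : C) :
    ∃ P : Chain d C, P.obj (0 : Fin (d + 1)).castSucc = X ∧ (∀ i : Fin (d + 1), IsAdd T (P.obj i.succ)) ∧
      Function.Surjective ((homFunctor T).map P.final).hom ∧
      ∀ i : Fin d, LinearMap.range ((homFunctor T).map
        (P.map i.succ : P.obj i.succ.succ ⟶ P.obj i.succ.castSucc)).hom =
        LinearMap.ker ((homFunctor T).map
          (P.map i.castSucc : P.obj i.succ.castSucc ⟶ P.obj i.castSucc.castSucc)).hom := by
  obtain ⟨T₀, p, h₀, hp⟩ := exists_epi (isFinDim_hom (T := T) k hfin X)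
  obtain ⟨f, rfl⟩ := h₀.exists_map_eq p
  obtain ⟨o, m, rfl, hs, hT, hex⟩ := exists_sequence (D := C) (fun _ A _ _ => IsAdd T A)
    (fun _ _ _ g f => LinearMap.range ((homFunctor T).map g).hom =
      LinearMap.ker ((homFunctor T).map f).hom)
    (fun _ A B f _ => by
      obtain ⟨Y, g, hY, hg, -⟩ := exists_cover_ker hfin ((homFunctor T).map f)
      exact ⟨Y, g, hY, hg⟩)
    (fun _ _ f => Function.Surjective ((homFunctor T).map f).hom) f h₀ hp
  exact ⟨⟨fun i => o i.val, fun i => m i.val⟩, rfl, fun i => hT i.val, hs, fun i => hex i.val⟩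

variable {n : ℕ} {𝒜 : Angulation (n + 1) C}

/-- Condition (b) for an object of `add T`. -/
lemma exists_angle_of_isAdd {X : C} (hX : IsAdd T X) :
    ∃ Z : SuspSeq (n + 1) 𝒜.susp.functor, 𝒜.IsAngle Z ∧
      Nonempty (Z.obj (0 : Fin (n + 2)).castSucc ≅ X) ∧
      (∀ i : Fin (n + 2), IsAdd T (Z.obj i.succ)) ∧ (homFunctor T).map Z.conn = 0 := by
  obtain ⟨O, hO⟩ := exists_isZero (C := C)
  let Z := SuspSeq.pair 𝒜.susp.functor O X (0 : Fin (n + 2))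
  refine ⟨Z, 𝒜.pair_mem hO X 0, ⟨SuspSeq.pairIsoCastSucc⟩, fun i => ?_,
    (homFunctor T).map_zero _ _⟩
  by_cases hi : i = 0
  · subst hi
    have e : Z.obj (0 : Fin (n + 2)).succ ≅ X := SuspSeq.pairIsoSucc
    exact hX.of_retract e.hom e.inv e.hom_inv_id
  · exact isAdd_of_isZero (SuspSeq.pair_isZero hO
      (fun h => hi (Fin.succ_injective _ h)) (Fin.succ_ne_zero i))

/-- A chain endomorphism of an angle which is the identity at the first two terms becomes a
morphism of angles after a change at the first term. -/
lemma Angulation.exists_hom_of_chainMap {Z : SuspSeq (n + 1) 𝒜.susp.functor} (hZ : 𝒜.IsAngle Z)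
    {γ : ∀ i, Z.obj i ⟶ Z.obj i} (hγ : Chain.IsChainMap (P := Z.toChain) (Q := Z.toChain) γ)
    (hγ₀ : γ (Fin.last (n + 1)).castSucc = 𝟙 _) :
    ∃ φ : Z.Hom Z, ∀ i : Fin (n + 2), φ.app i.castSucc = γ i.castSucc := by
  obtain ⟨s, hs⟩ := Chain.IsCoexact.exists_homotopy (P := Z.toChain)
    (fun i Y g hg => exists_desc hZ i g hg) (isComplex hZ) hγ hγ₀ 0
  obtain ⟨θ, hθ⟩ := exists_desc_final hZ _ hs
  obtain ⟨ω, hω⟩ := 𝒜.susp.functor.map_surjective (𝟙 _ - θ ≫ Z.conn)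
  have h1 : ω ≫ Z.first = Z.first := 𝒜.susp.functor.map_injective (by
    rw [Functor.map_comp, hω, Preadditive.sub_comp, Category.assoc, conn_comp_first hZ, comp_zero,
      sub_zero, Category.id_comp])
  have h2 : Z.conn ≫ 𝒜.susp.functor.map ω = γ (0 : Fin (n + 2)).castSucc ≫ Z.conn := by
    rw [hω, Preadditive.comp_sub, ← Category.assoc, hθ]
    simp only [Preadditive.sub_comp, Category.assoc, Category.comp_id, Category.id_comp]
    rw [final_comp_conn hZ, comp_zero, sub_zero, sub_sub_cancel]
  let f : ∀ i, Z.obj i ⟶ Z.obj i := Fin.lastCases ω fun i => γ i.castSucc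
  have f1 : f (Fin.last (n + 1)).succ = ω := Fin.lastCases_last
  have f2 : ∀ i : Fin (n + 2), f i.castSucc = γ i.castSucc := fun i => Fin.lastCases_castSucc _
  refine ⟨⟨f, fun i => ?_, ?_⟩, f2⟩
  · induction i using Fin.lastCases with
    | last =>
      rw [f1, f2, hγ₀, Category.comp_id]
      exact h1.symm
    | cast i =>
      rw [f2]
      have : f i.castSucc.succ = γ i.castSucc.succ := f2 i.succ
      rw [this]
      exact hγ i.castSucc
  · rw [f1]
    exact h2.trans (congrArg (· ≫ Z.conn) (f2 0).symm)

lemma not_map_id_eq_zero {X : C} (h : Nontrivial (T ⟶ X)) : (homFunctor T).map (𝟙 X) ≠ 0 := by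
  intro h0
  rw [homFunctor_map_eq_zero_iff] at h0
  obtain ⟨x, y, hxy⟩ := h
  have h1 := h0 (x - y)
  rw [Category.comp_id, sub_eq_zero] at h1
  exact hxy h1

open Angulation

variable [IsIdempotentComplete C]

lemma isIso_of_map_eq_id (hfin : ∀ X Y : C, Module.Finite k (X ⟶ Y)) {X : C}
    (hX : Indecomposable X) (hTX : Nontrivial (T ⟶ X)) {ζ : X ⟶ X}
    (hζ : (homFunctor T).map ζ = 𝟙 _) : IsIso ζ := by
  refine (isIso_or_nilpotent k hfin hX ζ).resolve_right fun ⟨N, hN⟩ => not_map_id_eq_zero hTX ?_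
  have h := congrArg ((homFunctor T).mapEnd X) hN
  have h1 : (homFunctor T).mapEnd X (End.of ζ) = 1 := hζ
  rw [map_pow, h1, one_pow] at h
  have h0 : (homFunctor T).mapEnd X 0 = 0 := (homFunctor T).map_zero _ _
  rw [h0] at h
  rw [CategoryTheory.Functor.map_id]
  exact h

/-- An endomorphism of an indecomposable object outside `add T` is an isomorphism if it is
homotopic to the identity. -/
lemma isIso_of_homotopy (hfin : ∀ X Y : C, Module.Finite k (X ⟶ Y)) {X T₀ : C}
    (hX : Indecomposable X) (hTX : Nontrivial (T ⟶ X)) (hadd : ¬ IsAdd T X) (h₀ : IsAdd T T₀)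
    {a : T₀ ⟶ X} (ha : Function.Surjective ((homFunctor T).map a).hom) {ψ : X ⟶ X} {s : X ⟶ T₀}
    (hψ : a ≫ (𝟙 _ - ψ - s ≫ a) = 0) : IsIso ψ := by
  refine (isIso_or_nilpotent k hfin hX ψ).resolve_right fun ⟨N, hN⟩ => hadd ?_
  have hu : IsUnit (1 - End.of ψ) := IsNilpotent.isUnit_one_sub ⟨N + 1, hN⟩
  obtain ⟨y, hy⟩ := hu.exists_left_inv
  replace hy : (𝟙 X - ψ) ≫ End.asHom y = 𝟙 X := hy
  have hζ : (homFunctor T).map ((s ≫ a) ≫ End.asHom y) = 𝟙 _ := by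
    have := (ModuleCat.epi_iff_surjective _).2 ha
    have hw : (homFunctor T).map (𝟙 _ - ψ - s ≫ a) = 0 := by
      rw [← cancel_epi ((homFunctor T).map a), ← Functor.map_comp, hψ, Functor.map_zero, comp_zero]
    rw [Functor.map_sub, sub_eq_zero] at hw
    rw [Functor.map_comp, ← hw, ← Functor.map_comp, hy, CategoryTheory.Functor.map_id]
  have := isIso_of_map_eq_id hfin hX hTX hζ
  refine h₀.of_retract s (a ≫ End.asHom y ≫ inv ((s ≫ a) ≫ End.asHom y)) ?_
  have := IsIso.hom_inv_id ((s ≫ a) ≫ End.asHom y)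
  simpa only [Category.assoc] using this

/-- The Fitting summand of a composite `α ≫ β` such that `β ≫ α` is invertible. -/
lemma exists_iso_of_isFittingEnd {W X Y : C} {α : W ⟶ X} {β : X ⟶ W} (h : IsIso (β ≫ α))
    {ι : Y ⟶ W} {ρ : W ⟶ Y} (hιρ : ι ≫ ρ = 𝟙 Y) (he : IsFittingEnd (α ≫ β) (ρ ≫ ι)) :
    Nonempty (Y ≅ X) := by
  have h1 : β ≫ α ≫ inv (β ≫ α) = 𝟙 X := by
    rw [← Category.assoc, IsIso.hom_inv_id]
  have h2 : inv (β ≫ α) ≫ β ≫ α = 𝟙 X := IsIso.inv_hom_id _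
  have hfit : IsFittingEnd (α ≫ β) (α ≫ inv (β ≫ α) ≫ β) := by
    refine ⟨?_, ⟨α ≫ inv (β ≫ α) ≫ inv (β ≫ α) ≫ β, ?_, ?_⟩, 0, ?_⟩
    · change (α ≫ inv (β ≫ α) ≫ β) ≫ (α ≫ inv (β ≫ α) ≫ β) = _
      simp only [Category.assoc]
      rw [reassoc_of% h1]
    · change (α ≫ inv (β ≫ α) ≫ inv (β ≫ α) ≫ β) ≫ (α ≫ β) = _
      simp only [Category.assoc]
      rw [reassoc_of% h2]
    · change (α ≫ β) ≫ (α ≫ inv (β ≫ α) ≫ inv (β ≫ α) ≫ β) = _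
      simp only [Category.assoc]
      rw [reassoc_of% h1]
    · rw [zero_add, pow_one]
      change (α ≫ inv (β ≫ α) ≫ β) ≫ (α ≫ β) = α ≫ β
      simp only [Category.assoc]
      rw [reassoc_of% h2]
  have h3 := he.unique hfit
  refine ⟨⟨ι ≫ α ≫ inv (β ≫ α), β ≫ ρ, ?_, ?_⟩⟩
  · have : ι ≫ (α ≫ inv (β ≫ α) ≫ β) ≫ ρ = 𝟙 Y := by
      rw [← h3, Category.assoc, hιρ, Category.comp_id, hιρ]
    simpa only [Category.assoc] using this
  · have : β ≫ (ρ ≫ ι) ≫ α ≫ inv (β ≫ α) = 𝟙 X := by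
      rw [h3]
      simp only [Category.assoc]
      rw [reassoc_of% h1, h1]
    simpa only [Category.assoc] using this

/-- If `𝒟` is `d`-cluster tilting and `𝒯(T, -)` is full, then (b) holds. -/
theorem conditionB (hfin : ∀ X Y : C, Module.Finite k (X ⟶ Y))
    (hD : IsDClusterTilting k (n + 1) (imageD T)) (hfull : (homFunctor T).Full) :
    ConditionB 𝒜 T := by
  intro X hX hTX
  by_cases hadd : IsAdd T X
  · exact exists_angle_of_isAdd hadd
  obtain ⟨P, rfl, hT, hs, hex⟩ := exists_resolution (T := T) hfin (n + 1) X
  let F := homFunctor T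
  have hP' : P.IsComplex := fun i => (hT i.succ).map_injective (by
    rw [Functor.map_zero, Functor.map_comp]
    exact comp_eq_zero_of_range_eq_ker (hex i))
  have hPc : P.IsCoexact := fun i Y g hg => by
    obtain ⟨h', hh⟩ := InnerExact.exists_desc (Q := P.mapChain F) hex hs (W := F.obj Y)
      (fun i j h₁ h₂ => ((hD.mem_iff_to _).1 (imageD_obj (P.obj i.castSucc))).2 _ (imageD_obj Y)
        j h₁ h₂) i (F.map g) ((F.map_comp _ _).symm.trans ((congrArg F.map hg).trans
          (F.map_zero _ _)))
    obtain ⟨h, rfl⟩ := F.map_surjective h'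
    exact ⟨h, (hT i.castSucc).map_injective ((F.map_comp _ _).trans hh)⟩
  obtain ⟨Z, hZ, ⟨e⟩⟩ := 𝒜.exists_completion P.first
  obtain ⟨a, b, hab⟩ := exists_isos_of_arrow_iso e
  obtain ⟨α, hα, hαa, hαb⟩ := Chain.IsCoexact.exists_chainMap (P := Z.toChain)
    (fun i Y g hg => exists_desc hZ i g hg) hP' a.hom b.hom hab
  obtain ⟨β, hβ, hβa, hβb⟩ := hPc.exists_chainMap (Q := Z.toChain) (isComplex hZ) a.inv b.inv (by
    rw [Iso.eq_inv_comp, ← Category.assoc, ← hab, Category.assoc, Iso.hom_inv_id]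
    exact Category.comp_id _)
  have hψ : Chain.IsChainMap (P := P) (Q := P) fun i => β i ≫ α i := fun i => by
    rw [← Category.assoc, hβ, Category.assoc, hα, Category.assoc]
  have hγ : Chain.IsChainMap (P := Z.toChain) (Q := Z.toChain) fun i => α i ≫ β i := fun i => by
    rw [← Category.assoc, hα, Category.assoc, hβ, Category.assoc]
  obtain ⟨s, hs'⟩ := hPc.exists_homotopy hP' hψ (by
    rw [hβb, hαb]; exact b.inv_hom_id) 0
  have hiso := isIso_of_homotopy hfin hX hTX hadd (hT 0) hs hs'
  obtain ⟨φ, hφ⟩ := exists_hom_of_chainMap hZ hγ (by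
    rw [hαb, hβb]; exact b.hom_inv_id)
  obtain ⟨Y, ι, ρ, hY, hιρ, hfit, hmap, hconn⟩ := exists_fitting_split hfin hZ φ
  have h₀ := hfit (0 : Fin (n + 2)).castSucc
  rw [hφ] at h₀
  refine ⟨Y, hY, exists_iso_of_isFittingEnd hiso (hιρ _) h₀, fun i => ?_, ?_⟩
  · induction i using Fin.lastCases with
    | last =>
      exact (hT (Fin.last (n + 1))).of_retract (ι _ ≫ a.hom) (a.inv ≫ ρ _) (by
        rw [Category.assoc, Iso.hom_inv_id_assoc, hιρ])
    | cast i =>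
      have h := hfit i.succ.castSucc
      rw [hφ] at h
      obtain ⟨z, hz⟩ := h.exists_eq_comp (hιρ _)
      refine (hT i.castSucc).of_retract (z ≫ α i.succ.castSucc) (β i.succ.castSucc ≫ ρ _) ?_
      have := hιρ i.succ.castSucc
      rw [hz] at this
      simp only [Category.assoc] at this ⊢
      exact this
  · obtain ⟨z, hz⟩ := h₀.exists_eq_comp (hιρ _)
    rw [← Category.assoc] at hz
    rw [hconn]
    refine map_eq_zero_of_epi F ((ModuleCat.epi_iff_surjective _).2 hs) ?_ hz _
    rw [hβ 0, Category.assoc]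
    exact (congrArg (_ ≫ ·) (final_comp_conn hZ)).trans comp_zero

end

namespace Chain

variable {C : Type*} [Category C] {d : ℕ}

/-- The sequence with a single morphism. -/
def single {X Y : C} (f : X ⟶ Y) : Chain 0 C where
  obj := Fin.cases Y fun _ => X
  map := Fin.cases f fun i => i.elim0

/-- Extension of a sequence by a morphism starting at its last object. -/
def cons (P : Chain d C) {W : C} (g : P.obj (0 : Fin (d + 1)).castSucc ⟶ W) : Chain (d + 1) C where
  obj := Fin.cases W P.obj
  map := Fin.cases g P.map

variable [Preadditive C]

lemma IsComplex.cons {P : Chain d C} (hP : P.IsComplex) {W : C}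
    {g : P.obj (0 : Fin (d + 1)).castSucc ⟶ W} (hg : P.final ≫ g = 0) : (P.cons g).IsComplex :=
  Fin.cases hg hP

lemma IsCoexact.cons {C : Type u} [Category.{v} C] [Preadditive C] {P : Chain d C}
    (hP : P.IsCoexact) {W : C} {g : P.obj (0 : Fin (d + 1)).castSucc ⟶ W}
    (hg : ∀ (Y : C) (h : P.obj (0 : Fin (d + 1)).castSucc ⟶ Y), P.final ≫ h = 0 →
      ∃ t, g ≫ t = h) : (P.cons g).IsCoexact :=
  Fin.cases hg hP

end Chain

section

variable {D : Type*} [Category D] [Preadditive D]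

lemma hasFiniteBiproducts_of_essSurj {C : Type*} [Category C] [Preadditive C]
    [HasFiniteBiproducts C] (H : C ⥤ D) [H.Additive] [H.EssSurj] : HasFiniteBiproducts D where
  out n :=
    { has_biproduct := fun f => by
        let X : Fin n → C := fun j => H.objPreimage (f j)
        let e : ∀ j, H.obj (X j) ≅ f j := fun j => H.objObjPreimageIso (f j)
        let b : Bicone f :=
          { pt := H.obj (⨁ X)
            π := fun j => H.map (biproduct.π X j) ≫ (e j).hom
            ι := fun j => (e j).inv ≫ H.map (biproduct.ι X j)
            ι_π := fun i j => by
              by_cases h : i = j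
              · subst h
                rw [Category.assoc, ← Category.assoc (H.map _), ← H.map_comp]
                simp
              · rw [Category.assoc, ← Category.assoc (H.map _), ← H.map_comp,
                  biproduct.ι_π_ne _ h, dif_neg h]
                simp }
        refine hasBiproduct_of_total b ?_
        simp only [b, Category.assoc, Iso.hom_inv_id_assoc, ← H.map_comp]
        rw [← H.map_sum, biproduct.total, H.map_id] }

end

section

variable {C : Type u} [Category.{v} C] [Preadditive C] {T : C} {k : Type w} [Field k] [Linear k C]

/-- Elements of a module are morphisms from `𝒯(T, T)`. -/
lemma exists_hom_apply_id {M : ModuleCat.{v} (End T)ᵐᵒᵖ} (m : M) :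
    ∃ θ : (homFunctor T).obj T ⟶ M, θ.hom (el (𝟙 T)) = m := by
  refine ⟨coordMap (n := 1) (fun _ => 𝟙 T) (fun _ => m), ?_⟩
  rw [coordMap_apply]
  simp [sc_one]

lemma hom_ext_id {M : ModuleCat.{v} (End T)ᵐᵒᵖ} {θ θ' : (homFunctor T).obj T ⟶ M}
    (h : θ.hom (el (𝟙 T)) = θ'.hom (el (𝟙 T))) : θ = θ' := by
  ext
  exact h

lemma surjective_of_forall_comp_eq_zero (S : SerreFunctor k C)
    {M N : ModuleCat.{v} (End T)ᵐᵒᵖ} {f : M ⟶ N}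
    (h : ∀ g : N ⟶ (homFunctor T).obj (S.equiv.functor.obj T), f ≫ g = 0 → g = 0) :
    Function.Surjective f.hom := by
  by_contra hf
  simp only [Function.Surjective, not_forall] at hf
  obtain ⟨y, hy⟩ := hf
  have hy' : (cokπ f).hom y ≠ 0 := fun h0 => hy (by
    have : y ∈ LinearMap.ker (cokπ f).hom := h0
    rw [ker_cokπ] at this
    exact this)
  obtain ⟨θ, hθ⟩ := S.exists_map_apply_ne_zero hy'
  have h0 := h (cokπ f ≫ θ) (by
    rw [← Category.assoc, comp_eq_zero_of_range_eq_ker (ker_cokπ f).symm, zero_comp])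
  exact hθ (congrArg (fun φ => φ.hom y) h0)

lemma injective_of_forall_comp_eq_zero {M N : ModuleCat.{v} (End T)ᵐᵒᵖ} {f : M ⟶ N}
    (h : ∀ g : (homFunctor T).obj T ⟶ M, g ≫ f = 0 → g = 0) : Function.Injective f.hom := by
  rw [← LinearMap.ker_eq_bot, eq_bot_iff]
  intro m hm
  obtain ⟨θ, hθ⟩ := exists_hom_apply_id m
  have : θ = 0 := h θ (hom_ext_id (by
    rw [ModuleCat.hom_comp, LinearMap.comp_apply, hθ]
    exact hm))
  rw [← hθ, this]
  rfl

variable {A : Type*} [Category A] [Preadditive A] (G : A ⥤ ModuleCat.{v} (End T)ᵐᵒᵖ) [G.Full]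
  [G.Faithful] [G.Additive]

lemma surjective_of_epi (hG : ∀ M, imageD T M → ∃ X, Nonempty (G.obj X ≅ M))
    (S : SerreFunctor k C) {X Y : A} (f : X ⟶ Y) [Epi f] : Function.Surjective (G.map f).hom := by
  obtain ⟨W, ⟨e⟩⟩ := hG _ (imageD_obj (S.equiv.functor.obj T))
  refine surjective_of_forall_comp_eq_zero S fun g hg => ?_
  obtain ⟨g', hg'⟩ := G.map_surjective (g ≫ e.inv)
  have h0 : f ≫ g' = 0 := G.map_injective (by
    rw [G.map_comp, hg', ← Category.assoc, hg, zero_comp, G.map_zero])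
  rw [← cancel_mono e.inv, ← hg', (cancel_epi f).1 (h0.trans comp_zero.symm), G.map_zero, zero_comp]

lemma injective_of_mono (hG : ∀ M, imageD T M → ∃ X, Nonempty (G.obj X ≅ M))
    {X Y : A} (f : X ⟶ Y) [Mono f] : Function.Injective (G.map f).hom := by
  obtain ⟨W, ⟨e⟩⟩ := hG _ (imageD_obj T)
  refine injective_of_forall_comp_eq_zero fun g hg => ?_
  obtain ⟨g', hg'⟩ := G.map_surjective (e.hom ≫ g)
  have h0 : g' ≫ f = 0 := G.map_injective (by
    rw [G.map_comp, hg', Category.assoc, hg, comp_zero, G.map_zero])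
  rw [← cancel_epi e.hom, ← hg', (cancel_mono f).1 (h0.trans zero_comp.symm), G.map_zero, comp_zero]

/-- Exactness of modules may be tested by maps to `𝒯(T, S T)`. -/
lemma range_eq_ker_of_desc (hG : ∀ M, imageD T M → ∃ X, Nonempty (G.obj X ≅ M))
    (S : SerreFunctor k C) {X Y Z : A} {f : X ⟶ Y} {g : Y ⟶ Z} (hfg : f ≫ g = 0)
    (h : ∀ (W : A) (t : Y ⟶ W), f ≫ t = 0 → ∃ s, g ≫ s = t) :
    LinearMap.range (G.map f).hom = LinearMap.ker (G.map g).hom := by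
  apply le_antisymm
  · exact range_le_ker_of_comp_eq_zero (by rw [← G.map_comp, hfg, G.map_zero])
  · intro y hy
    obtain ⟨W, ⟨e⟩⟩ := hG _ (imageD_obj (S.equiv.functor.obj T))
    by_contra hne
    have hy' : (cokπ (G.map f)).hom y ≠ 0 := fun h0 => hne (by
      rw [← ker_cokπ]
      exact h0)
    obtain ⟨θ, hθ⟩ := S.exists_map_apply_ne_zero hy'
    obtain ⟨t, ht⟩ := G.map_surjective (cokπ (G.map f) ≫ θ ≫ e.inv)
    obtain ⟨s, hs⟩ := h W t (G.map_injective (by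
      rw [G.map_comp, ht, ← Category.assoc, comp_eq_zero_of_range_eq_ker (ker_cokπ _).symm,
        zero_comp, G.map_zero]))
    have h1 : (G.map t).hom y = 0 := by
      rw [← hs, G.map_comp, ModuleCat.hom_comp, LinearMap.comp_apply, LinearMap.mem_ker.1 hy,
        map_zero]
    apply hθ
    have h2 : cokπ (G.map f) ≫ θ = G.map t ≫ e.hom := by
      rw [ht]
      simp
    have h3 := congrArg (fun φ => φ.hom y) h2
    refine h3.trans ?_
    rw [ModuleCat.hom_comp, LinearMap.comp_apply, h1, map_zero]

/-- Exactness of modules may be tested by maps from `𝒯(T, T)`. -/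
lemma range_eq_ker_of_lift' (hG : ∀ M, imageD T M → ∃ X, Nonempty (G.obj X ≅ M))
    {X Y Z : A} {f : X ⟶ Y} {g : Y ⟶ Z} (hfg : f ≫ g = 0)
    (h : ∀ (W : A) (t : W ⟶ Y), t ≫ g = 0 → ∃ s, s ≫ f = t) :
    LinearMap.range (G.map f).hom = LinearMap.ker (G.map g).hom := by
  apply le_antisymm
  · exact range_le_ker_of_comp_eq_zero (by rw [← G.map_comp, hfg, G.map_zero])
  · intro y hy
    obtain ⟨W, ⟨e⟩⟩ := hG _ (imageD_obj T)
    obtain ⟨θ, hθ⟩ := exists_hom_apply_id y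
    obtain ⟨t, ht⟩ := G.map_surjective (e.hom ≫ θ)
    have hθ0 : θ ≫ G.map g = 0 := hom_ext_id (by
      rw [ModuleCat.hom_comp, LinearMap.comp_apply, hθ]
      exact hy)
    obtain ⟨s, hs⟩ := h W t (G.map_injective (by
      rw [G.map_comp, ht, Category.assoc, hθ0, comp_zero, G.map_zero]))
    have h2 : θ = e.inv ≫ G.map s ≫ G.map f := by
      rw [← G.map_comp, hs, ht, Iso.inv_hom_id_assoc]
    rw [← hθ, h2]
    exact ⟨_, rfl⟩

variable {n : ℕ}

lemma isDExact_of_mono (S : SerreFunctor k C) (hD : IsDClusterTilting k (n + 1) (imageD T))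
    (hG : ∀ M, imageD T M → ∃ X, Nonempty (G.obj X ≅ M)) (hG' : ∀ X, imageD T (G.obj X))
    (P : Chain (n + 1) A) (hm : Mono P.first) (hP : P.IsDCokernel) : P.IsDExact := by
  refine ⟨⟨hP.isComplex, fun i Y g hg => ?_, hm⟩, hP⟩
  have hex : InnerExact (P.mapChain G) := fun i =>
    range_eq_ker_of_desc G hG S (hP.isComplex i) (hP.exact i)
  obtain ⟨h', hh⟩ := hex.exists_lift (injective_of_mono G hG P.first) (W := G.obj Y)
    (fun i j h₁ h₂ => ((hD.mem_iff_to _).1 (hG' Y)).2 _ (hG' (P.obj i.succ)) j h₁ h₂) i (G.map g)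
    ((G.map_comp _ _).symm.trans ((congrArg G.map hg).trans (G.map_zero _ _)))
  obtain ⟨h, rfl⟩ := G.map_surjective h'
  exact ⟨h, G.map_injective ((G.map_comp _ _).trans hh)⟩

lemma isDExact_of_epi (S : SerreFunctor k C) (hD : IsDClusterTilting k (n + 1) (imageD T))
    (hG : ∀ M, imageD T M → ∃ X, Nonempty (G.obj X ≅ M)) (hG' : ∀ X, imageD T (G.obj X))
    (P : Chain (n + 1) A) (hm : Epi P.final) (hP : P.IsDKernel) : P.IsDExact := by
  refine ⟨hP, ⟨hP.isComplex, fun i Y g hg => ?_, hm⟩⟩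
  have hex : InnerExact (P.mapChain G) := fun i =>
    range_eq_ker_of_lift' G hG (hP.isComplex i) (hP.exact i)
  obtain ⟨h', hh⟩ := hex.exists_desc (surjective_of_epi G hG S P.final) (W := G.obj Y)
    (fun i j h₁ h₂ => ((hD.mem_iff_to _).1 (hG' (P.obj i.castSucc))).2 _ (hG' Y) j h₁ h₂) i
    (G.map g) ((G.map_comp _ _).symm.trans ((congrArg G.map hg).trans (G.map_zero _ _)))
  obtain ⟨h, rfl⟩ := G.map_surjective h'
  exact ⟨h, G.map_injective ((G.map_comp _ _).trans hh)⟩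

end

section

variable {C : Type u} [Category.{v} C] [Preadditive C] {T : C} {k : Type w} [Field k] [Linear k C]
  {n : ℕ}

lemma isFinDim_cokObj {M N : ModuleCat.{v} (End T)ᵐᵒᵖ} (f : M ⟶ N) (hN : IsFinDim k N) :
    IsFinDim k (cokObj f) := isFinDim_of_surjective _ (cokπ_surjective f) hN

lemma isFinDim_kerObj {M N : ModuleCat.{v} (End T)ᵐᵒᵖ} (f : M ⟶ N) (hM : IsFinDim k M) :
    IsFinDim k (kerObj f) := isFinDim_of_injective _ (kerι_injective f) hM

section Approximations

variable {L M N D : ModuleCat.{v} (End T)ᵐᵒᵖ} {u : L ⟶ M} {q : M ⟶ N} {m : ℕ}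

lemma SES.extZero_of_approximation (h : SES u q)
    (hM : ∀ j, 1 ≤ j → j < n + 1 → ExtZero M D j)
    (hL : ∀ j, 1 ≤ j → j ≤ m → j < n + 1 → ExtZero L D j)
    (hu : ∀ φ : L ⟶ D, ∃ ψ, u ≫ ψ = φ) (j : ℕ) (h₁ : 1 ≤ j) (h₂ : j ≤ m + 1) (h₃ : j < n + 1) :
    ExtZero N D j := by
  obtain ⟨j, rfl⟩ := Nat.exists_eq_add_of_le' h₁
  rcases j with _ | j
  · exact h.extZero_one' (hM 1 le_rfl h₃) hu
  · exact h.extZero_succ' (hM _ h₁ h₃) (hL _ (by omega) (by omega) (by omega))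

lemma SES.extZero_of_approximation' (h : SES u q)
    (hM : ∀ j, 1 ≤ j → j < n + 1 → ExtZero D M j)
    (hN : ∀ j, 1 ≤ j → j ≤ m → j < n + 1 → ExtZero D N j)
    (hq : ∀ φ : D ⟶ N, ∃ ψ, ψ ≫ q = φ) (j : ℕ) (h₁ : 1 ≤ j) (h₂ : j ≤ m + 1) (h₃ : j < n + 1) :
    ExtZero D L j := by
  obtain ⟨j, rfl⟩ := Nat.exists_eq_add_of_le' h₁
  rcases j with _ | j
  · exact h.extZero_one (hM 1 le_rfl h₃) hq
  · exact h.extZero_succ (hM _ h₁ h₃) (hN _ (by omega) (by omega) (by omega))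

end Approximations

variable [HasFiniteBiproducts C]
  {A : Type*} [Category A] [Preadditive A] (G : A ⥤ ModuleCat.{v} (End T)ᵐᵒᵖ) [G.Full]
  [G.Faithful] [G.Additive]

lemma exists_mono_leftApproximation (S : SerreFunctor k C)
    (hD : IsDClusterTilting k (n + 1) (imageD T))
    (hG : ∀ M, imageD T M → ∃ X, Nonempty (G.obj X ≅ M))
    {M : ModuleCat.{v} (End T)ᵐᵒᵖ} (hM : IsFinDim k M) :
    ∃ (W : A) (u : M ⟶ G.obj W), Function.Injective u.hom ∧
      ∀ Y, imageD T Y → ∀ g : M ⟶ Y, ∃ h, u ≫ h = g := by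
  obtain ⟨X, u, hX, hu⟩ := hD.exists_leftApproximation M hM
  obtain ⟨W, ⟨e⟩⟩ := hG X hX
  have hu' : ∀ Y, imageD T Y → ∀ g : M ⟶ Y, ∃ h, (u ≫ e.inv) ≫ h = g := fun Y hY g => by
    obtain ⟨h, hh⟩ := hu Y g hY
    exact ⟨e.hom ≫ h, by simp [hh]⟩
  refine ⟨W, u ≫ e.inv, ?_, hu'⟩
  obtain ⟨I, v, -, hv⟩ := exists_mono S hM
  obtain ⟨h, hh⟩ := hu' _ (imageD_obj _) v
  refine injective_of_comp (g := h) ?_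
  rwa [hh]

lemma exists_epi_rightApproximation (hD : IsDClusterTilting k (n + 1) (imageD T))
    (hG : ∀ M, imageD T M → ∃ X, Nonempty (G.obj X ≅ M))
    {M : ModuleCat.{v} (End T)ᵐᵒᵖ} (hM : IsFinDim k M) :
    ∃ (W : A) (u : G.obj W ⟶ M), Function.Surjective u.hom ∧
      (∀ Y, imageD T Y → ∀ g : Y ⟶ M, ∃ h, h ≫ u = g) ∧ (imageD T M → Mono u) := by
  by_cases hMD : imageD T M
  · obtain ⟨W, ⟨e⟩⟩ := hG M hMD
    exact ⟨W, e.hom, (ModuleCat.epi_iff_surjective _).1 inferInstance,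
      fun Y _ g => ⟨g ≫ e.inv, by simp⟩, fun _ => inferInstance⟩
  obtain ⟨X, u, hX, hu⟩ := hD.exists_rightApproximation M hM
  obtain ⟨W, ⟨e⟩⟩ := hG X hX
  have hu' : ∀ Y, imageD T Y → ∀ g : Y ⟶ M, ∃ h, h ≫ e.hom ≫ u = g := fun Y hY g => by
    obtain ⟨h, hh⟩ := hu Y g hY
    exact ⟨h ≫ e.inv, by simp [hh]⟩
  refine ⟨W, e.hom ≫ u, ?_, hu', fun h => absurd h hMD⟩
  obtain ⟨I, v, -, hv⟩ := exists_epi hM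
  obtain ⟨h, hh⟩ := hu' _ (imageD_obj _) v
  refine surjective_of_comp (f := h) ?_
  rwa [hh]

/-- The first terms of a `d`-cokernel. -/
lemma exists_partial_dCokernel (hfin : ∀ X Y : C, Module.Finite k (X ⟶ Y)) (S : SerreFunctor k C)
    (hD : IsDClusterTilting k (n + 1) (imageD T))
    (hG : ∀ M, imageD T M → ∃ X, Nonempty (G.obj X ≅ M)) (hG' : ∀ X, imageD T (G.obj X))
    {X Y : A} (f : X ⟶ Y) (m : ℕ) :
    ∃ P : Chain m A, Nonempty (Arrow.mk P.first ≅ Arrow.mk f) ∧ P.IsComplex ∧ P.IsCoexact ∧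
      ∀ D, imageD T D → ∀ j, 1 ≤ j → j ≤ m → j < n + 1 → ExtZero (cokObj (G.map P.final)) D j := by
  induction m with
  | zero =>
    exact ⟨Chain.single f, ⟨Iso.refl _⟩, fun i => i.elim0, fun i => i.elim0,
      fun D _ j h₁ h₂ => by omega⟩
  | succ m ih =>
    obtain ⟨P, hf, hc, hex, hext⟩ := ih
    obtain ⟨W, u, hu, hu'⟩ := exists_mono_leftApproximation G S hD hG
      (isFinDim_cokObj (G.map P.final) (imageD_isFinDim hfin (hG' _)))
    obtain ⟨g, hg⟩ := G.map_surjective (cokπ (G.map P.final) ≫ u)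
    have hπ := comp_eq_zero_of_range_eq_ker (ker_cokπ (G.map P.final)).symm
    refine ⟨P.cons g, hf, hc.cons (G.map_injective ?_), hex.cons fun V h hh => ?_,
      fun D hDD j h₁ h₂ h₃ => ?_⟩
    · rw [G.map_comp, hg, ← Category.assoc, hπ, zero_comp, G.map_zero]
    · obtain ⟨h', hh'⟩ := exists_desc_of_ker_le _ (cokπ_surjective (G.map P.final)) (G.map h) (by
        rw [ker_cokπ]
        exact range_le_ker_of_comp_eq_zero (by rw [← G.map_comp, hh, G.map_zero]))
      obtain ⟨t', ht'⟩ := hu' _ (hG' V) h'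
      obtain ⟨t, rfl⟩ := G.map_surjective t'
      exact ⟨t, G.map_injective (by rw [G.map_comp, hg, Category.assoc, ht', hh'])⟩
    · have hs : SES u (cokπ (G.map g)) := ⟨hu, by
        rw [ker_cokπ, hg, range_comp_of_surjective _ _ (cokπ_surjective _)], cokπ_surjective _⟩
      exact hs.extZero_of_approximation (fun j h₁ h₂ => ((hD.mem_iff_to _).1 (hG' W)).2 D hDD j h₁ h₂)
        (hext D hDD) (hu' D hDD) j h₁ h₂ h₃

lemma exists_dCokernel (hfin : ∀ X Y : C, Module.Finite k (X ⟶ Y)) (S : SerreFunctor k C)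
    (hD : IsDClusterTilting k (n + 1) (imageD T))
    (hG : ∀ M, imageD T M → ∃ X, Nonempty (G.obj X ≅ M)) (hG' : ∀ X, imageD T (G.obj X))
    {X Y : A} (f : X ⟶ Y) :
    ∃ P : Chain (n + 1) A, P.IsDCokernel ∧ Nonempty (Arrow.mk P.first ≅ Arrow.mk f) := by
  obtain ⟨P, hf, hc, hex, hext⟩ := exists_partial_dCokernel G hfin S hD hG hG' f n
  obtain ⟨W, ⟨e⟩⟩ := hG _ ((hD.mem_iff_to (cokObj (G.map P.final))).2
    ⟨isFinDim_cokObj _ (imageD_isFinDim hfin (hG' _)), fun D hDD j h₁ h₂ =>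
      hext D hDD j h₁ (by omega) h₂⟩)
  obtain ⟨g, hg⟩ := G.map_surjective (cokπ (G.map P.final) ≫ e.inv)
  have hπ := comp_eq_zero_of_range_eq_ker (ker_cokπ (G.map P.final)).symm
  refine ⟨P.cons g, ⟨hc.cons (G.map_injective ?_), hex.cons fun V h hh => ?_, ?_⟩, hf⟩
  · rw [G.map_comp, hg, ← Category.assoc, hπ, zero_comp, G.map_zero]
  · obtain ⟨h', hh'⟩ := exists_desc_of_ker_le _ (cokπ_surjective (G.map P.final)) (G.map h) (by
      rw [ker_cokπ]
      exact range_le_ker_of_comp_eq_zero (by rw [← G.map_comp, hh, G.map_zero]))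
    obtain ⟨t, ht⟩ := G.map_surjective (e.hom ≫ h')
    exact ⟨t, G.map_injective (by
      rw [G.map_comp, hg, ht, Category.assoc, Iso.inv_hom_id_assoc, hh'])⟩
  · have := (ModuleCat.epi_iff_surjective _).2 (cokπ_surjective (G.map P.final))
    have : Epi (G.map g) := by rw [hg]; infer_instance
    exact G.epi_of_epi_map (f := g) this

lemma exists_dKernel (hfin : ∀ X Y : C, Module.Finite k (X ⟶ Y))
    (hD : IsDClusterTilting k (n + 1) (imageD T))
    (hG : ∀ M, imageD T M → ∃ X, Nonempty (G.obj X ≅ M)) (hG' : ∀ X, imageD T (G.obj X))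
    {X Y : A} (f : X ⟶ Y) :
    ∃ P : Chain (n + 1) A, P.IsDKernel ∧ Nonempty (Arrow.mk P.final ≅ Arrow.mk f) := by
  have step : ∀ (m : ℕ) ⦃A' B' : A⦄ (f : A' ⟶ B'),
      (∀ D, imageD T D → ∀ j, 1 ≤ j → j ≤ m → j < n + 1 → ExtZero D (kerObj (G.map f)) j) →
      ∃ (E : A) (g : E ⟶ A'),
        (∀ D, imageD T D → ∀ j, 1 ≤ j → j ≤ m + 1 → j < n + 1 → ExtZero D (kerObj (G.map g)) j) ∧
        g ≫ f = 0 ∧ (∀ V (h : V ⟶ A'), h ≫ f = 0 → ∃ t, t ≫ g = h) ∧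
        (imageD T (kerObj (G.map f)) → Mono g) := by
    intro m A' B' f hm
    obtain ⟨W, u, hu, hu', hmono⟩ := exists_epi_rightApproximation G hD hG
      (isFinDim_kerObj (G.map f) (imageD_isFinDim hfin (hG' _)))
    obtain ⟨g, hg⟩ := G.map_surjective (u ≫ kerι (G.map f))
    have hι := comp_eq_zero_of_range_eq_ker (range_kerι (G.map f))
    refine ⟨W, g, fun D hDD j h₁ h₂ h₃ => ?_, G.map_injective ?_, fun V h hh => ?_, fun hk => ?_⟩
    · have hs : SES (kerι (G.map g)) u := ⟨kerι_injective _, by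
        rw [range_kerι, hg, ker_comp_of_injective _ _ (kerι_injective _)], hu⟩
      exact hs.extZero_of_approximation'
        (fun j h₁ h₂ => ((hD.mem_iff_from _).1 (hG' W)).2 D hDD j h₁ h₂)
        (hm D hDD) (hu' D hDD) j h₁ h₂ h₃
    · rw [G.map_comp, hg, Category.assoc, hι, comp_zero, G.map_zero]
    · obtain ⟨h', hh'⟩ := exists_lift_of_range_le _ (kerι_injective (G.map f)) (G.map h) (by
        rw [range_kerι]
        exact range_le_ker_of_comp_eq_zero (by rw [← G.map_comp, hh, G.map_zero]))
      obtain ⟨t', ht'⟩ := hu' _ (hG' V) h'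
      obtain ⟨t, rfl⟩ := G.map_surjective t'
      exact ⟨t, G.map_injective (by rw [G.map_comp, hg, ← Category.assoc, ht', hh'])⟩
    · have := hmono hk
      have := (ModuleCat.mono_iff_injective _).2 (kerι_injective (G.map f))
      have : Mono (G.map g) := by rw [hg]; infer_instance
      exact G.mono_of_mono_map (f := g) this

  obtain ⟨o, m, -, hf, hext, hr⟩ := exists_sequence (D := A)
    (fun m _ _ f => ∀ D, imageD T D → ∀ j, 1 ≤ j → j ≤ m → j < n + 1 → ExtZero D (kerObj (G.map f)) j)
    (fun A' _ _ g f => g ≫ f = 0 ∧ (∀ V (h : V ⟶ _), h ≫ f = 0 → ∃ t, t ≫ g = h) ∧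
      (imageD T (kerObj (G.map f)) → Mono g)) step
    (fun _ _ g => Nonempty (Arrow.mk g ≅ Arrow.mk f)) f
    (fun D _ j h₁ h₂ => by omega) ⟨Iso.refl _⟩
  refine ⟨⟨fun i => o i.val, fun i => m i.val⟩, ⟨fun i => (hr i.val).1,
    fun i => (hr i.val).2.1, (hr n).2.2 ?_⟩, hf⟩
  exact (hD.mem_iff_from _).2 ⟨isFinDim_kerObj _ (imageD_isFinDim hfin (hG' _)),
    fun D hDD j h₁ h₂ => hext n D hDD j h₁ (by omega) h₂⟩

end

section

variable {C : Type u} [Category.{v} C] [Preadditive C] {T : C} {k : Type w} [Field k] [Linear k C]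
  {n : ℕ} [HasFiniteBiproducts C] [IsIdempotentComplete C]

section

variable {A : Type*} [Category A] [Preadditive A] (G : A ⥤ ModuleCat.{v} (End T)ᵐᵒᵖ) [G.Full]
  [G.Faithful] [G.Additive]

lemma isIdempotentComplete_of_image (hfin : ∀ X Y : C, Module.Finite k (X ⟶ Y))
    (hfull : (homFunctor T).Full)
    (hG : ∀ M, imageD T M → ∃ X, Nonempty (G.obj X ≅ M)) (hG' : ∀ X, imageD T (G.obj X)) :
    IsIdempotentComplete A where
  idempotents_split X e he := by
    have hid : G.map e ≫ G.map e = G.map e := by rw [← G.map_comp, he]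
    have h1 : imι (G.map e) ≫ imπ (G.map e) = 𝟙 _ := by
      have := (ModuleCat.epi_iff_surjective _).2 (imπ_surjective (G.map e))
      have := (ModuleCat.mono_iff_injective _).2 (imι_injective (G.map e))
      rw [← cancel_epi (imπ (G.map e)), ← cancel_mono (imι (G.map e)), Category.comp_id]
      rw [← Category.assoc, imπ_imι, Category.assoc, imπ_imι, hid]
    obtain ⟨W, ⟨ε⟩⟩ := hG _ (imageD_of_retract (k := k) hfin hfull _ _ h1 (hG' X))
    obtain ⟨i, hi⟩ := G.map_surjective (ε.hom ≫ imι (G.map e))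
    obtain ⟨r, hr⟩ := G.map_surjective (imπ (G.map e) ≫ ε.inv)
    refine ⟨W, i, r, G.map_injective ?_, G.map_injective ?_⟩
    · rw [G.map_comp, hi, hr, Category.assoc, ← Category.assoc (imι _), h1, Category.id_comp,
        Iso.hom_inv_id, CategoryTheory.Functor.map_id]
    · rw [G.map_comp, hi, hr, Category.assoc, Iso.inv_hom_id_assoc, imπ_imι]

/-- A category that is equivalent to a `d`-cluster tilting subcategory is `d`-abelian. -/
theorem isDAbelian_of_isDClusterTilting (hfin : ∀ X Y : C, Module.Finite k (X ⟶ Y))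
    (S : SerreFunctor k C)
    (hD : IsDClusterTilting k (n + 1) (imageD T)) (hfull : (homFunctor T).Full)
    (hG : ∀ M, imageD T M → ∃ X, Nonempty (G.obj X ≅ M)) (hG' : ∀ X, imageD T (G.obj X))
    (h : HasFiniteBiproducts A) : IsDAbelian (n + 1) A where
  hasFiniteBiproducts := h
  isIdempotentComplete := isIdempotentComplete_of_image (k := k) G hfin hfull hG hG'
  exists_dKernel _ _ f := exists_dKernel G hfin hD hG hG' f
  exists_dCokernel _ _ f := exists_dCokernel G hfin S hD hG hG' f
  isDExact_of_mono P := isDExact_of_mono G S hD hG hG' P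
  isDExact_of_epi P := isDExact_of_epi G S hD hG hG' P

end

lemma inducedFunctor_isEquivalence (hfull : (homFunctor T).Full) :
    (inducedFunctor T).IsEquivalence where
  full := ⟨fun {X Y} g => by
    obtain ⟨f, hf⟩ := (homFunctor T).map_surjective ((imageD T).ι.map g)
    exact ⟨(Quotient.functor _).map f, (imageD T).ι.map_injective hf⟩⟩
  faithful := ⟨fun {X Y} f g hfg => by
    obtain ⟨f, rfl⟩ := (Quotient.functor _).map_surjective f
    obtain ⟨g, rfl⟩ := (Quotient.functor _).map_surjective g
    exact CategoryTheory.Quotient.sound _ ((idealRel_iff T f g).2 (congrArg (imageD T).ι.map hfg))⟩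
  essSurj := ⟨fun ⟨M, X, ⟨e⟩⟩ => ⟨(Quotient.functor _).obj X, ⟨(imageD T).isoMk e⟩⟩⟩

instance : (Quotient.functor (idealRel T)).Additive where

instance : (inducedFunctor T).Additive where
  map_add {_ _ f g} := by
    obtain ⟨f, rfl⟩ := (Quotient.functor _).map_surjective f
    obtain ⟨g, rfl⟩ := (Quotient.functor _).map_surjective g
    exact (imageD T).ι.map_injective ((homFunctor T).map_add (f := f) (g := g))

instance : (homFunctor T).toEssImage.Additive where
  map_add {_ _ f g} := (imageD T).ι.map_injective ((homFunctor T).map_add (f := f) (g := g))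

theorem isDAbelian_imageD (hfin : ∀ X Y : C, Module.Finite k (X ⟶ Y)) (S : SerreFunctor k C)
    (hD : IsDClusterTilting k (n + 1) (imageD T)) (hfull : (homFunctor T).Full) :
    IsDAbelian (n + 1) (imageD T).FullSubcategory :=
  isDAbelian_of_isDClusterTilting (imageD T).ι hfin S hD hfull
    (fun M hM => ⟨⟨M, hM⟩, ⟨Iso.refl _⟩⟩) (fun X => X.property)
    (hasFiniteBiproducts_of_essSurj (homFunctor T).toEssImage)

theorem isDAbelian_quotient (hfin : ∀ X Y : C, Module.Finite k (X ⟶ Y)) (S : SerreFunctor k C)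
    (hD : IsDClusterTilting k (n + 1) (imageD T)) (hfull : (homFunctor T).Full) :
    IsDAbelian (n + 1) (QuotientByIdeal T) :=
  have := inducedFunctor_isEquivalence hfull
  isDAbelian_of_isDClusterTilting (inducedFunctor T ⋙ (imageD T).ι) hfin S hD hfull
    (fun _ ⟨X, ⟨e⟩⟩ => ⟨(Quotient.functor _).obj X, ⟨e⟩⟩)
    (fun X => ((inducedFunctor T).obj X).property)
    (hasFiniteBiproducts_of_essSurj (Quotient.functor (idealRel T)))

end

end DAngulated

end

theorem theorem0p4 {k : Type w} [Field k] [IsAlgClosed k] {d : ℕ} (hd : 1 ≤ d)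
    {C : Type u} [Category.{v} C] [Preadditive C] [Linear k C] [HasFiniteBiproducts C]
    [IsIdempotentComplete C] (hfin : ∀ X Y : C, Module.Finite k (X ⟶ Y))
    (𝒜 : DAngulated.Angulation d C) (S : DAngulated.SerreFunctor k C) (T : C) :
    List.TFAE
      [ DAngulated.IsDClusterTilting k d (DAngulated.imageD T) ∧ (DAngulated.homFunctor T).Full,
        DAngulated.ConditionA k 𝒜 T ∧ DAngulated.ConditionA' k 𝒜 S T ∧ DAngulated.ConditionB 𝒜 T,
        DAngulated.ConditionStrongA k 𝒜 T ∧ DAngulated.ConditionStrongA' k 𝒜 S T ∧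
          DAngulated.ConditionB 𝒜 T ] ∧
    (DAngulated.IsDClusterTilting k d (DAngulated.imageD T) ∧ (DAngulated.homFunctor T).Full →
      (DAngulated.inducedFunctor T).IsEquivalence ∧
      DAngulated.IsDAbelian d (DAngulated.imageD T).FullSubcategory ∧
      DAngulated.IsDAbelian d (DAngulated.QuotientByIdeal T)) := by
  obtain ⟨n, rfl⟩ := Nat.exists_eq_add_of_le' hd
  refine ⟨?_, fun ⟨hD, hfull⟩ => ⟨DAngulated.inducedFunctor_isEquivalence hfull,
    DAngulated.isDAbelian_imageD hfin S hD hfull, DAngulated.isDAbelian_quotient hfin S hD hfull⟩⟩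
  tfae_have 1 → 3 := fun ⟨hD, hfull⟩ => ⟨DAngulated.conditionStrongA hfin hD hfull,
    DAngulated.conditionStrongA' hfin S hD hfull, DAngulated.conditionB hfin hD hfull⟩
  tfae_have 3 → 2 := fun ⟨ha, ha', hb⟩ =>
    ⟨fun M hM hext T₁ T₀ h₁ h₀ f p hmin =>
      have ⟨Z, hZ, e, h⟩ := ha M hM hext T₁ T₀ h₁ h₀ f p hmin
      ⟨Z, hZ, e, _, h⟩,
    fun N hN hext T₁ T₀ h₁ h₀ g u hmin =>
      have ⟨Z, hZ, e, h⟩ := ha' N hN hext T₁ T₀ h₁ h₀ g u hmin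
      ⟨Z, hZ, e, _, h⟩, hb⟩
  tfae_have 2 → 1 := fun ⟨ha, ha', hb⟩ => DAngulated.isDClusterTilting_of_conditions hfin ha ha' hb
  tfae_finish
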